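/- \textbf{Theorem 6 (MS-Adjustment).} Setting. Let $G$ be a directed acyclic graph (an m-graph augmented with a selection indicator) whose nodes are: finitely many discrete observable variables $\mathbf V=\mathbf V_o\cup\mathbf V_m$ ($\mathbf V_o$ always observed, $\mathbf V_m$ possibly missing), finitely many unobserved variables $\mathbf U$ (a bidirected arrow stands for an unobserved common parent), one binary missingness indicator $R_V$ for each $V\in\mathbf V_m$ ($R_V=1$ iff $V$ is observed), and a binary selection indicator $S$ ($S=1$ iff the unit is in the sample); no indicator $R_V$ or $S$ is a parent of a variable in $\mathbf V\cup\mathbf U$. For $\mathbf C\subseteq\mathbf V_m$ let $\mathbf R_{\mathbf C}=\{R_V: V\in\mathbf C\}$. Let $\mathbf X,\mathbf Y,\mathbf Z\subseteq\mathbf V$ be pairwise disjoint and $\mathbf W=\mathbf V_m\cap(\mathbf X\cup\mathbf Y\cup\mathbf Z)$. Let $G_{\overline{\mathbf X}}$ (resp. $G_{\underline{\mathbf X}}$) be $G$ with all edges into (resp. out of) $\mathbf X$ deleted. Every node counts as its own ancestor and descendant. A path from $\mathbf X$ to $\mathbf Y$ starts at a node of $\mathbf X$ and ends at a node of $\mathbf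 Y$; it is causal if it is directed from its start to its end, and proper if only its first node is in $\mathbf X$. Blocking and d-separation are the usual ones. The set $\mathbf Z$ is an \emph{ms-adjustment set} for the causal effect of $\mathbf X$ on $\mathbf Y$ if, for every structural causal model with finite variable ranges compatible with $G$ and all values $\mathbf x,\mathbf y$ for which the conditional probabilities below are defined (that is, $P(\mathbf R_{\mathbf W}=1,S=1)>0$, and $P(\mathbf x,\mathbf z,\mathbf R_{\mathbf W}=1,S=1)>0$ whenever $P(\mathbf z,\mathbf R_{\mathbf W}=1,S=1)>0$), $$P(\mathbf y\mid do(\mathbf x))=\sum_{\mathbf z}P(\mathbf y\mid\mathbf x,\mathbf z,\mathbf R_{\mathbf W}=1,S=1)\,P(\mathbf z\mid\mathbf R_{\mathbf W}=1,S=1),$$ where the sum is over the $\mathbf z$ with $P(\mathbf z,\mathbf R_{\mathbf W}=1,S=1)>0$. The set $\mathbf Z$ satisfies the \emph{ms-adjustment criterion} relative to $(\mathbf X,\mathbf Y)$ if (a) no element of $\mathbf Z$ is a descendant in $G_{\overline{\mathbf X}}$ of any node $N\notin\mathbf X$ that lies on a proper causal path from $\mathbf X$ to $\mathbf Y$; (b)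 every proper non-causal path from $\mathbf X$ to $\mathbf Y$ in $G$ is blocked by $\mathbf Z\cup\mathbf R_{\mathbf W}\cup\{S\}$; (c) $\mathbf Y$ is d-separated from $\mathbf R_{\mathbf W}\cup\{S\}$ given $\mathbf X$ in $G_{\overline{\mathbf X}}$; (d) every $X\in\mathbf X$ that is an ancestor of a node of $\mathbf R_{\mathbf W}\cup\{S\}$ is d-separated from $\mathbf Y$ (given $\emptyset$) in $G_{\underline{\mathbf X}}$. Claim. $\mathbf Z$ is an ms-adjustment set for the causal effect of $\mathbf X$ on $\mathbf Y$ if and only if $\mathbf Z$ satisfies the ms-adjustment criterion relative to $(\mathbf X,\mathbf Y)$. -/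

import Mathlib

open scoped BigOperators

/-! ## Directed graphs: paths, blocking, d-separation

A directed graph on `N` is given by its edge relation `E : N → N → Prop` (`E a b` means `a → b`).
Since the graphs below are acyclic, a path is determined by its list of nodes. -/

namespace CausalGraph

variable {N : Type*}

/-- `b` is a descendant of `a` (every node is a descendant and an ancestor of itself). -/
def Desc (E : N → N → Prop) (a b : N) : Prop := Relation.ReflTransGen E a b

/-- `p` is a path from `a` to `b` in the graph: distinct nodes, consecutive ones joined by an edge
of either orientation. -/
def IsPath (E : N → N → Prop) (a b : N) (p : List N) : Prop :=
  p.head? = some a ∧ p.getLast? = some b ∧ p.Nodup ∧ p.IsChain (fun u v => E u v ∨ E v u)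

/-- All edges of the node sequence `p` point forward; a path with this property is *causal*. -/
def IsCausal (E : N → N → Prop) (p : List N) : Prop := p.IsChain E

/-- `p` meets `X` at most in its first node. -/
def IsProper (X : Set N) (p : List N) : Prop := ∀ n ∈ p.tail, n ∉ X

/-- `p` is blocked by `C`: some inner node `b` of `p` is a non-collider belonging to `C`, or is a
collider none of whose descendants (itself included) belongs to `C`. -/
def Blocked (E : N → N → Prop) (C : Set N) (p : List N) : Prop :=
  ∃ a b c : N, [a, b, c] <:+: p ∧
    ((¬ (E a b ∧ E c b) ∧ b ∈ C) ∨ ((E a b ∧ E c b) ∧ ∀ d ∈ C, ¬ Desc E b d))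

/-- `A` is d-separated from `B` given `C`. -/
def DSep (E : N → N → Prop) (A B C : Set N) : Prop :=
  ∀ a ∈ A, ∀ b ∈ B, ∀ p : List N, IsPath E a b p → Blocked E C p

/-- Delete all edges into `X`. -/
def deleteIn (E : N → N → Prop) (X : Set N) : N → N → Prop := fun a b => E a b ∧ b ∉ X

/-- Delete all edges out of `X`. -/
def deleteOut (E : N → N → Prop) (X : Set N) : N → N → Prop := fun a b => E a b ∧ a ∉ X

end CausalGraph

/-! ## m-graphs augmented with a selection indicator -/

/-- The nodes: observable variables (those in `Vo` are always observed, those in `Vm` may be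
missing), unobserved variables `U`, one missingness indicator for each variable in `Vm`, and the
selection indicator. -/
inductive MNode (Vo Vm U : Type*) where
  | obs (v : Vo ⊕ Vm) : MNode Vo Vm U
  | lat (u : U) : MNode Vo Vm U
  | miss (m : Vm) : MNode Vo Vm U
  | sel : MNode Vo Vm U
  deriving DecidableEq, Fintype

/-- Missingness indicators and the selection indicator. -/
def MNode.IsIndicator {Vo Vm U : Type*} : MNode Vo Vm U → Prop
  | .obs _ => False
  | .lat _ => False
  | .miss _ => True
  | .sel => True

/-- An m-graph augmented with a selection indicator: a directed acyclic graph in which no indicator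
is a parent of a (measured or unmeasured) substantive variable. A bidirected arrow between two
nodes is represented by an unobserved common parent in `U`. -/
structure MGraph (Vo Vm U : Type*) where
  edge : MNode Vo Vm U → MNode Vo Vm U → Prop
  acyclic : ∀ n, ¬ Relation.TransGen edge n n
  indicator_edge : ∀ i n, i.IsIndicator → edge i n → n.IsIndicator

/-! ## Structural causal models -/

/-- The range of each node: `D v` for an observable variable, `L u` for an unobserved variable,
and `Bool` for the binary indicators (`true` is the value `1`). -/
def MNode.Dom {Vo Vm U : Type*} (D : Vo ⊕ Vm → Type) (L : U → Type) : MNode Vo Vm U → Type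
  | .obs v => D v
  | .lat u => L u
  | .miss _ => Bool
  | .sel => Bool

instance {Vo Vm U : Type*} (D : Vo ⊕ Vm → Type) (L : U → Type)
    [∀ v, Fintype (D v)] [∀ u, Fintype (L u)] (n : MNode Vo Vm U) : Fintype (n.Dom D L) :=
  match n with
  | .obs v => inferInstanceAs (Fintype (D v))
  | .lat u => inferInstanceAs (Fintype (L u))
  | .miss _ => inferInstanceAs (Fintype Bool)
  | .sel => inferInstanceAs (Fintype Bool)

/-- A structural causal model compatible with `G`: finite ranges, mutually independent exogenous
noise variables (one for each node, with distribution `noiseProb`), and a structural function for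
each node, which takes the values of the parents and of the noise. -/
structure MGraph.SCM {Vo Vm U : Type*} (G : MGraph Vo Vm U) where
  D : Vo ⊕ Vm → Type
  L : U → Type
  Noise : MNode Vo Vm U → Type
  [fintypeD : ∀ v, Fintype (D v)]
  [nonemptyD : ∀ v, Nonempty (D v)]
  [fintypeL : ∀ u, Fintype (L u)]
  [nonemptyL : ∀ u, Nonempty (L u)]
  [fintypeNoise : ∀ n, Fintype (Noise n)]
  noiseProb : ∀ n, Noise n → ℝ
  noiseProb_nonneg : ∀ n e, 0 ≤ noiseProb n e
  noiseProb_sum : ∀ n, ∑ e, noiseProb n e = 1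
  func : ∀ n, (∀ p : {p // G.edge p n}, p.1.Dom D L) → Noise n → n.Dom D L

namespace MGraph.SCM

attribute [instance] fintypeD nonemptyD fintypeL nonemptyL fintypeNoise

variable {Vo Vm U : Type*} {G : MGraph Vo Vm U}

/-- Joint values of all nodes. -/
abbrev World (M : G.SCM) : Type _ := ∀ n : MNode Vo Vm U, n.Dom M.D M.L

/-- Joint values of the observable variables in `A`. -/
abbrev Val (M : G.SCM) (A : Finset (Vo ⊕ Vm)) : Type _ := ∀ v : A, M.D v

/-- The event `A = a`. -/
def event (M : G.SCM) (A : Finset (Vo ⊕ Vm)) (a : M.Val A) : Set M.World :=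
  {w | ∀ v : A, w (.obs v) = a v}

/-- The event `R_W = 1, S = 1`. -/
def completeCase (M : G.SCM) (W : Set Vm) : Set M.World :=
  {w | (∀ m ∈ W, w (.miss m) = true) ∧ w .sel = true}

/-- Under the noise `e`, the world `w` satisfies the structural equation of node `n`. -/
def Equation (M : G.SCM) (e : ∀ n, M.Noise n) (w : M.World) (n : MNode Vo Vm U) : Prop :=
  w n = M.func n (fun p => w p.1) (e n)

variable [Fintype Vo] [Fintype Vm] [Fintype U] [DecidableEq Vo] [DecidableEq Vm] [DecidableEq U]

/-- The probability of a joint value of the (mutually independent) noise variables. -/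
noncomputable def noiseJoint (M : G.SCM) (e : ∀ n, M.Noise n) : ℝ := ∏ n, M.noiseProb n (e n)

/-- The probability `P(w)`: the total weight of the noise values for which `w` solves all
structural equations. -/
noncomputable def joint (M : G.SCM) (w : M.World) : ℝ :=
  ∑ e, Set.indicator {e | ∀ n, M.Equation e w n} M.noiseJoint e

/-- The probability `P(w | do(X = x))`: the equations of the variables in `X` are replaced
by `X = x`. -/
noncomputable def jointDo (M : G.SCM) (X : Finset (Vo ⊕ Vm)) (x : M.Val X) (w : M.World) : ℝ :=
  ∑ e, Set.indicator {e | w ∈ M.event X x ∧ ∀ n, (∀ v ∈ X, n ≠ .obs v) → M.Equation e w n}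
    M.noiseJoint e

/-- The observational probability of an event. -/
noncomputable def prob (M : G.SCM) (A : Set M.World) : ℝ := ∑ w, A.indicator M.joint w

/-- The probability of an event under the intervention `do(X = x)`. -/
noncomputable def probDo (M : G.SCM) (X : Finset (Vo ⊕ Vm)) (x : M.Val X) (A : Set M.World) : ℝ :=
  ∑ w, A.indicator (M.jointDo X x) w

/-- The conditional probability `P(A | B)`, meaningful if `P(B) > 0`. -/
noncomputable def condProb (M : G.SCM) (A B : Set M.World) : ℝ := M.prob (A ∩ B) / M.prob B

end MGraph.SCM

/-! ## ms-adjustment sets and the ms-adjustment criterion -/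

namespace MGraph

open CausalGraph

variable {Vo Vm U : Type*}

/-- `W = Vm ∩ (X ∪ Y ∪ Z)`. -/
def missingPart (X Y Z : Finset (Vo ⊕ Vm)) : Set Vm :=
  {m | Sum.inr m ∈ X ∨ Sum.inr m ∈ Y ∨ Sum.inr m ∈ Z}

/-- A set of observable variables, as a set of nodes. -/
def nodes (U : Type*) (A : Finset (Vo ⊕ Vm)) : Set (MNode Vo Vm U) := {n | ∃ v ∈ A, n = .obs v}

/-- The set of nodes `R_W ∪ {S}`. -/
def indicators (U : Type*) (W : Set Vm) : Set (MNode Vo Vm U) :=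
  {n | (∃ m ∈ W, n = .miss m) ∨ n = .sel}

/-- All conditional probabilities that the ms-adjustment formula uses at `X = x` are defined. -/
def SCM.FormulaDefined {G : MGraph Vo Vm U}
    [Fintype Vo] [Fintype Vm] [Fintype U] [DecidableEq Vo] [DecidableEq Vm] [DecidableEq U]
    (M : G.SCM) (X Z : Finset (Vo ⊕ Vm)) (W : Set Vm) (x : M.Val X) : Prop :=
  0 < M.prob (M.completeCase W) ∧
  ∀ z : M.Val Z, 0 < M.prob (M.event Z z ∩ M.completeCase W) →
    0 < M.prob (M.event X x ∩ M.event Z z ∩ M.completeCase W)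

/-- `Z` is an ms-adjustment set for the causal effect of `X` on `Y`: in every model compatible with
`G`, for all values `x`, `y`,
`P(y | do(x)) = ∑ z, P(y | x, z, R_W = 1, S = 1) P(z | R_W = 1, S = 1)`. -/
def IsMSAdjustmentSet (G : MGraph Vo Vm U)
    [Fintype Vo] [Fintype Vm] [Fintype U] [DecidableEq Vo] [DecidableEq Vm] [DecidableEq U]
    (X Y Z : Finset (Vo ⊕ Vm)) : Prop :=
  ∀ (M : G.SCM) (x : M.Val X) (y : M.Val Y),
    M.FormulaDefined X Z (missingPart X Y Z) x →
    M.probDo X x (M.event Y y) =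
      ∑ z : M.Val Z,
        M.condProb (M.event Y y)
          (M.event X x ∩ M.event Z z ∩ M.completeCase (missingPart X Y Z)) *
        M.condProb (M.event Z z) (M.completeCase (missingPart X Y Z))

/-- The ms-adjustment criterion for `Z` relative to the pair `(X, Y)`. -/
structure MSAdjustmentCriterion (G : MGraph Vo Vm U) (X Y Z : Finset (Vo ⊕ Vm)) : Prop where
  /-- No element of `Z` is a descendant, after deletion of the edges into `X`, of a node outside
  `X` that lies on a proper causal path from `X` to `Y`. -/
  no_forbidden : ∀ x ∈ nodes U X, ∀ y ∈ nodes U Y, ∀ p, IsPath G.edge x y p →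
    IsCausal G.edge p → IsProper (nodes U X) p →
      ∀ w ∈ p, w ∉ nodes U X → ∀ z ∈ nodes U Z, ¬ Desc (deleteIn G.edge (nodes U X)) w z
  /-- All (proper) non-causal paths from `X` to `Y` are blocked by `Z`, `R_W` and `S`. -/
  blocks : ∀ x ∈ nodes U X, ∀ y ∈ nodes U Y, ∀ p, IsPath G.edge x y p →
    ¬ IsCausal G.edge p → IsProper (nodes U X) p →
      Blocked G.edge (nodes U Z ∪ indicators U (missingPart X Y Z)) p
  /-- `Y` is d-separated from `R_W ∪ {S}` given `X` after deletion of the edges into `X`. -/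
  indicators_sep : DSep (deleteIn G.edge (nodes U X)) (nodes U Y)
    (indicators U (missingPart X Y Z)) (nodes U X)
  /-- Every element of `X` that is an ancestor of `R_W ∪ {S}` is d-separated from `Y` after deletion
  of the edges out of `X`. -/
  ancestors_sep : ∀ x ∈ nodes U X, (∃ i ∈ indicators U (missingPart X Y Z), Desc G.edge x i) →
    DSep (deleteOut G.edge (nodes U X)) {x} (nodes U Y) ∅

end MGraph

/-! Both sides of the equivalence are compared with `SourceCriterion`, which speaks of directed
paths only. Write C = R_W ∪ {S} and Q = Z ∪ C, and let B (`freeAncestors`) be the nodes outside X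
with a directed path to Y that avoids X. `cutCausal` deletes the edges from X into B. A source is a
node, possibly in X, whose noise flows along directed paths of the cut graph that stop at Q and X. X
and Y are `Linked` if a source reaching X is joined to a source outside X reaching Y by a chain in
which neighbours meet in Q. This is d-connection given Q in the cut graph, in a form that serves
both for factorizing laws and for building models. `sourceCriterion_of_paths` and the lemmas of the
namespace `SourceCriterion` translate between paths and sources.

Sufficiency (`probDo_eq_of_sourceCriterion`): let P' (`probCut`) be the law in which the nodes of B
read x in place of the actual value of X. It factorizes along the cut graph. P'(y) = P(y | do x),
because both laws have the same kernels on B, which is ancestral. P' = P on events inside X = x, and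
on events about Q, since no child of X in B has a descendant in Q. Under P', Y is independent of C,
since no node of B has a descendant in C, and X is independent of Y given Q, since without links
every family lies on one side of Q. Hence P(y | do x) = P'(y | C) = ∑ P'(y | z, C) P'(z | C) = ∑ P(y
| x, z, C) P(z | C).

Necessity: every failure of `SourceCriterion` yields a model with binary noises, each equal to 1
with the small probability ε = 1/(n+2), n being the number of nodes. In it some z, together with x
and complete-case status, forces y, so the formula is at least P(z | C). Under do(x), y requires one
particular noise to be 1, so P(y | do x) ≤ ε. But P(z | C) is 1, or P(z, C) is at least the weight
(1-ε)^n > ε of the all-zero noise. The models are in `IsMSAdjustmentSet.not_anc`,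
`IsMSAdjustmentSet.not_desc` and `SourceChain.not_isMSAdjustmentSet`; the last lives on a shortest
chain of sources, so that binary indicators suffice to compare them. -/

namespace CausalGraph

/-! ### Open walks and their shortening to open paths. -/

variable {N : Type*} {E : N → N → Prop} {C : Set N}

/-- The condition for a walk to be open at the inner node `b` between `a` and `c`. -/
def OpenTriple (E : N → N → Prop) (C : Set N) (a b c : N) : Prop :=
  (¬ (E a b ∧ E c b) → b ∉ C) ∧ (E a b ∧ E c b → ∃ d ∈ C, Desc E b d)

/-- Walks (nodes may repeat) that are open given `C`. -/
def OpenWalk (E : N → N → Prop) (C : Set N) (p : List N) : Prop :=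
  p.IsChain (fun u v => E u v ∨ E v u) ∧ ¬ Blocked E C p

theorem not_blocked_iff {p : List N} :
    ¬ Blocked E C p ↔ ∀ a b c, [a, b, c] <:+: p → OpenTriple E C a b c := by
  unfold Blocked OpenTriple
  push Not
  refine forall₃_congr fun a b c => imp_congr_right fun _ => ?_
  tauto

theorem OpenWalk.infix {p q : List N} (h : OpenWalk E C p) (hq : q <:+: p) : OpenWalk E C q :=
  ⟨h.1.infix hq, fun ⟨a, b, c, hi, hb⟩ => h.2 ⟨a, b, c, hi.trans hq, hb⟩⟩

theorem openTriple_comm {a b c : N} : OpenTriple E C a b c ↔ OpenTriple E C c b a := by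
  unfold OpenTriple
  rw [and_comm (a := E a b)]

theorem OpenWalk.reverse {p : List N} (h : OpenWalk E C p) : OpenWalk E C p.reverse := by
  refine ⟨?_, ?_⟩
  · rw [List.isChain_reverse]
    exact h.1.imp fun a b hab => hab.symm
  · rw [not_blocked_iff]
    intro a b c hi
    rw [openTriple_comm]
    refine not_blocked_iff.1 h.2 _ _ _ ?_
    rw [← List.reverse_infix]
    simpa using hi

theorem openWalk_singleton (a : N) : OpenWalk E C [a] := by
  refine ⟨by simp, not_blocked_iff.2 fun x y z h => ?_⟩
  simpa using h.length_le

theorem openWalk_pair {a b : N} : OpenWalk E C [a, b] ↔ (E a b ∨ E b a) := by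
  refine ⟨fun h => by simpa using h.1, fun h => ⟨by simpa using h, not_blocked_iff.2 ?_⟩⟩
  intro x y z h
  simpa using h.length_le

theorem openWalk_cons_cons_cons {a b c : N} {l : List N} :
    OpenWalk E C (a :: b :: c :: l) ↔
      (E a b ∨ E b a) ∧ OpenTriple E C a b c ∧ OpenWalk E C (b :: c :: l) := by
  constructor
  · intro h
    refine ⟨?_, ?_, h.infix (List.infix_cons (List.infix_refl _))⟩
    · exact (List.isChain_cons_cons.1 h.1).1
    · exact not_blocked_iff.1 h.2 _ _ _ ⟨[], l, by simp⟩
  · rintro ⟨h1, h2, h3⟩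
    refine ⟨List.isChain_cons_cons.2 ⟨h1, h3.1⟩, not_blocked_iff.2 ?_⟩
    intro x y z hi
    rw [List.infix_cons_iff] at hi
    rcases hi with hi | hi
    · simp only [List.cons_prefix_cons, List.nil_prefix, and_true] at hi
      obtain ⟨rfl, rfl, rfl⟩ := hi
      exact h2
    · exact not_blocked_iff.1 h3.2 _ _ _ hi

theorem OpenWalk.append {n : N} {γ : List N} (hγ : OpenWalk E C (n :: γ)) :
    ∀ {α : List N}, OpenWalk E C (α ++ [n]) →
      (∀ a ∈ α.getLast?, ∀ c ∈ γ.head?, OpenTriple E C a n c) → OpenWalk E C (α ++ n :: γ)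
  | [], _, _ => hγ
  | [a], h, ht => by
    cases γ with
    | nil => exact h
    | cons c γ =>
      exact openWalk_cons_cons_cons.2 ⟨openWalk_pair.1 h, ht a (by simp) c (by simp), hγ⟩
  | [a, b], h, ht => by
    have h' := openWalk_cons_cons_cons.1 h
    exact openWalk_cons_cons_cons.2 ⟨h'.1, h'.2.1,
      OpenWalk.append hγ (α := [b]) h'.2.2 (by simpa using ht)⟩
  | a :: b :: c :: α, h, ht => by
    have h' := openWalk_cons_cons_cons.1 h
    exact openWalk_cons_cons_cons.2 ⟨h'.1, h'.2.1,
      OpenWalk.append hγ (α := b :: c :: α) h'.2.2 (by simpa using ht)⟩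

/-- An open walk that starts along an arrow leads to a descendant or to an open collider. -/
theorem OpenWalk.transGen_or_desc {n m : N} {l : List N} (h : OpenWalk E C (n :: m :: l))
    (hnm : E n m) :
    Relation.TransGen E n ((m :: l).getLast (by simp)) ∨ ∃ d ∈ C, Relation.TransGen E n d := by
  induction l generalizing n m with
  | nil => exact Or.inl (.single hnm)
  | cons k l ih =>
    obtain ⟨-, ht, hw⟩ := openWalk_cons_cons_cons.1 h
    by_cases hk : E k m
    · obtain ⟨d, hd, hmd⟩ := ht.2 ⟨hnm, hk⟩
      exact Or.inr ⟨d, hd, .head' hnm hmd⟩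
    · have hmk : E m k := ((List.isChain_cons_cons.1 hw.1).1).resolve_right hk
      rcases ih hw hmk with h1 | ⟨d, hd, h1⟩
      · exact Or.inl (by simpa using Relation.TransGen.head hnm h1)
      · exact Or.inr ⟨d, hd, .head hnm h1⟩

theorem exists_append_of_not_nodup {p : List N} (h : ¬ p.Nodup) :
    ∃ α n β γ, p = α ++ n :: (β ++ n :: γ) := by
  induction p with
  | nil => simp at h
  | cons a l ih =>
    by_cases hl : l.Nodup
    · have ha : a ∈ l := by
        by_contra ha
        exact h (List.nodup_cons.2 ⟨ha, hl⟩)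
      obtain ⟨β, γ, rfl⟩ := List.append_of_mem ha
      exact ⟨[], a, β, γ, rfl⟩
    · obtain ⟨α, n, β, γ, rfl⟩ := ih hl
      exact ⟨a :: α, n, β, γ, rfl⟩

/-- An open walk in an acyclic graph can be shortened to an open path. -/
theorem OpenWalk.exists_nodup (hE : ∀ n, ¬ Relation.TransGen E n n) {p : List N}
    (h : OpenWalk E C p) :
    ∃ q, q.Nodup ∧ OpenWalk E C q ∧ q.head? = p.head? ∧ q.getLast? = p.getLast? ∧ q ⊆ p := by
  induction hn : p.length using Nat.strong_induction_on generalizing p with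
  | _ k ih =>
  subst hn
  by_cases hp : p.Nodup
  · exact ⟨p, hp, h, rfl, rfl, fun _ => id⟩
  obtain ⟨α, n, β, γ, rfl⟩ := exists_append_of_not_nodup hp
  have hlast : OpenWalk E C (n :: γ) := h.infix ⟨α ++ n :: β, [], by simp⟩
  have hfirst : OpenWalk E C (α ++ [n]) := h.infix ⟨[], β ++ n :: γ, by simp⟩
  have hq : OpenWalk E C (α ++ n :: γ) := by
    refine hlast.append hfirst ?_
    intro a ha c hc
    obtain ⟨α, rfl⟩ := List.getLast?_eq_some_iff.1 ha
    obtain ⟨γ, rfl⟩ := List.head?_eq_some_iff.1 hc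
    obtain ⟨b, δ, hb⟩ : ∃ b δ, β ++ [n] = b :: δ := by cases β <;> simp
    obtain ⟨ε, b', hb'⟩ : ∃ ε b', n :: β = ε ++ [b'] :=
      ⟨_, _, (List.dropLast_append_getLast (List.cons_ne_nil n β)).symm⟩
    have h1 : OpenTriple E C a n b := not_blocked_iff.1 h.2 _ _ _
      ⟨α, δ ++ c :: γ, by
        have : β ++ n :: c :: γ = (β ++ [n]) ++ c :: γ := by simp
        rw [this, hb]; simp⟩
    have h2 : OpenTriple E C b' n c := not_blocked_iff.1 h.2 _ _ _
      ⟨α ++ a :: ε, γ, by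
        have : n :: (β ++ n :: c :: γ) = (n :: β) ++ n :: c :: γ := by simp
        rw [this, hb']; simp⟩
    -- The loop at `n` is excised, so only the triple `a n c` is new. If `n` lay in `C` it would be
    -- a collider in both old triples, hence in the new one.
    refine ⟨fun hnc hC => ?_, fun hc => ?_⟩
    · exact h1.1 (fun h1' => h2.1 (fun h2' => hnc ⟨h1'.1, h2'.2⟩) hC) hC
    · by_cases hbn : E b n
      · exact h1.2 ⟨hc.1, hbn⟩
      -- The loop leaves `n` along an arrow. By acyclicity it cannot be directed all the way back,
      -- so it turns at an open collider below `n`, which supplies the descendant in `C`.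
      · have hw : OpenWalk E C (n :: b :: δ) := h.infix ⟨α ++ [a], c :: γ, by
          have : β ++ n :: c :: γ = (β ++ [n]) ++ c :: γ := by simp
          rw [this, hb]; simp⟩
        have hnb : E n b := ((List.isChain_cons_cons.1 hw.1).1).resolve_right hbn
        suffices h3 : ¬ Relation.TransGen E n ((b :: δ).getLast (by simp)) by
          obtain ⟨d, hd, h⟩ := (hw.transGen_or_desc hnb).resolve_left h3
          exact ⟨d, hd, h.to_reflTransGen⟩
        have : (b :: δ).getLast (by simp) = n := by
          simp only [← hb]; simp
        rw [this]
        exact hE n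
  obtain ⟨q, h1, h2, h3, h4, h5⟩ := ih _ (by simp) hq rfl
  refine ⟨q, h1, h2, ?_, ?_, fun x hx => ?_⟩
  · rw [h3]; cases α <;> simp
  · rw [h4]; simp [List.getLast?_append, List.getLast?_cons]
  · have := h5 hx
    simp only [List.mem_append, List.mem_cons] at this ⊢
    tauto

end CausalGraph

/-! ### Sources, flows and the criterion in terms of directed paths. -/

namespace CausalGraph

open Relation

variable {N : Type*}

/-- The nodes outside `X` with a directed path to `Y` that avoids `X`. -/
def freeAncestors (E : N → N → Prop) (X Y : Set N) : Set N :=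
  {n | n ∉ X ∧ ∃ y ∈ Y, Desc (deleteIn E X) n y}

/-- Delete the first edges of the proper causal paths from `X` to `Y`. -/
def cutCausal (E : N → N → Prop) (X Y : Set N) : N → N → Prop :=
  fun a b => E a b ∧ ¬ (a ∈ X ∧ b ∈ freeAncestors E X Y)

/-- An edge of `cutCausal E X Y` along which information flows from the source `s`: it leaves `s`
or a node outside `X`, and it does not leave `Q`. -/
def FlowStep (E : N → N → Prop) (X Y Q : Set N) (s a b : N) : Prop :=
  cutCausal E X Y a b ∧ a ∉ Q ∧ (a ∉ X ∨ a = s)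

/-- Information flows from the source `s` to `n`. -/
def Flow (E : N → N → Prop) (X Y Q : Set N) (s n : N) : Prop :=
  ReflTransGen (FlowStep E X Y Q s) s n

/-- The sources `s` and `t` reach a common node of `Q`. -/
def Coupled (E : N → N → Prop) (X Y Q : Set N) (s t : N) : Prop :=
  t ∉ Q ∧ ∃ q ∈ Q, Flow E X Y Q s q ∧ Flow E X Y Q t q

/-- Sources outside `Q` that reach `X`. -/
def IsStart (E : N → N → Prop) (X Y Q : Set N) (s : N) : Prop :=
  s ∉ Q ∧ ∃ x ∈ X, Flow E X Y Q s x

/-- Sources outside `Q` and `X` that reach `Y`. -/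
def IsEnd (E : N → N → Prop) (X Y Q : Set N) (s : N) : Prop :=
  s ∉ Q ∧ s ∉ X ∧ ∃ y ∈ Y, Flow E X Y Q s y

/-- `X` and `Y` are linked by a chain of coupled sources. -/
def Linked (E : N → N → Prop) (X Y Q : Set N) : Prop :=
  ∃ s t, IsStart E X Y Q s ∧ IsEnd E X Y Q t ∧ ReflTransGen (Coupled E X Y Q) s t

/-- A form of the adjustment criterion that refers to directed paths only. -/
structure SourceCriterion (E : N → N → Prop) (X Y Z C : Set N) : Prop where
  not_desc : ∀ x ∈ X, ∀ m, E x m → m ∈ freeAncestors E X Y → ∀ z ∈ Z, ¬ Desc (deleteIn E X) m z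
  not_anc : ∀ t ∈ freeAncestors E X Y, ∀ c ∈ C, ¬ Desc E t c
  not_linked : ¬ Linked E X Y (Z ∪ C)

variable {E : N → N → Prop} {X Y Z C Q : Set N}

theorem Desc.mono {E' : N → N → Prop} (h : ∀ a b, E a b → E' a b) {a b : N} (hab : Desc E a b) :
    Desc E' a b := ReflTransGen.mono h _ _ hab

theorem Desc.of_deleteIn {a b : N} (h : Desc (deleteIn E X) a b) : Desc E a b :=
  h.mono fun _ _ h => h.1

theorem notMem_of_desc_deleteIn {a b : N} (ha : a ∉ X) (h : Desc (deleteIn E X) a b) : b ∉ X := by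
  rcases ReflTransGen.cases_tail h with rfl | ⟨c, -, hc⟩
  · exact ha
  · exact hc.2

theorem acyclic_mono {E' : N → N → Prop} (hE : ∀ n, ¬ TransGen E n n)
    (h : ∀ a b, E' a b → E a b) (n : N) : ¬ TransGen E' n n :=
  fun hn => hE n (TransGen.mono h _ _ hn)

theorem not_edge_symm (hE : ∀ n, ¬ TransGen E n n) {a b : N} (h : E a b) : ¬ E b a :=
  fun h' => hE a (.head h (.single h'))

/-- Stop the directed path at its first entry into `X`, made from `u`. -/
theorem desc_deleteIn_or_exit {t c : N} (h : Desc E t c) :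
    Desc (deleteIn E X) t c ∨
      ∃ x ∈ X, Desc E x c ∧ ∃ u, Desc (deleteIn E X) t u ∧ E u x := by
  induction h with
  | refl => exact Or.inl .refl
  | @tail b c _ hbc ih =>
    rcases ih with ih | ⟨x, hx, hxb, u, hu⟩
    · by_cases hc : c ∈ X
      · exact Or.inr ⟨c, hc, .refl, b, ih, hbc⟩
      · exact Or.inl (ih.tail ⟨hbc, hc⟩)
    · exact Or.inr ⟨x, hx, hxb.tail hbc, u, hu⟩

/-- Along a directed list that avoids `X` after its head. -/
theorem desc_deleteIn_of_isChain {m : N} {l : List N} (h : (m :: l).IsChain E)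
    (hl : ∀ n ∈ l, n ∉ X) {w : N} (hw : w ∈ m :: l) :
    Desc (deleteIn E X) m w ∧ Desc (deleteIn E X) w ((m :: l).getLast (by simp)) := by
  induction l generalizing m w with
  | nil =>
    simp only [List.mem_singleton] at hw
    subst hw
    exact ⟨.refl, .refl⟩
  | cons k l ih =>
    obtain ⟨h1, h2⟩ := List.isChain_cons_cons.1 h
    have hk : deleteIn E X m k := ⟨h1, hl k (by simp)⟩
    have ih' := fun {w} => ih h2 (fun n hn => hl n (by simp [hn])) (w := w)
    rcases List.mem_cons.1 hw with rfl | hw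
    · exact ⟨.refl, by simpa [Desc] using (ih' (w := k) (by simp)).2.head hk⟩
    · exact ⟨.head hk (ih' hw).1, by simpa using (ih' hw).2⟩

theorem nodup_of_isChain (hE : ∀ n, ¬ TransGen E n n) {p : List N} (h : p.IsChain E) :
    p.Nodup := by
  have h' : p.IsChain (TransGen E) := h.imp fun _ _ => TransGen.single
  refine (List.isChain_iff_pairwise.1 h').imp ?_
  rintro a b hab rfl
  exact hE a hab

theorem exists_isChain_of_desc {a b : N} (h : Desc E a b) :
    ∃ l, (a :: l).IsChain E ∧ (a :: l).getLast? = some b := by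
  induction h using ReflTransGen.head_induction_on with
  | refl => exact ⟨[], by simp⟩
  | @head a c hac _ ih =>
    obtain ⟨l, h1, h2⟩ := ih
    exact ⟨c :: l, List.isChain_cons_cons.2 ⟨hac, h1⟩, by simpa using h2⟩

/-- A common ancestor gives an open path. -/
theorem exists_path_of_fork (hE : ∀ n, ¬ TransGen E n n) {t a b : N}
    (ha : Desc (fun u v => E u v ∧ u ∉ C) t a) (hb : Desc (fun u v => E u v ∧ u ∉ C) t b) :
    ∃ p, IsPath E a b p ∧ ¬ Blocked E C p := by
  obtain ⟨l, hl, hlast⟩ : ∃ l, OpenWalk E C (t :: l) ∧ (t :: l).getLast? = some b := by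
    suffices ∃ l, OpenWalk E C (t :: l) ∧ (t :: l).getLast? = some b ∧
        ∀ m ∈ l.head?, E t m ∧ t ∉ C from this.imp fun l h => ⟨h.1, h.2.1⟩
    clear ha
    induction hb using ReflTransGen.head_induction_on with
    | refl => exact ⟨[], openWalk_singleton _, by simp, by simp⟩
    | @head t c htc hcb ih =>
      obtain ⟨l, h1, h2, h3⟩ := ih
      refine ⟨c :: l, ?_, by simpa using h2, by simpa using htc⟩
      cases l with
      | nil => exact openWalk_pair.2 (.inl htc.1)
      | cons m l =>
        have h3 := h3 m rfl
        exact openWalk_cons_cons_cons.2 ⟨.inl htc.1,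
          ⟨fun _ => h3.2, fun h => (not_edge_symm hE h3.1 h.2).elim⟩, h1⟩
  obtain ⟨l', hl', hlast'⟩ : ∃ l, OpenWalk E C (a :: l) ∧ (a :: l).getLast? = some b := by
    clear hb
    induction ha with
    | refl => exact ⟨l, hl, hlast⟩
    | @tail n c htn hnc ih =>
      obtain ⟨l', h1, h2⟩ := ih
      refine ⟨n :: l', ?_, by simpa using h2⟩
      cases l' with
      | nil => exact openWalk_pair.2 (.inr hnc.1)
      | cons m l' =>
        exact openWalk_cons_cons_cons.2 ⟨.inr hnc.1,
          ⟨fun _ => hnc.2, fun h => (not_edge_symm hE hnc.1 h.1).elim⟩, h1⟩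
  obtain ⟨q, h1, h2, h3, h4, -⟩ := hl'.exists_nodup hE
  exact ⟨q, ⟨by simpa using h3, h4.trans hlast', h1, h2.1⟩, h2.2⟩

/-- An open walk without open colliders has a common ancestor of its end points. -/
theorem exists_fork_of_openWalk {n : N} {l : List N} (h : OpenWalk E C (n :: l))
    (hC : ∀ a b, E a b → ∀ d ∈ C, ¬ Desc E b d) :
    ∃ t, Desc E t n ∧ Desc E t ((n :: l).getLast (by simp)) ∧
      (t = n ∨ t = (n :: l).getLast (by simp) ∨ t ∉ C) := by
  induction l generalizing n with
  | nil => exact ⟨n, .refl, .refl, .inl rfl⟩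
  | cons m l ih =>
    by_cases hnm : E n m
    · rcases h.transGen_or_desc hnm with h' | ⟨d, hd, h'⟩
      · exact ⟨n, .refl, by simpa [Desc] using h'.to_reflTransGen, .inl rfl⟩
      · obtain ⟨b, hb, hbd⟩ := TransGen.head'_iff.1 h'
        exact (hC _ _ hb d hd hbd).elim
    · have hmn : E m n := ((List.isChain_cons_cons.1 h.1).1).resolve_left hnm
      obtain ⟨t, h1, h2, h3⟩ := ih (h.infix (List.infix_cons (List.infix_refl _)))
      refine ⟨t, h1.tail hmn, by simpa using h2, .inr ?_⟩
      rcases h3 with rfl | h3 | h3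
      · cases l with
        | nil => exact .inl rfl
        | cons k l =>
          refine .inr ?_
          exact (openWalk_cons_cons_cons.1 h).2.1.1 fun h => hnm h.1
      · exact .inl (by simpa using h3)
      · exact .inr h3

/-! ### Flows -/

theorem cutCausal_of_notMem {a b : N} (h : E a b) (ha : a ∉ X) : cutCausal E X Y a b :=
  ⟨h, fun h' => ha h'.1⟩

theorem FlowStep.mono {s t a b : N} (hs : s ∉ X) (h : FlowStep E X Y Q s a b) :
    FlowStep E X Y Q t a b :=
  ⟨h.1, h.2.1, .inl (h.2.2.elim id fun e => e ▸ hs)⟩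

/-- The condition `m ∉ X` matters: only the source itself may leave a node of `X`, so a flow that
starts in `X` does not in general continue that of another source. -/
theorem Flow.trans {s m n : N} (h : Flow E X Y Q s m) (hm : m ∉ X) (h' : Flow E X Y Q m n) :
    Flow E X Y Q s n :=
  ReflTransGen.trans h (ReflTransGen.mono (fun _ _ => FlowStep.mono hm) _ _ h')

theorem Flow.single {s n : N} (h : cutCausal E X Y s n) (hs : s ∉ Q) : Flow E X Y Q s n :=
  ReflTransGen.single ⟨h, hs, .inr rfl⟩

theorem Flow.head {s m n : N} (h : cutCausal E X Y s m) (hs : s ∉ Q) (hm : m ∉ X)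
    (h' : Flow E X Y Q m n) : Flow E X Y Q s n :=
  (Flow.single h hs).trans hm h'

theorem Flow.desc {s n : N} (h : Flow E X Y Q s n) : Desc E s n :=
  ReflTransGen.mono (fun _ _ h => h.1.1) _ _ h

theorem Flow.desc_deleteIn {s n : N} (h : Flow E X Y Q s n) (hs : s ∉ X) (hn : n ∉ X) :
    Desc (deleteIn E X) s n := by
  induction h with
  | refl => exact .refl
  | @tail b c _ hbc ih =>
    exact (ih (hbc.2.2.elim id fun e => e ▸ hs)).tail ⟨hbc.1.1, hn⟩

/-- From a node outside `X` that has a descendant in `Q`, information flows to `Q` or to `X`. -/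
theorem flow_of_desc {k d : N} (hk : k ∉ X) (hd : d ∈ Q) (h : Desc E k d) :
    ∃ n, (n ∈ Q ∨ n ∈ X) ∧ Flow E X Y Q k n := by
  induction h using ReflTransGen.head_induction_on with
  | refl => exact ⟨d, .inl hd, .refl⟩
  | @head k b hkb _ ih =>
    by_cases hkQ : k ∈ Q
    · exact ⟨k, .inl hkQ, .refl⟩
    have hcut : cutCausal E X Y k b := cutCausal_of_notMem hkb hk
    by_cases hb : b ∈ X
    · exact ⟨b, .inr hb, .single hcut hkQ⟩
    · obtain ⟨n, hn, hbn⟩ := ih hb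
      exact ⟨n, hn, hbn.head hcut hkQ hb⟩

end CausalGraph

/-! ### From the path criterion to the source criterion. -/

namespace CausalGraph

open Relation

variable {N : Type*} {E : N → N → Prop} {X Y Z C Q : Set N}

/-- An open walk in `cutCausal E X Y` whose last node is its only node in `X`. -/
def XWalk (E : N → N → Prop) (X Y Q : Set N) (l : List N) : Prop :=
  OpenWalk (cutCausal E X Y) Q l ∧ (∃ x ∈ X, l.getLast? = some x) ∧ ∀ n ∈ l.dropLast, n ∉ X

theorem XWalk.cons {a b : N} {l : List N} (h : XWalk E X Y Q (b :: l)) (ha : a ∉ X)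
    (hab : cutCausal E X Y a b ∨ cutCausal E X Y b a)
    (ht : ∀ m ∈ l.head?, OpenTriple (cutCausal E X Y) Q a b m) : XWalk E X Y Q (a :: b :: l) := by
  refine ⟨?_, ?_, ?_⟩
  · cases l with
    | nil => exact openWalk_pair.2 hab
    | cons m l => exact openWalk_cons_cons_cons.2 ⟨hab, ht m rfl, h.1⟩
  · simpa using h.2.1
  · intro n hn
    rw [List.dropLast_cons_cons] at hn
    rcases List.mem_cons.1 hn with rfl | hn
    · exact ha
    · exact h.2.2 n hn

theorem cutCausal_acyclic (hE : ∀ n, ¬ TransGen E n n) (n : N) :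
    ¬ TransGen (cutCausal E X Y) n n :=
  acyclic_mono hE (fun _ _ h => h.1) n

/-- A walk at whose head a source may start. -/
def SourceWalk (E : N → N → Prop) (X Y Q : Set N) (s : N) : Prop :=
  ∃ l, XWalk E X Y Q (s :: l) ∧ (∀ m ∈ l.head?, cutCausal E X Y s m) ∧ (s ∈ X → l = [])

theorem sourceWalk_of_mem {x : N} (hx : x ∈ X) : SourceWalk E X Y Q x :=
  ⟨[], ⟨openWalk_singleton _, ⟨x, hx, rfl⟩, by simp⟩, by simp, fun _ => rfl⟩

/-- Follow a flow backwards. -/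
theorem XWalk.flow_up (hE : ∀ n, ¬ TransGen E n n) {s n : N} {l : List N} (hs : s ∉ X)
    (hsn : s ≠ n) (h : XWalk E X Y Q (n :: l)) (hn : n ∈ X ∧ l = [] ∨ n ∈ Q ∧
      ∀ m ∈ l.head?, cutCausal E X Y m n) (hf : Flow E X Y Q s n) : SourceWalk E X Y Q s := by
  have key : ∀ a, ReflTransGen (FlowStep E X Y Q s) a n → a = n ∨
      ∃ m l, XWalk E X Y Q (a :: m :: l) ∧ cutCausal E X Y a m ∧ a ∉ X ∧ a ∉ Q := by
    intro a ha
    induction ha using ReflTransGen.head_induction_on with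
    | refl => exact .inl rfl
    | @head a b hab _ ih =>
      have haX : a ∉ X := hab.2.2.elim id fun e => e ▸ hs
      refine .inr ?_
      rcases ih with rfl | ⟨m, l', h1, h2, h3, h4⟩
      · refine ⟨b, l, h.cons haX (.inl hab.1) fun m hm => ?_, hab.1, haX, hab.2.1⟩
        rcases hn with ⟨-, rfl⟩ | ⟨hQ, hn⟩
        · simp at hm
        · exact ⟨fun hnc => (hnc ⟨hab.1, hn m hm⟩).elim, fun _ => ⟨b, hQ, .refl⟩⟩
      · refine ⟨b, m :: l', h1.cons haX (.inl hab.1) fun m' hm' => ?_, hab.1, haX, hab.2.1⟩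
        obtain rfl : m = m' := by simpa using hm'
        exact ⟨fun _ => h4, fun hc => (not_edge_symm hE h2.1 hc.2.1).elim⟩
  obtain ⟨m, l', h1, h2, h3, -⟩ := (key s hf).resolve_left hsn
  exact ⟨m :: l', h1, by simpa using h2, fun h => (h3 h).elim⟩

/-- Follow a flow forwards. -/
theorem SourceWalk.flow_down (hE : ∀ n, ¬ TransGen E n n) {s n : N} (h : SourceWalk E X Y Q s)
    (hn : n ∉ X) (hf : Flow E X Y Q s n) :
    s = n ∨ ∃ m l, XWalk E X Y Q (n :: m :: l) ∧ cutCausal E X Y m n := by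
  induction hf with
  | refl => exact .inl rfl
  | @tail b c hsb hbc ih =>
    refine .inr ?_
    by_cases hb : s = b
    · subst hb
      obtain ⟨l, h1, h2, h3⟩ := h
      refine ⟨s, l, h1.cons hn (.inr hbc.1) fun m hm => ?_, hbc.1⟩
      exact ⟨fun _ => hbc.2.1, fun hc => (not_edge_symm hE hbc.1.1 hc.1.1).elim⟩
    · obtain ⟨m, l, h1, h2⟩ :=
        (ih (hbc.2.2.elim id fun e => (hb e.symm).elim)).resolve_left hb
      refine ⟨b, m :: l, h1.cons hn (.inr hbc.1) fun m' hm' => ?_, hbc.1⟩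
      exact ⟨fun _ => hbc.2.1, fun hc => (not_edge_symm hE hbc.1.1 hc.1.1).elim⟩

theorem IsStart.sourceWalk (hE : ∀ n, ¬ TransGen E n n) {s : N} (h : IsStart E X Y Q s) :
    SourceWalk E X Y Q s := by
  by_cases hs : s ∈ X
  · exact sourceWalk_of_mem hs
  obtain ⟨hsQ, x, hx, hf⟩ := h
  obtain ⟨l, hl⟩ := sourceWalk_of_mem (E := E) (Y := Y) (Q := Q) hx
  exact XWalk.flow_up hE hs (fun e => hs (e ▸ hx)) hl.1 (.inl ⟨hx, hl.2.2 hx⟩) hf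

/-- Go down from `s` to the meeting node `q` and up to `t`: the two arrows collide at `q ∈ Q`, so
the walk stays open. -/
theorem SourceWalk.coupled (hE : ∀ n, ¬ TransGen E n n) (hQ : Disjoint Q X) {s t : N}
    (h : SourceWalk E X Y Q s) (hsQ : s ∉ Q) (hst : Coupled E X Y Q s t) :
    SourceWalk E X Y Q t := by
  by_cases ht : t ∈ X
  · exact sourceWalk_of_mem ht
  obtain ⟨htQ, q, hq, h1, h2⟩ := hst
  obtain ⟨m, l, hw, hm⟩ := (h.flow_down hE (Set.disjoint_left.1 hQ hq) h1).resolve_left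
    fun e => hsQ (e ▸ hq)
  exact XWalk.flow_up hE ht (fun e => htQ (e ▸ hq)) hw (.inr ⟨hq, by simpa using hm⟩) h2

theorem Linked.exists_xWalk (hE : ∀ n, ¬ TransGen E n n) (hQ : Disjoint Q X) (hXY : Disjoint X Y)
    (h : Linked E X Y Q) : ∃ y ∈ Y, ∃ l, XWalk E X Y Q (y :: l) := by
  obtain ⟨s, t, hs, ⟨htQ, htX, y, hy, hty⟩, hst⟩ := h
  have ht : SourceWalk E X Y Q t ∧ t ∉ Q := by
    clear hty htQ htX
    induction hst with
    | refl => exact ⟨hs.sourceWalk hE, hs.1⟩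
    | tail _ hbc ih => exact ⟨ih.1.coupled hE hQ ih.2 hbc, hbc.1⟩
  refine ⟨y, hy, ?_⟩
  have hyX := Set.disjoint_right.1 hXY hy
  rcases ht.1.flow_down hE hyX hty with rfl | ⟨m, l, hw, -⟩
  · exact ht.1.imp fun _ h => h.1
  · exact ⟨_, hw⟩

/-- Deleting edges can only remove descendants of colliders, and acyclicity fixes the orientations
along a walk of the cut graph. -/
theorem blocked_cutCausal_of_blocked (hE : ∀ n, ¬ TransGen E n n) {p : List N}
    (hp : p.IsChain fun u v => cutCausal E X Y u v ∨ cutCausal E X Y v u)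
    (h : Blocked E Q p) : Blocked (cutCausal E X Y) Q p := by
  obtain ⟨a, b, c, hi, h⟩ := h
  have hc := hp.infix hi
  simp only [List.isChain_cons_cons, List.isChain_singleton, and_true] at hc
  refine ⟨a, b, c, hi, ?_⟩
  rcases h with ⟨h1, h2⟩ | ⟨h1, h2⟩
  · exact .inl ⟨fun h => h1 ⟨h.1.1, h.2.1⟩, h2⟩
  · refine .inr ⟨⟨?_, ?_⟩, fun d hd hbd => h2 d hd (hbd.mono fun _ _ h => h.1)⟩
    · exact hc.1.resolve_right fun h => not_edge_symm hE h1.1 h.1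
    · exact hc.2.resolve_left fun h => not_edge_symm hE h1.2 h.1

/-- A chain of coupled sources yields an open proper non-causal path. -/
theorem Linked.exists_path (hE : ∀ n, ¬ TransGen E n n) (hQ : Disjoint Q X) (hXY : Disjoint X Y)
    (h : Linked E X Y Q) : ∃ x ∈ X, ∃ y ∈ Y, ∃ p, IsPath E x y p ∧ ¬ IsCausal E p ∧
      IsProper X p ∧ ¬ Blocked E Q p := by
  obtain ⟨y, hy, l, hl, ⟨x, hx, hlast⟩, hfree⟩ := h.exists_xWalk hE hQ hXY
  obtain ⟨q, hnd, hop, hhead, hlast', hsub⟩ := hl.exists_nodup (cutCausal_acyclic hE)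
  rw [hlast] at hlast'
  obtain ⟨q, rfl⟩ := List.getLast?_eq_some_iff.1 hlast'
  have hqX : ∀ n ∈ q, n ∉ X := by
    intro n hn hnX
    have h1 : n ∈ y :: l := hsub (by simp [hn])
    obtain ⟨l', hl'⟩ := List.getLast?_eq_some_iff.1 hlast
    rw [hl'] at h1 hfree
    simp only [List.dropLast_concat] at hfree
    rcases List.mem_append.1 h1 with h1 | h1
    · exact hfree n h1 hnX
    · obtain rfl : n = x := by simpa using h1
      simp only [List.nodup_append, List.mem_singleton, forall_eq] at hnd
      exact hnd.2.2 n hn rfl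
  have hrev := hop.reverse
  rw [List.reverse_append, List.reverse_singleton, List.singleton_append] at hrev
  have hne : q ≠ [] := by
    rintro rfl
    simp only [List.nil_append, List.head?_cons, Option.some.injEq] at hhead
    exact Set.disjoint_left.1 hXY hx (hhead ▸ hy)
  have hlastq : q.reverse.getLast? = some y := by
    rw [List.getLast?_reverse]
    rw [List.head?_append_of_ne_nil _ hne] at hhead
    simpa using hhead
  have hpath : IsPath E x y (x :: q.reverse) := by
    refine ⟨rfl, ?_, ?_, hrev.1.imp fun a b h => h.imp (·.1) (·.1)⟩
    · rw [List.getLast?_cons, hlastq]; rfl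
    · have := List.nodup_reverse.2 hnd
      rwa [List.reverse_append, List.reverse_singleton, List.singleton_append] at this
  refine ⟨x, hx, y, hy, x :: q.reverse, hpath, fun hcaus => ?_, ?_, fun hb =>
    hrev.2 (blocked_cutCausal_of_blocked hE hrev.1 hb)⟩
  -- A causal path would begin with an edge from `X` into `freeAncestors`, and exactly these edges
  -- are missing from `cutCausal`.
  · obtain ⟨m, r, hr⟩ := List.exists_cons_of_ne_nil (mt List.reverse_eq_nil_iff.1 hne)
    have hmem : ∀ n ∈ m :: r, n ∉ X := fun n hn => hqX n (by rw [← hr] at hn; simpa using hn)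
    rw [hr] at hcaus hrev hlastq
    obtain ⟨hxm, hc⟩ := List.isChain_cons_cons.1 hcaus
    have hmB : m ∈ freeAncestors E X Y := by
      refine ⟨hmem m (by simp), y, hy, ?_⟩
      have := (desc_deleteIn_of_isChain hc (fun n hn => hmem n (by simp [hn]))
        (w := m) (by simp)).2
      rw [List.getLast?_eq_getLast_of_ne_nil (by simp)] at hlastq
      rwa [Option.some_injective _ hlastq] at this
    rcases (List.isChain_cons_cons.1 hrev.1).1 with h | h
    · exact h.2 ⟨hx, hmB⟩
    · exact not_edge_symm hE hxm h.1
  · intro n hn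
    exact hqX n (by simpa using hn)

/-- The adjustment criterion in terms of paths implies the one in terms of directed paths. -/
theorem sourceCriterion_of_paths (hE : ∀ n, ¬ TransGen E n n) (hXY : Disjoint X Y)
    (hZX : Disjoint Z X) (hCX : Disjoint C X)
    (ha : ∀ x ∈ X, ∀ y ∈ Y, ∀ p, IsPath E x y p → IsCausal E p → IsProper X p →
      ∀ w ∈ p, w ∉ X → ∀ z ∈ Z, ¬ Desc (deleteIn E X) w z)
    (hb : ∀ x ∈ X, ∀ y ∈ Y, ∀ p, IsPath E x y p → ¬ IsCausal E p → IsProper X p →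
      Blocked E (Z ∪ C) p)
    (hc : DSep (deleteIn E X) Y C X)
    (hd : ∀ x ∈ X, (∃ i ∈ C, Desc E x i) → DSep (deleteOut E X) {x} Y ∅) :
    SourceCriterion E X Y Z C := by
  refine ⟨?_, ?_, ?_⟩
  · rintro x hx m hxm ⟨hmX, y, hy, hmy⟩ z hz hmz
    obtain ⟨l, hl, hlast⟩ := exists_isChain_of_desc hmy
    have hcaus : IsCausal E (x :: m :: l) :=
      List.isChain_cons_cons.2 ⟨hxm, hl.imp fun _ _ h => h.1⟩
    have hlX : ∀ n ∈ m :: l, n ∉ X := by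
      clear hlast hcaus hxm hmz hmy
      induction l generalizing m with
      | nil => simpa using hmX
      | cons k l ih =>
        obtain ⟨h1, h2⟩ := List.isChain_cons_cons.1 hl
        intro n hn
        rcases List.mem_cons.1 hn with rfl | hn
        · exact hmX
        · exact ih k h1.2 h2 n hn
    refine ha x hx y hy (x :: m :: l) ⟨rfl, by simpa using hlast, nodup_of_isChain hE hcaus,
      hcaus.imp fun _ _ => .inl⟩ hcaus hlX m (by simp) hmX z hz hmz
  · rintro t ⟨htX, y, hy, hty⟩ c hc' htc
    rcases desc_deleteIn_or_exit (X := X) htc with h | ⟨x, hx, hxc, u, htu, hux⟩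
    -- The descent to `c` avoids `X`: together with the one to `y` it forms a fork at `t` that is
    -- open given `X`, against `hc`.
    · have hconv : ∀ {v}, Desc (deleteIn E X) t v →
          Desc (fun a b => deleteIn E X a b ∧ a ∉ X) t v := by
        intro v hv
        induction hv with
        | refl => exact .refl
        | tail h1 h2 ih => exact ih.tail ⟨h2, notMem_of_desc_deleteIn htX h1⟩
      obtain ⟨p, hp, hp'⟩ := exists_path_of_fork (acyclic_mono hE fun _ _ h => h.1)
        (hconv hty) (hconv h)
      exact hp' (hc y hy c hc' p hp)
    -- The descent first meets `X` at `x`, an ancestor of `c`. The fork from `t` to `x` and to `y`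
    -- uses no edge out of `X`, against `hd`.
    · have hconv : ∀ {v}, Desc (deleteIn E X) t v →
          Desc (fun a b => deleteOut E X a b ∧ a ∉ (∅ : Set N)) t v := by
        intro v hv
        induction hv with
        | refl => exact .refl
        | tail h1 h2 ih => exact ih.tail ⟨⟨h2.1, notMem_of_desc_deleteIn htX h1⟩, by simp⟩
      have htx : Desc (fun a b => deleteOut E X a b ∧ a ∉ (∅ : Set N)) t x :=
        (hconv htu).tail ⟨⟨hux, notMem_of_desc_deleteIn htX htu⟩, by simp⟩
      obtain ⟨p, hp, hp'⟩ := exists_path_of_fork (acyclic_mono hE fun _ _ h => h.1)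
        htx (hconv hty)
      exact hp' (hd x hx ⟨c, hc', hxc⟩ x rfl y hy p hp)
  · intro h
    obtain ⟨x, hx, y, hy, p, h1, h2, h3, h4⟩ :=
      h.exists_path hE (Set.disjoint_union_left.2 ⟨hZX, hCX⟩) hXY
    exact h4 (hb x hx y hy p h1 h2 h3)

end CausalGraph

/-! ### From the source criterion back to paths. -/

namespace CausalGraph

open Relation

variable {N : Type*} {E : N → N → Prop} {X Y Z C Q : Set N}

/-- `s` is a source that is linked to `Y`. -/
def LinkedToEnd (E : N → N → Prop) (X Y Q : Set N) (s : N) : Prop :=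
  ∃ t, IsEnd E X Y Q t ∧ ReflTransGen (Coupled E X Y Q) s t

theorem LinkedToEnd.head {s t : N} (h : LinkedToEnd E X Y Q t) (hst : Coupled E X Y Q s t) :
    LinkedToEnd E X Y Q s :=
  h.imp fun _ h => ⟨h.1, h.2.head hst⟩

/-- Through `m`, the node `n` reaches what `m` reaches, so it can replace `m` at the head of the
chain. Only a chain of one source is delicate, because an end must lie outside `X`; `hend` covers
that case. -/
theorem LinkedToEnd.of_edge {n m : N} (h : LinkedToEnd E X Y Q m)
    (hnm : cutCausal E X Y n m) (hn : n ∉ Q) (hm : m ∉ X) (hend : n ∈ X → ¬ IsEnd E X Y Q m) :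
    LinkedToEnd E X Y Q n := by
  obtain ⟨t, ht, hmt⟩ := h
  rcases ReflTransGen.cases_head hmt with rfl | ⟨s, ⟨hs, q, hq, h1, h2⟩, hst⟩
  · by_cases hnX : n ∈ X
    · exact (hend hnX ht).elim
    · obtain ⟨y, hy, hty⟩ := ht.2.2
      exact ⟨n, ⟨hn, hnX, y, hy, hty.head hnm hn hm⟩, .refl⟩
  · exact ⟨t, ht, .head ⟨hs, q, hq, h1.head hnm hn hm, h2⟩ hst⟩

theorem Linked.of_flow {s x : N} (h : LinkedToEnd E X Y Q s) (hs : s ∉ Q) (hx : x ∈ X)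
    (hsx : Flow E X Y Q s x) : Linked E X Y Q :=
  h.elim fun t ht => ⟨s, t, ⟨hs, x, hx, hsx⟩, ht.1, ht.2⟩

/-- Read off sources from an open walk that ends in `Y`. -/
theorem linkedToEnd_of_openWalk (hE : ∀ n, ¬ TransGen E n n)
    (hQY : Disjoint Q Y) (hL : ¬ Linked E X Y Q) {n : N} {l : List N}
    (h : OpenWalk E Q (n :: l)) (hl : ∀ k ∈ l, k ∉ X)
    (hlast : (n :: l).getLast (by simp) ∈ Y) :
    (n ∉ X → n ∉ Q → (∀ m ∈ l.head?, E n m) → LinkedToEnd E X Y Q n) ∧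
    (∀ m ∈ l.head?, E m n → ∃ s, s ∉ X ∧ s ∉ Q ∧ Flow E X Y Q s n ∧ LinkedToEnd E X Y Q s) := by
  induction l generalizing n with
  | nil =>
    refine ⟨fun hnX hnQ _ => ⟨n, ⟨hnQ, hnX, n, hlast, .refl⟩, .refl⟩, by simp⟩
  | cons m l ih =>
    have hmX : m ∉ X := hl m (by simp)
    obtain ⟨ih1, ih2⟩ := ih (h.infix (List.infix_cons (List.infix_refl _)))
      (fun k hk => hl k (by simp [hk])) (by simpa using hlast)
    have ih1 := ih1 hmX
    have hmQ : (∀ k ∈ l.head?, ¬ (E n m ∧ E k m)) → m ∉ Q := by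
      intro hk
      cases l with
      | nil => exact fun hm => Set.disjoint_left.1 hQY hm (by simpa using hlast)
      | cons k l => exact (openWalk_cons_cons_cons.1 h).2.1.1 (hk k rfl)
    have hadj : ∀ k ∈ l.head?, E m k ∨ E k m := by
      intro k hk
      cases l with
      | nil => simp at hk
      | cons k' l =>
        obtain rfl : k' = k := by simpa using hk
        exact (List.isChain_cons_cons.1 (List.isChain_cons_cons.1 h.1).2).1
    constructor
    · intro hnX hnQ hfirst
      have hnm : E n m := hfirst m rfl
      -- If `m` is a collider, `n` and the source `s` behind it meet at a node of `Q` below `m`. A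
      -- descent that meets `X` instead would make `s` a start, against `hL`.
      by_cases hc : ∃ k ∈ l.head?, E k m
      · obtain ⟨k, hk, hkm⟩ := hc
        obtain ⟨s, hsX, hsQ, hsm, hs⟩ := ih2 k hk hkm
        obtain ⟨d, hd, hmd⟩ : ∃ d ∈ Q, Desc E m d := by
          cases l with
          | nil => simp at hk
          | cons k' l =>
            obtain rfl : k' = k := by simpa using hk
            exact (openWalk_cons_cons_cons.1 h).2.1.2 ⟨hnm, hkm⟩
        obtain ⟨q, hq | hq, hmq⟩ := flow_of_desc (Y := Y) hmX hd hmd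
        · exact hs.head ⟨hsQ, q, hq, hmq.head (cutCausal_of_notMem hnm hnX) hnQ hmX,
            hsm.trans hmX hmq⟩
        · exact (hL (.of_flow hs hsQ hq (hsm.trans hmX hmq))).elim
      · push Not at hc
        exact (ih1 (hmQ fun k hk h => hc k hk h.2)
          fun k hk => (hadj k hk).resolve_right (hc k hk)).of_edge
          (cutCausal_of_notMem hnm hnX) hnQ hmX fun h => (hnX h).elim
    · intro m' hm' hmn
      obtain rfl : m = m' := by simpa using hm'
      have hmQ := hmQ fun k _ h => not_edge_symm hE hmn h.1
      have hcut : cutCausal E X Y m n := cutCausal_of_notMem hmn hmX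
      -- The source already found for `m`, or `m` itself if the walk has a fork or its end there,
      -- feeds `n` as well.
      by_cases hc : ∃ k ∈ l.head?, E k m
      · obtain ⟨k, hk, hkm⟩ := hc
        obtain ⟨s, hsX, hsQ, hsm, hs⟩ := ih2 k hk hkm
        exact ⟨s, hsX, hsQ, hsm.trans hmX (.single hcut hmQ), hs⟩
      · push Not at hc
        exact ⟨m, hmX, hmQ, .single hcut hmQ, ih1 hmQ
          fun k hk => (hadj k hk).resolve_right (hc k hk)⟩

/-- The first arrow against the direction of travel sits at a collider, which is open and so has a
descendant in `Q`. -/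
theorem exists_desc_of_not_isCausal {n m : N} {l : List N} (h : OpenWalk E Q (n :: m :: l))
    (hnm : E n m) (hl : ¬ IsCausal E (m :: l)) : ∃ d ∈ Q, Desc E m d := by
  induction l generalizing n m with
  | nil => simp [IsCausal] at hl
  | cons k l ih =>
    obtain ⟨-, ht, hw⟩ := openWalk_cons_cons_cons.1 h
    by_cases hk : E k m
    · exact ht.2 ⟨hnm, hk⟩
    · have hmk : E m k := ((List.isChain_cons_cons.1 hw.1).1).resolve_right hk
      obtain ⟨d, hd, hkd⟩ := ih hw hmk fun h => hl (List.isChain_cons_cons.2 ⟨hmk, h⟩)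
      exact ⟨d, hd, .head hmk hkd⟩

namespace SourceCriterion

/-- The nodes on proper causal paths have no descendants among the conditioned nodes. -/
theorem isEnd_of_mem (h : SourceCriterion E X Y Z C) {x m : N} (hx : x ∈ X) (hxm : E x m)
    (hm : m ∈ freeAncestors E X Y) : IsEnd E X Y (Z ∪ C) m := by
  obtain ⟨hmX, y, hy, hmy⟩ := hm
  have hfree : ∀ k, Desc (deleteIn E X) m k → Desc (deleteIn E X) k y → k ∉ Z ∪ C := by
    rintro k hmk hky (hk | hk)
    · exact h.not_desc x hx m hxm ⟨hmX, y, hy, hmy⟩ k hk hmk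
    · exact h.not_anc k ⟨notMem_of_desc_deleteIn hmX hmk, y, hy, hky⟩ k hk .refl
  refine ⟨hfree m .refl hmy, hmX, y, hy, ?_⟩
  have key : ∀ k, Desc (deleteIn E X) m k → Desc (deleteIn E X) k y →
      Flow E X Y (Z ∪ C) m k := by
    intro k hmk hky
    induction hmk with
    | refl => exact .refl
    | @tail b c hb hbc ih =>
      have hbX := notMem_of_desc_deleteIn hmX hb
      exact (ih (.head hbc hky)).tail
        ⟨cutCausal_of_notMem hbc.1 hbX, hfree b hb (.head hbc hky), .inl hbX⟩
  exact key y hmy .refl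

/-- Follow the descent until it meets `Q` or `X`. Meeting `Z` violates `not_desc` and meeting `C`
violates `not_anc`. Meeting `X` makes `m`, which already reaches `Y`, a start and an end at once: a
chain of one source. -/
theorem not_desc_of_mem (h : SourceCriterion E X Y Z C) (hZX : Disjoint Z X)
    {x m : N} (hx : x ∈ X) (hxm : E x m) (hm : m ∈ freeAncestors E X Y) {d : N}
    (hd : d ∈ X ∪ (Z ∪ C)) : ¬ Desc E m d := by
  intro hmd
  have hmX := hm.1
  obtain ⟨n, hn, hmn⟩ : ∃ n, (n ∈ Z ∪ C ∨ n ∈ X) ∧ Flow E X Y (Z ∪ C) m n := by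
    rcases hd with hd | hd
    · have := flow_of_desc (Y := Y) (Q := Z ∪ C ∪ X) hmX (.inr hd) hmd
      obtain ⟨n, hn, hmn⟩ := this
      refine ⟨n, by simpa using hn, ?_⟩
      exact ReflTransGen.mono (fun a b h => ⟨h.1, fun h' => h.2.1 (.inl h'), h.2.2⟩) _ _ hmn
    · exact flow_of_desc hmX hd hmd
  have hend := h.isEnd_of_mem hx hxm hm
  rcases hn with (hn | hn) | hn
  · exact h.not_desc x hx m hxm hm n hn (hmn.desc_deleteIn hmX (Set.disjoint_left.1 hZX hn))
  · exact h.not_anc m hm n hn hmn.desc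
  · exact h.not_linked ⟨m, m, ⟨hend.1, n, hn, hmn⟩, hend, .refl⟩

theorem no_forbidden (h : SourceCriterion E X Y Z C) {x y : N} (hx : x ∈ X) (hy : y ∈ Y)
    {p : List N} (hp : IsPath E x y p) (hc : IsCausal E p) (hpX : IsProper X p) {w : N}
    (hw : w ∈ p) (hwX : w ∉ X) {z : N} (hz : z ∈ Z) : ¬ Desc (deleteIn E X) w z := by
  obtain ⟨l, rfl⟩ := List.head?_eq_some_iff.1 hp.1
  cases l with
  | nil =>
    obtain rfl : w = x := by simpa using hw
    exact (hwX hx).elim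
  | cons m l =>
    obtain ⟨hxm, hc⟩ := List.isChain_cons_cons.1 hc
    have hw : w ∈ m :: l := (List.mem_cons.1 hw).resolve_left fun e => hwX (e ▸ hx)
    have hpX : ∀ k ∈ m :: l, k ∉ X := hpX
    obtain ⟨h1, h2⟩ := desc_deleteIn_of_isChain hc (fun k hk => hpX k (by simp [hk])) hw
    have hlast : (m :: l).getLast (by simp) = y := by
      have := hp.2.1
      rw [List.getLast?_cons_cons, List.getLast?_eq_getLast_of_ne_nil (by simp)] at this
      exact Option.some_injective _ this
    rw [hlast] at h2
    exact fun hwz => h.not_desc x hx m hxm ⟨hpX m (by simp), y, hy, h1.trans h2⟩ z hz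
      (h1.trans hwz)

theorem blocked (h : SourceCriterion E X Y Z C) (hE : ∀ n, ¬ TransGen E n n)
    (hXY : Disjoint X Y) (hQX : Disjoint (Z ∪ C) X) (hQY : Disjoint (Z ∪ C) Y) {x y : N}
    (hx : x ∈ X) (hy : y ∈ Y) {p : List N} (hp : IsPath E x y p) (hc : ¬ IsCausal E p)
    (hpX : IsProper X p) : Blocked E (Z ∪ C) p := by
  by_contra hb
  have hL := h.not_linked
  have how : OpenWalk E (Z ∪ C) p := ⟨hp.2.2.2, hb⟩
  have hxQ : x ∉ Z ∪ C := Set.disjoint_right.1 hQX hx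
  obtain ⟨l, rfl⟩ := List.head?_eq_some_iff.1 hp.1
  cases l with
  | nil => exact hc (by simp [IsCausal])
  | cons m l =>
    have hpX : ∀ k ∈ m :: l, k ∉ X := hpX
    have hmX := hpX m (by simp)
    have hlast : (m :: l).getLast (by simp) = y := by
      have := hp.2.1
      rw [List.getLast?_cons_cons, List.getLast?_eq_getLast_of_ne_nil (by simp)] at this
      exact Option.some_injective _ this
    rcases (List.isChain_cons_cons.1 how.1).1 with hxm | hmx
    · have hcl : ¬ IsCausal E (m :: l) := fun h => hc (List.isChain_cons_cons.2 ⟨hxm, h⟩)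
      -- Being non-causal, the path must turn at a collider below `m`, which `not_desc_of_mem`
      -- excludes for `m` in `freeAncestors`. Otherwise the edge survives in `cutCausal`, and `x`
      -- can serve as a source.
      by_cases hmB : m ∈ freeAncestors E X Y
      · obtain ⟨d, hd, hmd⟩ := exists_desc_of_not_isCausal how hxm hcl
        exact h.not_desc_of_mem (Set.disjoint_union_left.1 hQX).1 hx hxm hmB (.inr hd) hmd
      have hcut : cutCausal E X Y x m := ⟨hxm, fun h => hmB h.2⟩
      cases l with
      | nil => exact hcl (by simp [IsCausal])
      | cons k l =>
        obtain ⟨-, ht, hw⟩ := openWalk_cons_cons_cons.1 how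
        obtain ⟨h1, h2⟩ := linkedToEnd_of_openWalk hE hQY hL hw
          (fun k hk => hpX k (by simp [hk])) (hlast ▸ hy)
        by_cases hkm : E k m
        · obtain ⟨s, hsX, hsQ, hsm, hs⟩ := h2 k rfl hkm
          obtain ⟨d, hd, hmd⟩ := ht.2 ⟨hxm, hkm⟩
          obtain ⟨q, hq | hq, hmq⟩ := flow_of_desc (Y := Y) hmX hd hmd
          · exact hL (.of_flow (hs.head ⟨hsQ, q, hq, hmq.head hcut hxQ hmX, hsm.trans hmX hmq⟩)
              hxQ hx .refl)
          · exact hL (.of_flow hs hsQ hq (hsm.trans hmX hmq))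
        · have hmk : E m k := ((List.isChain_cons_cons.1 hw.1).1).resolve_right hkm
          have hmQ := ht.1 fun h => hkm h.2
          refine hL (.of_flow ((h1 hmX hmQ (by simpa using hmk)).of_edge hcut hxQ hmX ?_)
            hxQ hx .refl)
          -- An end `m` would lie in `freeAncestors`, the case already settled.
          rintro - ⟨-, -, y', hy', hmy'⟩
          exact hmB ⟨hmX, y', hy', hmy'.desc_deleteIn hmX (Set.disjoint_right.1 hXY hy')⟩
    · obtain ⟨s, hsX, hsQ, hsx, hs⟩ := (linkedToEnd_of_openWalk hE hQY hL how
        (fun k hk => hpX k hk) (by simpa [hlast] using hy)).2 m rfl hmx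
      exact hL (.of_flow hs hsQ hx hsx)

/-- Once the edges into `X` are gone, a node with an incoming edge has no descendant in `X`. So an
open path has no collider and hence has a common ancestor of its ends, which lies in `freeAncestors`
and above `C`. -/
theorem dSep_deleteIn (h : SourceCriterion E X Y Z C) (hXY : Disjoint X Y) (hCX : Disjoint C X) :
    DSep (deleteIn E X) Y C X := by
  intro y hy c hc p hp
  by_contra hb
  obtain ⟨l, rfl⟩ := List.head?_eq_some_iff.1 hp.1
  obtain ⟨t, h1, h2, h3⟩ := exists_fork_of_openWalk (E := deleteIn E X) (C := X)
    ⟨hp.2.2.2, hb⟩ fun a b hab d hd hbd => notMem_of_desc_deleteIn hab.2 hbd hd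
  have hlast : (y :: l).getLast (by simp) = c := by
    have := hp.2.1
    rw [List.getLast?_eq_getLast_of_ne_nil (by simp)] at this
    exact Option.some_injective _ this
  rw [hlast] at h2 h3
  have ht : t ∉ X := by
    rcases h3 with rfl | rfl | h3
    · exact Set.disjoint_right.1 hXY hy
    · exact Set.disjoint_left.1 hCX hc
    · exact h3
  exact h.not_anc t ⟨ht, y, hy, h1⟩ c hc h2.of_deleteIn

/-- Given `∅` an open path has no collider. Its apex and the directed path from there to `Y` avoid
`X`, whose outgoing edges are gone. So the apex is in `freeAncestors` and above `x`, hence above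
`C`. -/
theorem dSep_deleteOut (h : SourceCriterion E X Y Z C) (hXY : Disjoint X Y) {x : N} (hx : x ∈ X)
    (hxC : ∃ i ∈ C, Desc E x i) : DSep (deleteOut E X) {x} Y ∅ := by
  rintro _ rfl y hy p hp
  rename_i x'
  by_contra hb
  obtain ⟨l, rfl⟩ := List.head?_eq_some_iff.1 hp.1
  obtain ⟨t, h1, h2, -⟩ := exists_fork_of_openWalk (E := deleteOut E X) (C := ∅)
    ⟨hp.2.2.2, hb⟩ (by simp)
  have hlast : (x' :: l).getLast (by simp) = y := by
    have := hp.2.1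
    rw [List.getLast?_eq_getLast_of_ne_nil (by simp)] at this
    exact Option.some_injective _ this
  rw [hlast] at h2
  have hyX := Set.disjoint_right.1 hXY hy
  have ht : t ∉ X := by
    rcases ReflTransGen.cases_head h2 with rfl | ⟨c, hc, -⟩
    · exact hyX
    · exact hc.2
  have hty : Desc (deleteIn E X) t y := by
    clear h1 hb ht
    induction h2 using ReflTransGen.head_induction_on with
    | refl => exact .refl
    | head hab hb ih =>
      refine .head ⟨hab.1, ?_⟩ ih
      rcases ReflTransGen.cases_head hb with rfl | ⟨c, hc, -⟩
      · exact hyX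
      · exact hc.2
  obtain ⟨i, hi, hxi⟩ := hxC
  exact h.not_anc t ⟨ht, y, hy, hty⟩ i hi ((h1.mono fun _ _ h => h.1).trans hxi)

end SourceCriterion

end CausalGraph

namespace CausalGraph

open Relation

/-! ### Factorizations along a graph -/

theorem exists_source {N : Type*} [Finite N] {E : N → N → Prop} (hE : ∀ n, ¬ TransGen E n n) {S : Set N} (hS : S.Nonempty) :
    ∃ s ∈ S, ∀ p ∈ S, ¬ E p s := by
  have : IsTrans N (TransGen E) := ⟨fun _ _ _ => TransGen.trans⟩
  have : Std.Irrefl (TransGen E) := ⟨hE⟩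
  have hwf : WellFounded (TransGen E) := Finite.wellFounded_of_trans_of_irrefl _
  obtain ⟨s, hs, h⟩ := hwf.has_min S hS
  exact ⟨s, hs, fun p hp hps => h p hp (.single hps)⟩

open Classical in
/-- Take the coordinates in `M` from `w` and the others from `w'`. -/
noncomputable def splice {N : Type*} {D : N → Type*} (M : Set N) (w w' : ∀ n, D n) : ∀ n, D n :=
  fun n => if n ∈ M then w n else w' n

theorem splice_splice {N : Type*} {D : N → Type*} (M : Set N) (w w' : ∀ n, D n) :
    splice M (splice M w w') (splice M w' w) = w := by
  ext n
  by_cases h : n ∈ M <;> simp [splice, h]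

variable {N : Type*} [Fintype N] [DecidableEq N] {D : N → Type*} [∀ n, Fintype (D n)]

/-- Sum over the coordinate `n` first, where `f` is constant. -/
theorem sum_mul_eq_of_sum_update_eq {n : N} {f k k' : (∀ n, D n) → ℝ}
    (hf : DependsOn f ({n}ᶜ : Set N))
    (hk : ∀ w, ∑ d, k (Function.update w n d) = ∑ d, k' (Function.update w n d)) :
    ∑ w, f w * k w = ∑ w, f w * k' w := by
  rw [← (Equiv.piSplitAt n D).symm.sum_comp, ← (Equiv.piSplitAt n D).symm.sum_comp,
    Fintype.sum_prod_type_right, Fintype.sum_prod_type_right]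
  refine Finset.sum_congr rfl fun r _ => ?_
  rcases isEmpty_or_nonempty (D n) with hD | ⟨⟨d₀⟩⟩
  · simp
  have hup : ∀ d, (Equiv.piSplitAt n D).symm (d, r) =
      Function.update ((Equiv.piSplitAt n D).symm (d₀, r)) n d := by
    intro d
    ext j
    by_cases hj : j = n
    · subst hj; simp [Equiv.piSplitAt]
    · simp [Equiv.piSplitAt, hj]
  have hfd : ∀ d, f ((Equiv.piSplitAt n D).symm (d, r)) =
      f ((Equiv.piSplitAt n D).symm (d₀, r)) := by
    intro d
    refine hf fun j hj => ?_
    have hj : j ≠ n := hj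
    simp [Equiv.piSplitAt, hj]
  simp_rw [hfd, ← Finset.mul_sum]
  congr 1
  rw [Finset.sum_congr rfl fun d _ => congrArg k (hup d), hk,
    Finset.sum_congr rfl fun d _ => congrArg k' (hup d).symm]

/-- `K` is a family of conditional probabilities, one for each node given its parents. -/
structure IsKernelFamily (E : N → N → Prop) (K : N → (∀ n, D n) → ℝ) : Prop where
  dependsOn : ∀ n, DependsOn (K n) (insert n {p | E p n})
  sum_update : ∀ n w, ∑ d, K n (Function.update w n d) = 1

/-- `T` contains the parents of its elements. -/
def IsAncestral (E : N → N → Prop) (T : Set N) : Prop := ∀ a b, E a b → b ∈ T → a ∈ T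

variable {E : N → N → Prop} {K : N → (∀ n, D n) → ℝ}

open Classical in
/-- The kernels outside an ancestral set may be replaced by uniform ones. -/
theorem IsKernelFamily.sum_eq_uniform [∀ n, Nonempty (D n)] (hK : IsKernelFamily E K)
    (hE : ∀ n, ¬ TransGen E n n) {T : Set N} (hT : IsAncestral E T) {f : (∀ n, D n) → ℝ}
    (hf : DependsOn f T) :
    ∑ w, f w * ∏ n, K n w =
      ∑ w, f w * ∏ n, if n ∈ T then K n w else (Fintype.card (D n) : ℝ)⁻¹ := by
  suffices h : ∀ S : Finset N, ∀ T : Set N, (S : Set N) = Tᶜ → IsAncestral E T → DependsOn f T →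
      ∑ w, f w * ∏ n, K n w =
        ∑ w, f w * ∏ n, if n ∈ T then K n w else (Fintype.card (D n) : ℝ)⁻¹ from
    h (Set.toFinset Tᶜ) T (by simp) hT hf
  clear hT hf T
  intro S
  induction hc : S.card using Nat.strong_induction_on generalizing S with
  | _ c ih =>
  subst hc
  intro T hST hT hf
  rcases S.eq_empty_or_nonempty with rfl | hne
  · have : T = Set.univ := by
      rw [← compl_compl T, ← hST]; simp
    simp [this]
  obtain ⟨s, hs, hsrc⟩ := exists_source hE (S := (S : Set N)) hne
  have hs : s ∈ S := hs
  have hsT : s ∉ T := by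
    have : s ∈ Tᶜ := hST ▸ hs
    exact this
  have hmemS : ∀ n, n ∈ S ↔ n ∉ T := fun n => by
    rw [← Finset.mem_coe, hST, Set.mem_compl_iff]
  -- All parents of `s` are in `T`, so `insert s T` is ancestral and induction makes every kernel
  -- outside it uniform. Then only the kernel of `s` still depends on the coordinate `s`, and it
  -- sums to 1 just as the uniform one does.
  rw [ih _ (Finset.card_erase_lt_of_mem hs) (S.erase s) rfl (insert s T)
    (by ext n; simp [hmemS, and_comm]) ?_ (hf.mono (Set.subset_insert _ _))]
  · have hsplit : ∀ (T' : Set N) (w : ∀ n, D n),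
        (f w * ∏ n, if n ∈ T' then K n w else (Fintype.card (D n) : ℝ)⁻¹) =
        (f w * ∏ n ∈ Finset.univ.erase s, if n ∈ T' then K n w else (Fintype.card (D n) : ℝ)⁻¹) *
          if s ∈ T' then K s w else (Fintype.card (D s) : ℝ)⁻¹ := by
      intro T' w
      rw [← Finset.prod_erase_mul _ _ (Finset.mem_univ s), mul_assoc]
    have hcongr : ∀ (T' : Set N), (∀ n, n ≠ s → (n ∈ T' ↔ n ∈ T)) → ∀ w : ∀ n, D n,
        (∏ n ∈ Finset.univ.erase s, if n ∈ T' then K n w else (Fintype.card (D n) : ℝ)⁻¹) =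
        ∏ n ∈ Finset.univ.erase s, if n ∈ T then K n w else (Fintype.card (D n) : ℝ)⁻¹ := by
      intro T' hT' w
      refine Finset.prod_congr rfl fun n hn => ?_
      simp only [hT' n (Finset.mem_erase.1 hn).1]
    rw [Finset.sum_congr rfl fun w _ => hsplit (insert s T) w,
      Finset.sum_congr rfl fun w _ => hsplit T w,
      Finset.sum_congr rfl fun w _ => by rw [hcongr (insert s T) (fun n hn => by simp [hn]) w]]
    refine sum_mul_eq_of_sum_update_eq (n := s) ?_ fun w => ?_
    · intro w w' hw
      have hwT : ∀ n ∈ T, w n = w' n := fun n hn => hw n fun e => hsT (e ▸ hn)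
      beta_reduce
      rw [hf hwT]
      congr 1
      refine Finset.prod_congr rfl fun n hn => ?_
      by_cases hnT : n ∈ T
      · simp only [hnT, if_true]
        refine hK.dependsOn n fun p hp => ?_
        rcases hp with rfl | hp
        · exact hwT _ hnT
        · exact hwT _ (hT p n hp hnT)
      · simp [hnT]
    · simp [hsT, hK.sum_update]
  · intro a b hab hb
    rcases hb with rfl | hb
    · by_contra ha
      have haT : a ∉ T := fun h => ha (.inr h)
      exact hsrc a ((hmemS a).2 haT) hab
    · exact .inr (hT a b hab hb)

theorem IsKernelFamily.sum_prod_eq_one [∀ n, Nonempty (D n)] (hK : IsKernelFamily E K)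
    (hE : ∀ n, ¬ TransGen E n n) : ∑ w, ∏ n, K n w = 1 := by
  classical
  have h := hK.sum_eq_uniform hE (T := ∅) (fun _ _ _ h => h.elim) (f := fun _ => 1)
    fun _ _ _ => rfl
  simp only [one_mul, Set.mem_empty_iff_false, if_false, Finset.sum_const, Finset.card_univ,
    nsmul_eq_mul] at h
  rw [h, Fintype.card_pi, Nat.cast_prod, ← Finset.prod_mul_distrib]
  refine Finset.prod_eq_one fun n _ => mul_inv_cancel₀ ?_
  exact_mod_cast Fintype.card_ne_zero

open Classical in
-- After the kernels outside `T` have become uniform, the two families coincide. The two graphs may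
-- differ as long as `T` is ancestral in both.
theorem IsKernelFamily.sum_congr [∀ n, Nonempty (D n)] (hK : IsKernelFamily E K)
    (hE : ∀ n, ¬ TransGen E n n) {E' : N → N → Prop} {K' : N → (∀ n, D n) → ℝ}
    (hK' : IsKernelFamily E' K') (hE' : ∀ n, ¬ TransGen E' n n) {T : Set N}
    (hT : IsAncestral E T) (hT' : IsAncestral E' T) (hKK' : ∀ n ∈ T, ∀ w, K n w = K' n w)
    {f : (∀ n, D n) → ℝ} (hf : DependsOn f T) :
    ∑ w, f w * ∏ n, K n w = ∑ w, f w * ∏ n, K' n w := by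
  rw [hK.sum_eq_uniform hE hT hf, hK'.sum_eq_uniform hE' hT' hf]
  refine Finset.sum_congr rfl fun w _ => ?_
  congr 1
  refine Finset.prod_congr rfl fun n _ => ?_
  split_ifs with h
  · exact hKK' n h w
  · rfl

theorem sum_sum_splice (M : Set N) (F : (∀ n, D n) → (∀ n, D n) → ℝ) :
    ∑ w, ∑ w', F (splice M w w') (splice M w' w) = ∑ w, ∑ w', F w w' := by
  rw [← Fintype.sum_prod_type' , ← Fintype.sum_prod_type']
  exact Fintype.sum_equiv ⟨fun p => (splice M p.1 p.2, splice M p.2 p.1),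
    fun p => (splice M p.1 p.2, splice M p.2 p.1), fun p => by simp [splice_splice],
    fun p => by simp [splice_splice]⟩ _ _ fun _ => rfl

/-- Conditional independence from a product form: every factor lives on one side of `Q`. -/
theorem sum_mul_sum_of_product {M Q : Set N} {J : N → (∀ n, D n) → ℝ}
    (hJ : ∀ n, DependsOn (J n) (M ∪ Q) ∨ DependsOn (J n) (Mᶜ ∪ Q))
    {a b q : (∀ n, D n) → ℝ} (ha : DependsOn a (M ∪ Q)) (hb : DependsOn b (Mᶜ ∪ Q))
    (hq : DependsOn q Q) (hqQ : ∀ w w', q w ≠ 0 → q w' ≠ 0 → ∀ n ∈ Q, w n = w' n) :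
    (∑ w, a w * b w * q w * ∏ n, J n w) * (∑ w, q w * ∏ n, J n w) =
      (∑ w, a w * q w * ∏ n, J n w) * (∑ w, b w * q w * ∏ n, J n w) := by
  -- Both products become sums over pairs of worlds, and the members of a pair exchange their
  -- coordinates in `M`. If they agree on `Q`, each factor sees unmixed worlds; if not, both sides
  -- vanish because `q` fixes the values on `Q`.
  rw [Finset.sum_mul_sum, Finset.sum_mul_sum,
    ← sum_sum_splice M fun w w' => (a w * q w * ∏ n, J n w) * (b w' * q w' * ∏ n, J n w')]
  refine Finset.sum_congr rfl fun w _ => Finset.sum_congr rfl fun w' _ => ?_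
  by_cases hag : ∀ n ∈ Q, w n = w' n
  · have h1 : ∀ n ∈ M ∪ Q, splice M w w' n = w n := by
      intro n hn
      by_cases h : n ∈ M
      · simp [splice, h]
      · simp [splice, h, hag n (hn.resolve_left h)]
    have h2 : ∀ n ∈ Mᶜ ∪ Q, splice M w w' n = w' n := by
      intro n hn
      by_cases h : n ∈ M
      · simp [splice, h, hag n (hn.resolve_left fun h' => h' h)]
      · simp [splice, h]
    have h3 : ∀ n ∈ M ∪ Q, splice M w' w n = w' n := by
      intro n hn
      by_cases h : n ∈ M
      · simp [splice, h]
      · simp [splice, h, hag n (hn.resolve_left h)]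
    have h4 : ∀ n ∈ Mᶜ ∪ Q, splice M w' w n = w n := by
      intro n hn
      by_cases h : n ∈ M
      · simp [splice, h, hag n (hn.resolve_left fun h' => h' h)]
      · simp [splice, h]
    have hprod : (∏ n, J n (splice M w w')) * ∏ n, J n (splice M w' w) =
        (∏ n, J n w) * ∏ n, J n w' := by
      rw [← Finset.prod_mul_distrib, ← Finset.prod_mul_distrib]
      refine Finset.prod_congr rfl fun n _ => ?_
      rcases hJ n with h | h
      · rw [h h1, h h3]
      · rw [h h2, h h4, mul_comm]
    rw [ha h1, hb h4, hq fun n hn => h1 n (.inr hn), hq fun n hn => h3 n (.inr hn)]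
    linear_combination -(a w * b w * q w * q w') * hprod
  · have h0 : q w = 0 ∨ q w' = 0 := by
      by_contra! h
      exact hag (hqQ w w' h.1 h.2)
    have h0' : q (splice M w w') = 0 ∨ q (splice M w' w) = 0 := by
      by_contra! h
      have h' := hqQ _ _ h.1 h.2
      refine hag fun n hn => ?_
      have := h' n hn
      by_cases hM : n ∈ M
      · simpa [splice, hM] using this
      · simpa [splice, hM] using this.symm
    rcases h0 with h | h <;> rcases h0' with h' | h' <;> simp [h, h']

/-- Conditional independence for a family of kernels. -/
theorem IsKernelFamily.sum_mul_sum [∀ n, Nonempty (D n)] (hK : IsKernelFamily E K)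
    (hE : ∀ n, ¬ TransGen E n n) {T M Q : Set N} (hT : IsAncestral E T)
    (hfam : ∀ n ∈ T, (insert n {p | E p n} ⊆ M ∪ Q) ∨ (insert n {p | E p n} ⊆ Mᶜ ∪ Q))
    {a b q : (∀ n, D n) → ℝ} (ha : DependsOn a (M ∪ Q)) (hb : DependsOn b (Mᶜ ∪ Q))
    (hq : DependsOn q Q) (hqQ : ∀ w w', q w ≠ 0 → q w' ≠ 0 → ∀ n ∈ Q, w n = w' n)
    (haT : DependsOn a T) (hbT : DependsOn b T) (hqT : DependsOn q T) :
    (∑ w, a w * b w * q w * ∏ n, K n w) * (∑ w, q w * ∏ n, K n w) =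
      (∑ w, a w * q w * ∏ n, K n w) * (∑ w, b w * q w * ∏ n, K n w) := by
  classical
  have hmul : ∀ {f g : (∀ n, D n) → ℝ}, DependsOn f T → DependsOn g T →
      DependsOn (fun w => f w * g w) T := fun hf hg w w' h => by
    simp only [hf h, hg h]
  rw [hK.sum_eq_uniform hE hT (hmul (hmul haT hbT) hqT), hK.sum_eq_uniform hE hT hqT,
    hK.sum_eq_uniform hE hT (hmul haT hqT), hK.sum_eq_uniform hE hT (hmul hbT hqT)]
  refine sum_mul_sum_of_product (fun n => ?_) ha hb hq hqQ
  by_cases hn : n ∈ T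
  · simp only [hn, if_true]
    exact (hfam n hn).imp (fun h => (hK.dependsOn n).mono h) fun h => (hK.dependsOn n).mono h
  · simp only [hn, if_false]
    exact .inl fun _ _ _ => rfl

end CausalGraph

/-! ### Kernels of the observational, the intervened and the cut model. -/

namespace MGraph.SCM

open CausalGraph Relation

section Kernels

variable {Vo Vm U : Type*} {G : MGraph Vo Vm U} (M : G.SCM)

instance (n : MNode Vo Vm U) : Nonempty (n.Dom M.D M.L) :=
  match n with
  | .obs v => M.nonemptyD v
  | .lat u => M.nonemptyL u
  | .miss _ => ⟨true⟩
  | .sel => ⟨true⟩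

/-- The conditional probability of the value of `n` given the values of its parents. -/
noncomputable def kernel (n : MNode Vo Vm U) (w : M.World) : ℝ :=
  ∑ e, Set.indicator {e | w n = M.func n (fun p => w p.1) e} (M.noiseProb n) e

open Classical in
/-- Replace the values of the variables in `X` by `x`. -/
noncomputable def override (X : Finset (Vo ⊕ Vm)) (x : M.Val X) (w : M.World) : M.World
  | .obs v => if h : v ∈ X then x ⟨v, h⟩ else w (.obs v)
  | .lat u => w (.lat u)
  | .miss m => w (.miss m)
  | .sel => w .sel

variable {M}

theorem kernel_nonneg (n : MNode Vo Vm U) (w : M.World) : 0 ≤ M.kernel n w :=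
  Finset.sum_nonneg fun e _ => Set.indicator_nonneg (fun _ _ => M.noiseProb_nonneg n _) e

theorem override_of_notMem {X : Finset (Vo ⊕ Vm)} (x : M.Val X) (w : M.World)
    {n : MNode Vo Vm U} (hn : n ∉ nodes U X) : M.override X x w n = w n := by
  cases n with
  | obs v => exact dif_neg fun h => hn ⟨v, h, rfl⟩
  | _ => rfl

theorem override_of_mem {X : Finset (Vo ⊕ Vm)} (x : M.Val X) (w w' : M.World)
    {n : MNode Vo Vm U} (hn : n ∈ nodes U X) : M.override X x w n = M.override X x w' n := by
  obtain ⟨v, hv, rfl⟩ := hn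
  have h : ∀ w : M.World, M.override X x w (.obs v) = x ⟨v, hv⟩ := fun w => dif_pos hv
  rw [h, h]

theorem override_eq_iff {X : Finset (Vo ⊕ Vm)} (x : M.Val X) (w : M.World) :
    M.override X x w = w ↔ w ∈ M.event X x := by
  constructor
  · intro h v
    rw [← h]
    exact dif_pos v.2
  · intro h
    ext n
    cases n with
    | obs v =>
      by_cases hv : v ∈ X
      · exact (dif_pos hv).trans (h ⟨v, hv⟩).symm
      · exact dif_neg hv
    | _ => rfl

theorem override_congr {X : Finset (Vo ⊕ Vm)} (x : M.Val X) {w w' : M.World}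
    {n : MNode Vo Vm U} (h : n ∉ nodes U X → w n = w' n) :
    M.override X x w n = M.override X x w' n := by
  by_cases hn : n ∈ nodes U X
  · exact override_of_mem x _ _ hn
  · rw [override_of_notMem x _ hn, override_of_notMem x _ hn, h hn]

open Classical in
/-- The kernels after deletion of the first edges of the causal paths from `X` to `Y`. -/
noncomputable def kernelCut (M : G.SCM) (X Y : Finset (Vo ⊕ Vm)) (x : M.Val X)
    (n : MNode Vo Vm U) (w : M.World) : ℝ :=
  if n ∈ freeAncestors G.edge (nodes U X) (nodes U Y) then M.kernel n (M.override X x w)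
  else M.kernel n w

theorem kernelCut_nonneg {X Y : Finset (Vo ⊕ Vm)} (x : M.Val X) (n : MNode Vo Vm U)
    (w : M.World) : 0 ≤ M.kernelCut X Y x n w := by
  unfold kernelCut
  split_ifs <;> exact kernel_nonneg _ _

theorem kernel_dependsOn (n : MNode Vo Vm U) :
    DependsOn (M.kernel n) (insert n {p | G.edge p n}) := by
  intro w w' h
  unfold kernel
  have h1 : w n = w' n := h n (Set.mem_insert _ _)
  have h2 : (fun p : {p // G.edge p n} => w p.1) = fun p : {p // G.edge p n} => w' p.1 := by
    funext p
    exact h p.1 (Set.mem_insert_of_mem _ p.2)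
  rw [h1, h2]

end Kernels

variable {Vo Vm U : Type*} {G : MGraph Vo Vm U} {M : G.SCM}
variable [DecidableEq Vo] [DecidableEq Vm] [DecidableEq U]

theorem kernel_sum_update (n : MNode Vo Vm U) (hn : ¬ G.edge n n) (w : M.World) :
    ∑ d, M.kernel n (Function.update w n d) = 1 := by
  classical
  unfold kernel
  rw [Finset.sum_comm, ← M.noiseProb_sum n]
  refine Finset.sum_congr rfl fun e _ => ?_
  have h2 : ∀ d, (fun p : {p // G.edge p n} => Function.update w n d p.1) =
      fun p : {p // G.edge p n} => w p.1 := by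
    intro d
    funext p
    have hp : p.1 ≠ n := by
      intro h
      have := p.2
      rw [h] at this
      exact hn this
    exact Function.update_of_ne hp _ _
  simp [Set.indicator_apply, h2]

theorem isKernelFamily_kernel : IsKernelFamily G.edge M.kernel :=
  ⟨kernel_dependsOn, fun n => kernel_sum_update n fun h => G.acyclic n (.single h)⟩

open Classical in
/-- The kernels of the intervention `do(X = x)`. -/
noncomputable def kernelDo (M : G.SCM) (X : Finset (Vo ⊕ Vm)) (x : M.Val X)
    (n : MNode Vo Vm U) (w : M.World) : ℝ :=
  if n ∈ nodes U X then (if w n = M.override X x w n then 1 else 0)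
  else M.kernel n (M.override X x w)

theorem override_update {X : Finset (Vo ⊕ Vm)} (x : M.Val X) (w : M.World)
    {n : MNode Vo Vm U} (hn : n ∉ nodes U X) (d) :
    M.override X x (Function.update w n d) = Function.update (M.override X x w) n d := by
  ext k
  by_cases hk : k = n
  · subst hk
    simp [override_of_notMem x _ hn]
  · rw [Function.update_of_ne hk]
    by_cases hkX : k ∈ nodes U X
    · exact override_of_mem x _ _ hkX
    · rw [override_of_notMem x _ hkX, override_of_notMem x _ hkX, Function.update_of_ne hk]

/-- Under the intervention the nodes of `X` carry point masses and the others read the constants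
`x`, so no edge into or out of `X` remains. -/
theorem isKernelFamily_kernelDo (X : Finset (Vo ⊕ Vm)) (x : M.Val X) :
    IsKernelFamily (fun a b => G.edge a b ∧ a ∉ nodes U X ∧ b ∉ nodes U X) (M.kernelDo X x) := by
  constructor
  · intro n w w' h
    unfold kernelDo
    have h1 : w n = w' n := h n (Set.mem_insert _ _)
    by_cases hn : n ∈ nodes U X
    · simp only [if_pos hn]
      rw [override_of_mem x w w' hn, h1]
    · simp only [if_neg hn]
      refine kernel_dependsOn n fun p hp => override_congr x fun hpX => h p ?_
      rcases hp with rfl | hp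
      · exact Set.mem_insert _ _
      · exact Set.mem_insert_of_mem _ ⟨hp, hpX, hn⟩
  · intro n w
    unfold kernelDo
    by_cases hn : n ∈ nodes U X
    · simp only [if_pos hn]
      rw [Finset.sum_congr rfl fun d _ => by
        rw [Function.update_self, override_of_mem x _ w hn]]
      rw [Fintype.sum_eq_single (M.override X x w n) fun d hd => if_neg hd, if_pos rfl]
    · simp only [if_neg hn]
      simp_rw [override_update x w hn]
      exact kernel_sum_update n (fun h => G.acyclic n (.single h)) _

/-- A node of `freeAncestors` ignores its parents in `X`, and these are the deleted edges. -/
theorem isKernelFamily_kernelCut (X Y : Finset (Vo ⊕ Vm)) (x : M.Val X) :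
    IsKernelFamily (cutCausal G.edge (nodes U X) (nodes U Y)) (M.kernelCut X Y x) := by
  constructor
  · intro n w w' h
    unfold kernelCut
    split_ifs with hn
    · refine kernel_dependsOn n fun p hp => override_congr x fun hpX => h p ?_
      rcases hp with rfl | hp
      · exact Set.mem_insert _ _
      · exact Set.mem_insert_of_mem _ (cutCausal_of_notMem hp hpX)
    · refine kernel_dependsOn n fun p hp => h p ?_
      rcases hp with rfl | hp
      · exact Set.mem_insert _ _
      · exact Set.mem_insert_of_mem _ ⟨hp, fun h => hn h.2⟩
  · intro n w
    have hnn : ¬ G.edge n n := fun h => G.acyclic n (.single h)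
    unfold kernelCut
    split_ifs with hn
    · simp_rw [override_update x w hn.1]
      exact kernel_sum_update n hnn _
    · exact kernel_sum_update n hnn _

variable [Fintype Vo] [Fintype Vm] [Fintype U]

/-- This is independence of the noise: expanding the product of sums over single noises gives the
sum over joint noise values. -/
theorem joint_eq_prod (w : M.World) : M.joint w = ∏ n, M.kernel n w := by
  classical
  unfold joint kernel noiseJoint
  rw [Finset.prod_univ_sum, Fintype.piFinset_univ]
  refine Finset.sum_congr rfl fun e _ => ?_
  simp only [Set.indicator_apply, Set.mem_ofPred_eq]
  rw [Finset.prod_ite_zero]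
  simp only [Finset.mem_univ, true_imp_iff]
  rfl

theorem jointDo_eq_prod (X : Finset (Vo ⊕ Vm)) (x : M.Val X) (w : M.World) :
    M.jointDo X x w = ∏ n, M.kernelDo X x n w := by
  classical
  by_cases hw : w ∈ M.event X x
  · have hov := (override_eq_iff x w).2 hw
    have hk : ∀ n, M.kernelDo X x n w = ∑ e,
        if (n ∉ nodes U X → w n = M.func n (fun p => w p.1) e) then M.noiseProb n e else 0 := by
      intro n
      unfold kernelDo kernel
      rw [hov]
      by_cases h : n ∈ nodes U X
      · rw [if_pos h, if_pos rfl, ← M.noiseProb_sum n]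
        exact Finset.sum_congr rfl fun e _ => (if_pos fun h' => (h' h).elim).symm
      · rw [if_neg h]
        refine Finset.sum_congr rfl fun e _ => ?_
        simp only [Set.indicator_apply, Set.mem_ofPred_eq, h, not_false_eq_true, true_imp_iff]
    simp_rw [hk]
    unfold jointDo noiseJoint
    rw [Finset.prod_univ_sum, Fintype.piFinset_univ]
    refine Finset.sum_congr rfl fun e _ => ?_
    simp only [Set.indicator_apply, Set.mem_ofPred_eq]
    rw [Finset.prod_ite_zero]
    have hX : ∀ n : MNode Vo Vm U, (∀ v ∈ X, n ≠ .obs v) ↔ n ∉ nodes U X :=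
      fun n => ⟨fun h ⟨v, hv, hn⟩ => h v hv hn, fun h v hv hn => h ⟨v, hv, hn⟩⟩
    simp only [hw, hX, true_and, Finset.mem_univ, true_imp_iff]
    rfl
  -- Off the event `X = x` one of the point masses vanishes.
  · have : ∃ n ∈ nodes U X, w n ≠ M.override X x w n := by
      by_contra! h
      refine hw ((override_eq_iff x w).1 ?_)
      ext n
      by_cases hn : n ∈ nodes U X
      · exact (h n hn).symm
      · exact override_of_notMem x w hn
    obtain ⟨n, hn, hne⟩ := this
    rw [Finset.prod_eq_zero (Finset.mem_univ n) (by simp [kernelDo, hn, hne])]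
    simp [jointDo, hw]

end MGraph.SCM

/-! ### Without links, each family lies on one side of the conditioning set. -/

namespace CausalGraph

open Relation

variable {N : Type*} {E : N → N → Prop} {X Y Z C Q : Set N}

/-- The sources that are linked to `X`. -/
def linkedSources (E : N → N → Prop) (X Y Q : Set N) : Set N :=
  {t | t ∉ Q ∧ ∃ s, IsStart E X Y Q s ∧ ReflTransGen (Coupled E X Y Q) s t}

theorem IsStart.mem_linkedSources {s : N} (h : IsStart E X Y Q s) :
    s ∈ linkedSources E X Y Q := ⟨h.1, s, h, .refl⟩

theorem Coupled.mem_linkedSources {s t : N} (h : Coupled E X Y Q s t)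
    (hs : s ∈ linkedSources E X Y Q) : t ∈ linkedSources E X Y Q :=
  ⟨h.1, hs.2.imp fun _ h' => ⟨h'.1, h'.2.tail h⟩⟩

theorem IsEnd.notMem_linkedSources {t : N} (h : IsEnd E X Y Q t) (hL : ¬ Linked E X Y Q) :
    t ∉ linkedSources E X Y Q :=
  fun ⟨_, s, hs, hst⟩ => hL ⟨s, t, hs, h, hst⟩

/-- The ancestors of `T`. -/
def ancestors (E : N → N → Prop) (T : Set N) : Set N := {n | ∃ d ∈ T, Desc E n d}

theorem isAncestral_ancestors {E' : N → N → Prop} (h : ∀ a b, E' a b → E a b) (T : Set N) :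
    IsAncestral E' (ancestors E T) :=
  fun _ _ hab ⟨d, hd, hbd⟩ => ⟨d, hd, .head (h _ _ hab) hbd⟩

theorem subset_ancestors (T : Set N) : T ⊆ ancestors E T := fun n hn => ⟨n, hn, .refl⟩

/-- A parent outside `X` of a free ancestor is again one, and the edges from `X` have been cut. -/
theorem isAncestral_freeAncestors : IsAncestral (cutCausal E X Y) (freeAncestors E X Y) := by
  intro a b hab hb
  have ha : a ∉ X := fun h => hab.2 ⟨h, hb⟩
  obtain ⟨y, hy, hby⟩ := hb.2
  exact ⟨ha, y, hy, .head ⟨hab.1, hb.1⟩ hby⟩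

/-- Every family of `cutCausal E X Y` lies on one side of `Q`. -/
theorem family_subset_or (hXY : Disjoint X Y) (hQX : Disjoint Q X)
    (hL : ¬ Linked E X Y Q) {n : N} (hn : n ∈ ancestors E (X ∪ Y ∪ Q)) :
    insert n {p | cutCausal E X Y p n} ⊆ linkedSources E X Y Q ∪ Q ∨
      insert n {p | cutCausal E X Y p n} ⊆ (linkedSources E X Y Q)ᶜ ∪ Q := by
  by_cases hfam : ∃ m ∈ insert n {p | cutCausal E X Y p n}, m ∈ linkedSources E X Y Q
  swap
  · push Not at hfam
    exact .inr fun m hm => .inl (hfam m hm)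
  left
  -- One member `m₀` linked to `X` pulls in every member outside `Q`, since what enters `n` stays at
  -- `n` in `X` or `Q`, or flows on to some `e`. In `X`, the members are starts; in `Q`, they are
  -- coupled with `m₀`. In `Y`, `m₀` would be an end and close a link, unless `m₀ ∈ X`, but then its
  -- edge into `n` was cut.
  obtain ⟨m₀, hm₀, hm₀L⟩ := hfam
  have hXstart : ∀ x ∈ X, IsStart E X Y Q x := fun x hx =>
    ⟨Set.disjoint_right.1 hQX hx, x, hx, .refl⟩
  intro m hm
  by_cases hmQ : m ∈ Q
  · exact .inr hmQ
  left
  by_cases hnX : n ∈ X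
  · rcases hm with rfl | hm
    · exact (hXstart _ hnX).mem_linkedSources
    · exact IsStart.mem_linkedSources ⟨hmQ, n, hnX, .single hm hmQ⟩
  by_cases hnQ : n ∈ Q
  · have hm : cutCausal E X Y m n := hm.resolve_left fun e => hmQ (e ▸ hnQ)
    have hm₀ : cutCausal E X Y m₀ n := hm₀.resolve_left fun e => hm₀L.1 (e ▸ hnQ)
    exact Coupled.mem_linkedSources ⟨hmQ, n, hnQ, .single hm₀ hm₀L.1, .single hm hmQ⟩ hm₀L
  obtain ⟨d, hd, hnd⟩ := hn
  obtain ⟨e, he, hne⟩ : ∃ e ∈ X ∪ Y ∪ Q, Flow E X Y Q n e := by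
    obtain ⟨e, he, hne⟩ := flow_of_desc (Y := Y) (Q := X ∪ Y ∪ Q) hnX hd hnd
    refine ⟨e, he.elim id fun h => .inl (.inl h), ?_⟩
    exact ReflTransGen.mono (fun a b h => ⟨h.1, fun h' => h.2.1 (.inr h'), h.2.2⟩) _ _ hne
  have hflow : ∀ m ∈ insert n {p | cutCausal E X Y p n}, m ∉ Q → Flow E X Y Q m e := by
    rintro m (rfl | hm) hmQ
    · exact hne
    · exact hne.head hm hmQ hnX
  rcases he with (he | he) | he
  · exact IsStart.mem_linkedSources ⟨hmQ, e, he, hflow m hm hmQ⟩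
  · by_cases hm₀X : m₀ ∈ X
    · rcases hm₀ with rfl | hm₀
      · exact (hnX hm₀X).elim
      · exact (hm₀.2 ⟨hm₀X, hnX, e, he,
          hne.desc_deleteIn hnX (Set.disjoint_right.1 hXY he)⟩).elim
    · exact (IsEnd.notMem_linkedSources ⟨hm₀L.1, hm₀X, e, he, hflow m₀ hm₀ hm₀L.1⟩ hL hm₀L).elim
  · exact Coupled.mem_linkedSources
      ⟨hmQ, e, he, hflow m₀ hm₀ hm₀L.1, hflow m hm hmQ⟩ hm₀L

end CausalGraph

/-! ### Sufficiency of the criterion. -/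

namespace MGraph.SCM

open CausalGraph Relation

section Events

variable {Vo Vm U : Type*} {G : MGraph Vo Vm U} {M : G.SCM}

theorem dependsOn_indicator {A : Set M.World} {T : Set (MNode Vo Vm U)}
    (h : ∀ w w', (∀ n ∈ T, w n = w' n) → w ∈ A → w' ∈ A) :
    DependsOn (A.indicator fun _ => (1 : ℝ)) T := by
  classical
  intro w w' hw
  have : w ∈ A ↔ w' ∈ A := ⟨h w w' hw, h w' w fun n hn => (hw n hn).symm⟩
  simp only [Set.indicator_apply, this]

theorem mem_event_congr {A : Finset (Vo ⊕ Vm)} {a : M.Val A} {T : Set (MNode Vo Vm U)}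
    (hT : nodes U A ⊆ T) (w w' : M.World) (h : ∀ n ∈ T, w n = w' n) (hw : w ∈ M.event A a) :
    w' ∈ M.event A a :=
  fun v => (h (.obs v) (hT ⟨v, v.2, rfl⟩)).symm.trans (hw v)

theorem mem_completeCase_congr {W : Set Vm} {T : Set (MNode Vo Vm U)}
    (hT : indicators U W ⊆ T) (w w' : M.World) (h : ∀ n ∈ T, w n = w' n)
    (hw : w ∈ M.completeCase W) : w' ∈ M.completeCase W :=
  ⟨fun m hm => (h (.miss m) (hT (.inl ⟨m, hm, rfl⟩))).symm.trans (hw.1 m hm),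
    (h .sel (hT (.inr rfl))).symm.trans hw.2⟩

theorem mem_inter_congr {A B : Set M.World} {w w' : M.World} (hA : w ∈ A → w' ∈ A)
    (hB : w ∈ B → w' ∈ B) (h : w ∈ A ∩ B) : w' ∈ A ∩ B := ⟨hA h.1, hB h.2⟩

theorem disjoint_nodes {A B : Finset (Vo ⊕ Vm)} (h : Disjoint A B) :
    Disjoint (nodes U A) (nodes U B) := by
  rw [Set.disjoint_left]
  rintro _ ⟨v, hv, rfl⟩ ⟨v', hv', h'⟩
  cases h'
  exact Finset.disjoint_left.1 h hv hv'

theorem disjoint_indicators (A : Finset (Vo ⊕ Vm)) (W : Set Vm) :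
    Disjoint (indicators (Vo := Vo) U W) (nodes U A) := by
  rw [Set.disjoint_left]
  rintro _ (⟨m, hm, rfl⟩ | rfl) ⟨v', hv', h'⟩ <;> cases h'

theorem cutCausal_acyclic (G : MGraph Vo Vm U) (X Y : Set (MNode Vo Vm U)) (n) :
    ¬ TransGen (cutCausal G.edge X Y) n n :=
  CausalGraph.cutCausal_acyclic G.acyclic n

end Events

variable {Vo Vm U : Type*} {G : MGraph Vo Vm U}
variable [Fintype Vo] [Fintype Vm] [Fintype U] [DecidableEq Vo] [DecidableEq Vm] [DecidableEq U]

/-- Probabilities after deletion of the first edges of the causal paths from `X` to `Y`. -/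
noncomputable def probCut (M : G.SCM) (X Y : Finset (Vo ⊕ Vm)) (x : M.Val X)
    (A : Set M.World) : ℝ :=
  ∑ w, A.indicator (fun _ => (1 : ℝ)) w * ∏ n, M.kernelCut X Y x n w

variable {M : G.SCM} {X Y Z : Finset (Vo ⊕ Vm)} {W : Set Vm}

theorem prob_eq_sum (A : Set M.World) :
    M.prob A = ∑ w, A.indicator (fun _ => (1 : ℝ)) w * ∏ n, M.kernel n w := by
  classical
  unfold prob
  refine Finset.sum_congr rfl fun w _ => ?_
  by_cases h : w ∈ A <;> simp [h, joint_eq_prod]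

theorem probDo_eq_sum (x : M.Val X) (A : Set M.World) :
    M.probDo X x A = ∑ w, A.indicator (fun _ => (1 : ℝ)) w * ∏ n, M.kernelDo X x n w := by
  classical
  unfold probDo
  refine Finset.sum_congr rfl fun w _ => ?_
  by_cases h : w ∈ A <;> simp [h, jointDo_eq_prod]

theorem prob_nonneg (A : Set M.World) : 0 ≤ M.prob A := by
  rw [prob_eq_sum]
  exact Finset.sum_nonneg fun w _ => mul_nonneg (Set.indicator_nonneg (by simp) _)
    (Finset.prod_nonneg fun n _ => kernel_nonneg n w)

theorem probCut_nonneg (x : M.Val X) (A : Set M.World) : 0 ≤ M.probCut X Y x A :=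
  Finset.sum_nonneg fun w _ => mul_nonneg (Set.indicator_nonneg (by simp) _)
    (Finset.prod_nonneg fun n _ => kernelCut_nonneg x n w)

theorem probCut_mono (x : M.Val X) {A B : Set M.World} (h : A ⊆ B) :
    M.probCut X Y x A ≤ M.probCut X Y x B :=
  Finset.sum_le_sum fun w _ => mul_le_mul_of_nonneg_right
    (Set.indicator_le_indicator_of_subset h (fun _ => zero_le_one) _)
    (Finset.prod_nonneg fun n _ => kernelCut_nonneg x n w)

/-- On `freeAncestors`, which contains `Y` and is ancestral in both graphs, the two laws have the
same kernels. -/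
theorem probDo_eq_probCut (hXY : Disjoint X Y) (x : M.Val X) (y : M.Val Y) :
    M.probDo X x (M.event Y y) = M.probCut X Y x (M.event Y y) := by
  rw [probDo_eq_sum, probCut]
  have hY : nodes U Y ⊆ freeAncestors G.edge (nodes U X) (nodes U Y) := fun n hn =>
    ⟨Set.disjoint_right.1 (disjoint_nodes hXY) hn, n, hn, .refl⟩
  refine (isKernelFamily_kernelDo X x).sum_congr (acyclic_mono G.acyclic fun _ _ h => h.1)
    (isKernelFamily_kernelCut X Y x) (cutCausal_acyclic G _ _)
    (T := freeAncestors G.edge (nodes U X) (nodes U Y)) ?_ isAncestral_freeAncestors ?_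
    (dependsOn_indicator (mem_event_congr hY))
  · rintro a b ⟨hab, haX, -⟩ hb
    exact isAncestral_freeAncestors a b (cutCausal_of_notMem hab haX) hb
  · intro n hn w
    rw [kernelDo, if_neg hn.1, kernelCut, if_pos hn]

/-- Where `X = x` already holds, overriding changes nothing. -/
theorem probCut_eq_prob_of_subset (x : M.Val X) {A : Set M.World} (hA : A ⊆ M.event X x) :
    M.probCut X Y x A = M.prob A := by
  classical
  rw [prob_eq_sum, probCut]
  refine Finset.sum_congr rfl fun w _ => ?_
  by_cases hw : w ∈ A
  · congr 1
    refine Finset.prod_congr rfl fun n _ => ?_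
    rw [kernelCut, (override_eq_iff x w).2 (hA hw), ite_self]
  · simp [hw]

/-- By `not_desc_of_mem`, an ancestor of `Z ∪ C` that lies in `freeAncestors` has no parent in `X`,
so its kernel is unchanged. -/
theorem probCut_eq_prob_of_dependsOn (hXZ : Disjoint X Z)
    (h : SourceCriterion G.edge (nodes U X) (nodes U Y) (nodes U Z) (indicators U W))
    (x : M.Val X) {A : Set M.World}
    (hA : DependsOn (A.indicator fun _ => (1 : ℝ)) (nodes U Z ∪ indicators U W)) :
    M.probCut X Y x A = M.prob A := by
  rw [prob_eq_sum, probCut]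
  refine (isKernelFamily_kernelCut X Y x).sum_congr (cutCausal_acyclic G _ _)
    isKernelFamily_kernel G.acyclic (T := ancestors G.edge (nodes U Z ∪ indicators U W))
    (isAncestral_ancestors (fun _ _ h => h.1) _) (isAncestral_ancestors (fun _ _ h => h) _) ?_
    (hA.mono (subset_ancestors _))
  rintro n ⟨d, hd, hnd⟩ w
  unfold kernelCut
  split_ifs with hn
  · refine kernel_dependsOn n fun p hp => override_of_notMem x w ?_
    rcases hp with rfl | hp
    · exact hn.1
    · intro hpX
      exact h.not_desc_of_mem (disjoint_nodes hXZ.symm) hpX hp hn (.inr hd) hnd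
  · rfl

/-- Conditional independence of `X` and `Y` given `Q`, cleared of denominators: `linkedSources`
contains `X` and its complement contains `Y`. -/
theorem probCut_mul_of_sourceCriterion (hXY : Disjoint X Y) (hXZ : Disjoint X Z)
    (hYZ : Disjoint Y Z)
    (h : SourceCriterion G.edge (nodes U X) (nodes U Y) (nodes U Z) (indicators U W))
    (x : M.Val X) (y : M.Val Y) (z : M.Val Z) :
    M.probCut X Y x (M.event X x ∩ M.event Y y ∩ (M.event Z z ∩ M.completeCase W)) *
        M.probCut X Y x (M.event Z z ∩ M.completeCase W) =
      M.probCut X Y x (M.event X x ∩ (M.event Z z ∩ M.completeCase W)) *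
        M.probCut X Y x (M.event Y y ∩ (M.event Z z ∩ M.completeCase W)) := by
  classical
  set Q := nodes U Z ∪ indicators U W with hQ
  have hQX : Disjoint Q (nodes U X) :=
    Set.disjoint_union_left.2 ⟨disjoint_nodes hXZ.symm, disjoint_indicators _ _⟩
  have hQY : Disjoint Q (nodes U Y) :=
    Set.disjoint_union_left.2 ⟨disjoint_nodes hYZ.symm, disjoint_indicators _ _⟩
  have hind : ∀ (A B : Set M.World) (w : M.World), (A ∩ B).indicator (fun _ => (1 : ℝ)) w =
      A.indicator (fun _ => 1) w * B.indicator (fun _ => 1) w := by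
    intro A B w
    by_cases hA : w ∈ A <;> by_cases hB : w ∈ B <;> simp [hA, hB]
  have hqdep : ∀ {T}, Q ⊆ T → ∀ w w' : M.World, (∀ n ∈ T, w n = w' n) →
      w ∈ M.event Z z ∩ M.completeCase W → w' ∈ M.event Z z ∩ M.completeCase W :=
    fun hT w w' hw => mem_inter_congr
      (mem_event_congr (Set.subset_union_left.trans hT) w w' hw)
      (mem_completeCase_congr (Set.subset_union_right.trans hT) w w' hw)
  have key := (isKernelFamily_kernelCut X Y x).sum_mul_sum (cutCausal_acyclic G _ _)
    (T := ancestors G.edge (nodes U X ∪ nodes U Y ∪ Q))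
    (M := linkedSources G.edge (nodes U X) (nodes U Y) Q) (Q := Q)
    (isAncestral_ancestors (fun _ _ h => h.1) _)
    (fun n hn => family_subset_or (disjoint_nodes hXY) hQX h.not_linked hn)
    (a := (M.event X x).indicator fun _ => 1) (b := (M.event Y y).indicator fun _ => 1)
    (q := (M.event Z z ∩ M.completeCase W).indicator fun _ => 1)
    (dependsOn_indicator (mem_event_congr fun n hn => .inl (IsStart.mem_linkedSources
      ⟨Set.disjoint_right.1 hQX hn, n, hn, .refl⟩)))
    (dependsOn_indicator (mem_event_congr fun n hn => .inl (IsEnd.notMem_linkedSources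
      ⟨Set.disjoint_right.1 hQY hn, Set.disjoint_right.1 (disjoint_nodes hXY) hn, n, hn, .refl⟩
      h.not_linked)))
    (dependsOn_indicator (hqdep subset_rfl)) ?_
    (dependsOn_indicator (mem_event_congr ((Set.subset_union_left.trans
      Set.subset_union_left).trans (subset_ancestors _))))
    (dependsOn_indicator (mem_event_congr ((Set.subset_union_right.trans
      Set.subset_union_left).trans (subset_ancestors _))))
    (dependsOn_indicator (hqdep (Set.subset_union_right.trans (subset_ancestors _))))
  · simp only [probCut, hind] at key ⊢
    exact key
  · intro w w' hw hw' n hn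
    have hw := Set.mem_of_indicator_ne_zero hw
    have hw' := Set.mem_of_indicator_ne_zero hw'
    rcases hn with ⟨v, hv, rfl⟩ | ⟨m, hm, rfl⟩ | rfl
    · exact (hw.1 ⟨v, hv⟩).trans (hw'.1 ⟨v, hv⟩).symm
    · exact (hw.2.1 m hm).trans (hw'.2.1 m hm).symm
    · exact hw.2.2.trans hw'.2.2.symm

/-- By `not_anc`, `freeAncestors` and the ancestors of the indicators are disjoint ancestral sets of
the cut graph. Nothing needs to be conditioned on. -/
theorem probCut_inter_completeCase (hXY : Disjoint X Y)
    (h : SourceCriterion G.edge (nodes U X) (nodes U Y) (nodes U Z) (indicators U W))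
    (x : M.Val X) (y : M.Val Y) :
    M.probCut X Y x (M.event Y y ∩ M.completeCase W) =
      M.probCut X Y x (M.event Y y) * M.probCut X Y x (M.completeCase W) := by
  classical
  set B := freeAncestors G.edge (nodes U X) (nodes U Y)
  have hY : nodes U Y ⊆ B := fun n hn =>
    ⟨Set.disjoint_right.1 (disjoint_nodes hXY) hn, n, hn, .refl⟩
  have hanc : ancestors G.edge (indicators U W) ⊆ Bᶜ := fun n ⟨c, hc, hnc⟩ hn =>
    h.not_anc n hn c hc hnc
  have hA : IsAncestral (cutCausal G.edge (nodes U X) (nodes U Y))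
      (ancestors G.edge (indicators U W)) := isAncestral_ancestors (fun _ _ h => h.1) _
  have key := (isKernelFamily_kernelCut X Y x).sum_mul_sum (cutCausal_acyclic G _ _)
    (T := B ∪ ancestors G.edge (indicators U W)) (M := B) (Q := ∅)
    (fun a b hab hb => hb.imp (isAncestral_freeAncestors a b hab) (hA a b hab))
    (by
      rintro n (hn | hn)
      · left
        rintro m (rfl | hm)
        · exact .inl hn
        · exact .inl (isAncestral_freeAncestors _ _ hm hn)
      · right
        rintro m (rfl | hm)
        · exact .inl (hanc hn)
        · exact .inl (hanc (hA _ _ hm hn)))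
    (a := (M.event Y y).indicator fun _ => 1) (b := (M.completeCase W).indicator fun _ => 1)
    (q := fun _ => 1)
    (dependsOn_indicator (mem_event_congr (hY.trans Set.subset_union_left)))
    (dependsOn_indicator (mem_completeCase_congr
      (((subset_ancestors _).trans hanc).trans Set.subset_union_left)))
    (fun _ _ _ => rfl) (by simp)
    (dependsOn_indicator (mem_event_congr (hY.trans Set.subset_union_left)))
    (dependsOn_indicator (mem_completeCase_congr
      ((subset_ancestors _).trans Set.subset_union_right)))
    (fun _ _ _ => rfl)
  have hind : ∀ (A B : Set M.World) (w : M.World), (A ∩ B).indicator (fun _ => (1 : ℝ)) w =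
      A.indicator (fun _ => 1) w * B.indicator (fun _ => 1) w := by
    intro A B w
    by_cases hA : w ∈ A <;> by_cases hB : w ∈ B <;> simp [hA, hB]
  have h1 := (isKernelFamily_kernelCut X Y x).sum_prod_eq_one (cutCausal_acyclic G _ _)
  simp only [mul_one, one_mul] at key
  rw [h1, mul_one] at key
  simp only [probCut, hind]
  exact key

theorem probCut_eq_sum_event (x : M.Val X) (A : Set M.World) :
    M.probCut X Y x A = ∑ z : M.Val Z, M.probCut X Y x (M.event Z z ∩ A) := by
  classical
  unfold probCut
  rw [Finset.sum_comm]
  refine Finset.sum_congr rfl fun w _ => ?_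
  rw [← Finset.sum_mul]
  congr 1
  refine Eq.symm ((Fintype.sum_eq_single (fun v : Z => w (.obs v)) ?_).trans ?_)
  swap
  · have : w ∈ M.event Z (fun v : Z => w (.obs v)) := fun v => rfl
    by_cases hA : w ∈ A <;> simp [hA, this]
  · intro z hz
    refine Set.indicator_of_notMem (fun hw => hz ?_) _
    funext v
    exact (hw.1 v).symm

/-- Soundness of the criterion. -/
theorem probDo_eq_of_sourceCriterion (hXY : Disjoint X Y) (hXZ : Disjoint X Z)
    (hYZ : Disjoint Y Z)
    (h : SourceCriterion G.edge (nodes U X) (nodes U Y) (nodes U Z) (indicators U W))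
    (x : M.Val X) (y : M.Val Y) (hdef : M.FormulaDefined X Z W x) :
    M.probDo X x (M.event Y y) =
      ∑ z : M.Val Z, M.condProb (M.event Y y) (M.event X x ∩ M.event Z z ∩ M.completeCase W) *
        M.condProb (M.event Z z) (M.completeCase W) := by
  have hC : M.probCut X Y x (M.completeCase W) = M.prob (M.completeCase W) :=
    probCut_eq_prob_of_dependsOn hXZ h x
      (dependsOn_indicator (mem_completeCase_congr Set.subset_union_right))
  have hZC : ∀ z, M.probCut X Y x (M.event Z z ∩ M.completeCase W) =
      M.prob (M.event Z z ∩ M.completeCase W) := fun z =>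
    probCut_eq_prob_of_dependsOn hXZ h x (dependsOn_indicator fun w w' hw => mem_inter_congr
      (mem_event_congr Set.subset_union_left w w' hw)
      (mem_completeCase_congr Set.subset_union_right w w' hw))
  have hpos := hdef.1
  have hmain : M.probCut X Y x (M.event Y y) * M.prob (M.completeCase W) =
      ∑ z : M.Val Z, M.probCut X Y x (M.event Y y ∩ (M.event Z z ∩ M.completeCase W)) := by
    rw [← hC, ← probCut_inter_completeCase hXY h, probCut_eq_sum_event (Z := Z)]
    refine Finset.sum_congr rfl fun z _ => congrArg _ ?_
    ext w
    simp only [Set.mem_inter_iff]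
    tauto
  rw [probDo_eq_probCut hXY, eq_div_of_mul_eq hpos.ne' hmain, Finset.sum_div]
  refine Finset.sum_congr rfl fun z _ => ?_
  unfold condProb
  rw [mul_div_assoc']
  congr 1
  -- A value `z` of probability zero among the complete cases contributes zero on both sides,
  -- whatever the quotient by zero means.
  rcases (prob_nonneg (M.event Z z ∩ M.completeCase W)).eq_or_lt with h0 | hlt
  · rw [← h0, mul_zero]
    refine le_antisymm ?_ (probCut_nonneg _ _)
    refine (probCut_mono x Set.inter_subset_right).trans ?_
    rw [hZC, ← h0]
  · have hlt' := hdef.2 z hlt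
    have key := probCut_mul_of_sourceCriterion hXY hXZ hYZ h x y z
    rw [probCut_eq_prob_of_subset x (Set.inter_subset_left.trans Set.inter_subset_left),
      probCut_eq_prob_of_subset x Set.inter_subset_left, hZC] at key
    have e1 : M.event X x ∩ M.event Y y ∩ (M.event Z z ∩ M.completeCase W) =
        M.event Y y ∩ (M.event X x ∩ M.event Z z ∩ M.completeCase W) := by
      ext w
      simp only [Set.mem_inter_iff]
      tauto
    rw [e1, ← Set.inter_assoc (M.event X x)] at key
    field_simp
    linarith

end MGraph.SCM

/-! ### Refuting the adjustment formula by models with rare noise. -/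

namespace MGraph

open CausalGraph Relation

variable {Vo Vm U : Type*} {G : MGraph Vo Vm U}
variable [Fintype Vo] [Fintype Vm] [Fintype U]

theorem wellFounded_edge (G : MGraph Vo Vm U) : WellFounded G.edge := by
  have : IsTrans _ (TransGen G.edge) := ⟨fun _ _ _ => TransGen.trans⟩
  have : Std.Irrefl (TransGen G.edge) := ⟨G.acyclic⟩
  have : Finite (MNode Vo Vm U) := by
    classical exact Finite.of_fintype _
  exact Subrelation.wf TransGen.single
    (Finite.wellFounded_of_trans_of_irrefl (TransGen G.edge))

namespace SCM

/-- Outside `S`, the equations compute each value from those of the parents; induct along the edges.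
-/
theorem eq_of_equation {M : G.SCM} {S : Set (MNode Vo Vm U)} {e : ∀ n, M.Noise n}
    {w w' : M.World} (hS : ∀ n ∈ S, w n = w' n) (hw : ∀ n ∉ S, M.Equation e w n)
    (hw' : ∀ n ∉ S, M.Equation e w' n) : w = w' := by
  funext n
  induction n using G.wellFounded_edge.induction with
  | _ n ih =>
    by_cases hn : n ∈ S
    · exact hS n hn
    · rw [hw n hn, hw' n hn]
      exact congrArg (fun g => M.func n g (e n)) (funext fun p => ih p.1 p.2)

variable {M : G.SCM}

theorem noiseJoint_nonneg (e : ∀ n, M.Noise n) : 0 ≤ M.noiseJoint e :=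
  Finset.prod_nonneg fun n _ => M.noiseProb_nonneg n _

variable [DecidableEq Vo] [DecidableEq Vm] [DecidableEq U]

theorem sum_noiseJoint (M : G.SCM) : ∑ e, M.noiseJoint e = 1 := by
  unfold noiseJoint
  rw [← Fintype.piFinset_univ, ← Finset.prod_univ_sum]
  simp [M.noiseProb_sum]

/-- Probabilities as weights of noise values, given the solutions of the structural equations. -/
theorem prob_eq_sum_noise (sol : (∀ n, M.Noise n) → M.World)
    (hsol : ∀ e n, M.Equation e (sol e) n) (A : Set M.World) :
    M.prob A = ∑ e, {e | sol e ∈ A}.indicator M.noiseJoint e := by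
  classical
  have hiff : ∀ (w : M.World) e, (∀ n, M.Equation e w n) ↔ w = sol e := fun w e =>
    ⟨fun h => eq_of_equation (S := ∅) (by simp) (fun n _ => h n) fun n _ => hsol e n,
      fun h => h ▸ hsol e⟩
  have h1 : ∀ w, A.indicator M.joint w =
      ∑ e, if w = sol e then (if w ∈ A then M.noiseJoint e else 0) else 0 := by
    intro w
    by_cases hA : w ∈ A
    · simp [hA, joint, Set.indicator_apply, hiff]
    · simp [hA]
  unfold prob
  simp_rw [h1]
  rw [Finset.sum_comm]
  refine Finset.sum_congr rfl fun e _ => ?_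
  rw [Fintype.sum_eq_single (sol e) fun w hw => if_neg hw]
  simp [Set.indicator_apply]

/-- Refutations need only an upper bound, so the intervened equations never have to be solved: each
noise value admits at most one world. -/
theorem probDo_le_sum_noise {X : Finset (Vo ⊕ Vm)} {x : M.Val X} {A : Set M.World}
    {P : Set (∀ n, M.Noise n)}
    (h : ∀ e, ∀ w ∈ M.event X x, (∀ n ∉ nodes U X, M.Equation e w n) → w ∈ A → e ∈ P) :
    M.probDo X x A ≤ ∑ e, P.indicator M.noiseJoint e := by
  classical
  have hX : ∀ n : MNode Vo Vm U, (∀ v ∈ X, n ≠ .obs v) ↔ n ∉ nodes U X :=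
    fun n => ⟨fun h ⟨v, hv, hn⟩ => h v hv hn, fun h v hv hn => h ⟨v, hv, hn⟩⟩
  have h1 : ∀ w, A.indicator (M.jointDo X x) w = ∑ e,
      if w ∈ A ∧ w ∈ M.event X x ∧ ∀ n ∉ nodes U X, M.Equation e w n
      then M.noiseJoint e else 0 := by
    intro w
    by_cases hA : w ∈ A
    · simp only [Set.indicator_of_mem hA, jointDo, Set.indicator_apply, Set.mem_ofPred_eq, hX, hA,
        true_and]
    · simp [hA]
  unfold probDo
  simp_rw [h1]
  rw [Finset.sum_comm]
  refine Finset.sum_le_sum fun e _ => ?_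
  by_cases hex : ∃ w, w ∈ A ∧ w ∈ M.event X x ∧ ∀ n ∉ nodes U X, M.Equation e w n
  · obtain ⟨w, hw⟩ := hex
    rw [Fintype.sum_eq_single w, if_pos hw, Set.indicator_of_mem (h e w hw.2.1 hw.2.2 hw.1)]
    intro w' hne
    refine if_neg fun hw' => hne (eq_of_equation (S := nodes U X) ?_ hw'.2.2 hw.2.2)
    rintro _ ⟨v, hv, rfl⟩
    exact (hw'.2.1 ⟨v, hv⟩).trans (hw.2.1 ⟨v, hv⟩).symm
  · rw [Finset.sum_eq_zero fun w _ => if_neg fun hw => hex ⟨w, hw⟩]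
    exact Set.indicator_nonneg (fun e _ => noiseJoint_nonneg e) e

theorem probDo_nonneg {X : Finset (Vo ⊕ Vm)} (x : M.Val X) (A : Set M.World) :
    0 ≤ M.probDo X x A :=
  Finset.sum_nonneg fun w _ => Set.indicator_nonneg (fun _ _ =>
    Finset.sum_nonneg fun e _ => Set.indicator_nonneg (fun e _ => noiseJoint_nonneg e) e) w

/-- If a value `z` determines `y`, the adjustment formula is at least the probability of `z`. -/
theorem probDo_ne_of_lt {X Y Z : Finset (Vo ⊕ Vm)} {W : Set Vm} {x : M.Val X} {y : M.Val Y}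
    {z : M.Val Z} (hdef : M.FormulaDefined X Z W x)
    (hdet : M.prob (M.event Y y ∩ (M.event X x ∩ M.event Z z ∩ M.completeCase W)) =
      M.prob (M.event X x ∩ M.event Z z ∩ M.completeCase W))
    (hlt : M.probDo X x (M.event Y y) * M.prob (M.completeCase W) <
      M.prob (M.event Z z ∩ M.completeCase W)) :
    M.probDo X x (M.event Y y) ≠
      ∑ z : M.Val Z, M.condProb (M.event Y y) (M.event X x ∩ M.event Z z ∩ M.completeCase W) *
        M.condProb (M.event Z z) (M.completeCase W) := by
  have hC := hdef.1
  have hZ : 0 < M.prob (M.event Z z ∩ M.completeCase W) :=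
    (mul_nonneg (probDo_nonneg _ _) hC.le).trans_lt hlt
  refine ne_of_lt (((lt_div_iff₀ hC).2 hlt).trans_le ?_)
  have hterm : M.prob (M.event Z z ∩ M.completeCase W) / M.prob (M.completeCase W) =
      M.condProb (M.event Y y) (M.event X x ∩ M.event Z z ∩ M.completeCase W) *
        M.condProb (M.event Z z) (M.completeCase W) := by
    rw [condProb, hdet, div_self (hdef.2 z hZ).ne', one_mul, condProb]
  rw [hterm]
  exact Finset.single_le_sum
    (f := fun z => M.condProb (M.event Y y) (M.event X x ∩ M.event Z z ∩ M.completeCase W) *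
        M.condProb (M.event Z z) (M.completeCase W))
    (fun z _ => mul_nonneg (div_nonneg (prob_nonneg _) (prob_nonneg _))
      (div_nonneg (prob_nonneg _) (prob_nonneg _))) (Finset.mem_univ z)

theorem prob_pos_iff {sol : (∀ n, M.Noise n) → M.World} (hsol : ∀ e n, M.Equation e (sol e) n)
    (hM : ∀ e, 0 < M.noiseJoint e) {A : Set M.World} : 0 < M.prob A ↔ ∃ e, sol e ∈ A := by
  classical
  rw [prob_eq_sum_noise sol hsol]
  constructor
  · intro h
    by_contra! hA
    refine h.ne' (Finset.sum_eq_zero fun e _ => Set.indicator_of_notMem ?_ _)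
    exact hA e
  · rintro ⟨e, he⟩
    refine Finset.sum_pos' (fun e _ => Set.indicator_nonneg
      (fun e _ => noiseJoint_nonneg e) e) ⟨e, Finset.mem_univ _, ?_⟩
    rw [Set.indicator_of_mem (show e ∈ {e | sol e ∈ A} from he)]
    exact hM e

/-- How a model with given solutions of its structural equations refutes the adjustment formula. -/
theorem not_isMSAdjustmentSet {X Y Z : Finset (Vo ⊕ Vm)}
    (sol : (∀ n, M.Noise n) → M.World) (hsol : ∀ e n, M.Equation e (sol e) n)
    (hM : ∀ e, 0 < M.noiseJoint e) (x : M.Val X) (y : M.Val Y) (z : M.Val Z)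
    (P : Set (∀ n, M.Noise n)) (e₀ : ∀ n, M.Noise n)
    (hP : ∑ e, P.indicator M.noiseJoint e < M.noiseJoint e₀)
    (hC : ∃ e, sol e ∈ M.completeCase (missingPart X Y Z))
    (hpos : ∀ e, sol e ∈ M.completeCase (missingPart X Y Z) →
      ∃ e', sol e' ∈ M.event X x ∧ sol e' ∈ M.completeCase (missingPart X Y Z) ∧
        ∀ v ∈ Z, sol e' (.obs v) = sol e (.obs v))
    (hdet : ∀ e, sol e ∈ M.event X x → sol e ∈ M.event Z z →
      sol e ∈ M.completeCase (missingPart X Y Z) → sol e ∈ M.event Y y)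
    (hz : (∀ e, sol e ∈ M.completeCase (missingPart X Y Z) → sol e ∈ M.event Z z) ∨
      sol e₀ ∈ M.event Z z ∩ M.completeCase (missingPart X Y Z))
    (hdo : ∀ e, ∀ w ∈ M.event X x, (∀ n ∉ nodes U X, M.Equation e w n) →
      w ∈ M.event Y y → e ∈ P) :
    ¬ G.IsMSAdjustmentSet X Y Z := by
  classical
  intro hadj
  have hdef : M.FormulaDefined X Z (missingPart X Y Z) x := by
    refine ⟨(prob_pos_iff hsol hM).2 hC, fun z hz => ?_⟩
    obtain ⟨e, he⟩ := (prob_pos_iff hsol hM).1 hz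
    obtain ⟨e', h1, h2, h3⟩ := hpos e he.2
    exact (prob_pos_iff hsol hM).2 ⟨e', ⟨h1, fun v => (h3 v v.2).trans (he.1 v)⟩, h2⟩
  have hprob : ∀ A B : Set M.World, (∀ e, sol e ∈ A ↔ sol e ∈ B) → M.prob A = M.prob B := by
    intro A B h
    rw [prob_eq_sum_noise sol hsol, prob_eq_sum_noise sol hsol]
    have : {e | sol e ∈ A} = {e | sol e ∈ B} := Set.ext h
    rw [this]
  have hone : ∀ S : Set (∀ n, M.Noise n), ∑ e, S.indicator M.noiseJoint e ≤ 1 := by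
    intro S
    rw [← sum_noiseJoint M]
    exact Finset.sum_le_sum fun e _ => Set.indicator_le_self' (fun _ _ => noiseJoint_nonneg _) e
  have hsingle : ∀ S : Set (∀ n, M.Noise n), e₀ ∈ S →
      M.noiseJoint e₀ ≤ ∑ e, S.indicator M.noiseJoint e := by
    intro S hS
    rw [← Set.indicator_of_mem hS M.noiseJoint]
    exact Finset.single_le_sum (fun e _ => Set.indicator_nonneg
      (fun e _ => noiseJoint_nonneg e) e) (Finset.mem_univ e₀)
  have hle := probDo_le_sum_noise hdo
  refine probDo_ne_of_lt (z := z) hdef ?_ ?_ (hadj M x y hdef)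
  · exact hprob _ _ fun e => ⟨fun h => h.2, fun h => ⟨hdet e h.1.1 h.1.2 h.2, h⟩⟩
  -- Either complete cases force `z`, and it suffices that P(y | do x) < 1; or the weight of `e₀`
  -- alone makes P(z, C) exceed P(y | do x).
  · rcases hz with hz | hz
    · rw [hprob (M.event Z z ∩ _) (M.completeCase _) fun e =>
        ⟨fun h => h.2, fun h => ⟨hz e h, h⟩⟩]
      refine mul_lt_of_lt_one_left hdef.1 (hle.trans_lt (hP.trans_le ?_))
      exact (hsingle Set.univ trivial).trans (hone _)
    · refine (mul_le_of_le_one_right (probDo_nonneg _ _) ?_).trans_lt (hle.trans_lt (hP.trans_le ?_))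
      · rw [prob_eq_sum_noise sol hsol]
        exact hone _
      · rw [prob_eq_sum_noise sol hsol]
        exact hsingle _ hz

end SCM

section Bernoulli

variable {N : Type*} [Fintype N]

theorem one_div_card_lt_one (N : Type*) [Fintype N] : 1 / (Fintype.card N + 2 : ℝ) < 1 := by
  rw [div_lt_one (by positivity)]
  have : (0 : ℝ) ≤ Fintype.card N := by positivity
  linarith

theorem sum_indicator_bernoulli [DecidableEq N] (ε : ℝ) (t : N) :
    ∑ e : N → Bool, {e : N → Bool | e t = true}.indicator
      (fun e => ∏ n, if e n then ε else 1 - ε) e = ε := by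
  classical
  have h : ∀ e : N → Bool,
      {e : N → Bool | e t = true}.indicator (fun e => ∏ n, if e n then ε else 1 - ε) e =
      ∏ n, if n = t → e n = true then (if e n then ε else 1 - ε) else 0 := by
    intro e
    rw [Finset.prod_ite_zero]
    simp [Set.indicator_apply]
  rw [Finset.sum_congr rfl fun e _ => h e]
  have h2 := (Finset.prod_univ_sum (fun _ : N => (Finset.univ : Finset Bool))
    fun n b => if n = t → b = true then (if b then ε else 1 - ε) else 0).symm
  rw [Fintype.piFinset_univ] at h2
  refine h2.trans ?_
  rw [Finset.prod_eq_single t]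
  · simp
  · intro n _ hn
    simp [hn]
  · simp

/-- With ε = 1/(n+2), Bernoulli's inequality gives (1-ε)^n ≥ 1 - nε = 2ε. -/
theorem one_div_card_lt_pow :
    1 / (Fintype.card N + 2 : ℝ) < (1 - 1 / (Fintype.card N + 2 : ℝ)) ^ Fintype.card N := by
  have h2 := one_div_card_lt_one N
  have h3 := one_add_mul_le_pow (a := -(1 / (Fintype.card N + 2 : ℝ))) (by linarith)
    (Fintype.card N)
  rw [← sub_eq_add_neg] at h3
  refine lt_of_lt_of_le ?_ h3
  have : 1 + (Fintype.card N : ℝ) * -(1 / (Fintype.card N + 2 : ℝ)) =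
      2 * (1 / (Fintype.card N + 2 : ℝ)) := by
    field_simp
    ring
  rw [this]
  have : 0 < 1 / (Fintype.card N + 2 : ℝ) := by positivity
  linarith

end Bernoulli

/-- A model with biased binary noise, in which all variables have the range `V`. -/
noncomputable def biasedModel (G : MGraph Vo Vm U) (V : Type) [Fintype V] [Nonempty V]
    (func : ∀ n, (∀ p : {p // G.edge p n}, p.1.Dom (fun _ => V) (fun _ => V)) → Bool →
      n.Dom (fun _ => V) (fun _ => V)) : G.SCM where
  D _ := V
  L _ := V
  Noise _ := Bool
  noiseProb _ e := if e then 1 / (Fintype.card (MNode Vo Vm U) + 2 : ℝ)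
    else 1 - 1 / (Fintype.card (MNode Vo Vm U) + 2 : ℝ)
  noiseProb_nonneg n e := by
    have := one_div_card_lt_one (MNode Vo Vm U)
    cases e
    · simpa using this.le
    · simp only [if_true]; positivity
  noiseProb_sum n := by simp
  func := func

/-- The worlds of `biasedModel`. -/
abbrev ConstWorld (Vo Vm U : Type*) (V : Type) : Type _ :=
  ∀ n : MNode Vo Vm U, n.Dom (fun _ => V) (fun _ => V)

/-- How a model with biased binary noise refutes the adjustment formula. -/
theorem not_isMSAdjustmentSet_of_func [DecidableEq Vo] [DecidableEq Vm] [DecidableEq U]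
    (V : Type) [Fintype V] [Nonempty V]
    (func : ∀ n, (∀ p : {p // G.edge p n}, p.1.Dom (fun _ => V) (fun _ => V)) → Bool →
      n.Dom (fun _ => V) (fun _ => V))
    {X Y Z : Finset (Vo ⊕ Vm)} (sol : (MNode Vo Vm U → Bool) → ConstWorld Vo Vm U V)
    (hsol : ∀ e n, sol e n = func n (fun p => sol e p.1) (e n))
    (x y z : Vo ⊕ Vm → V) (t : MNode Vo Vm U) (C : Set (ConstWorld Vo Vm U V))
    (hCW : ∀ w, w ∈ C ↔ (∀ m ∈ missingPart X Y Z, w (.miss m) = true) ∧ w .sel = true)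
    (hC : ∃ e, sol e ∈ C)
    (hpos : ∀ e, sol e ∈ C → ∃ e', (∀ v ∈ X, sol e' (.obs v) = x v) ∧ sol e' ∈ C ∧
        ∀ v ∈ Z, sol e' (.obs v) = sol e (.obs v))
    (hdet : ∀ e, (∀ v ∈ X, sol e (.obs v) = x v) → (∀ v ∈ Z, sol e (.obs v) = z v) →
      sol e ∈ C → ∀ v ∈ Y, sol e (.obs v) = y v)
    (hz : (∀ e, sol e ∈ C → ∀ v ∈ Z, sol e (.obs v) = z v) ∨
      (∀ v ∈ Z, sol (fun _ => false) (.obs v) = z v) ∧ sol (fun _ => false) ∈ C)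
    (hdo : ∀ (e : MNode Vo Vm U → Bool) (w : ConstWorld Vo Vm U V), (∀ v ∈ X, w (.obs v) = x v) →
      (∀ n ∉ nodes U X, w n = func n (fun p => w p.1) (e n)) →
      (∀ v ∈ Y, w (.obs v) = y v) → e t = true) :
    ¬ G.IsMSAdjustmentSet X Y Z := by
  obtain rfl : C = (G.biasedModel V func).completeCase (missingPart X Y Z) := Set.ext hCW
  have hε := one_div_card_lt_one (MNode Vo Vm U)
  refine SCM.not_isMSAdjustmentSet (M := G.biasedModel V func) sol hsol ?_
    (fun v => x v) (fun v => y v) (fun v => z v) {e | (e t : Bool) = true} (fun _ => false) ?_ hC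
    ?_ ?_ ?_ ?_
  · intro e
    refine Finset.prod_pos fun n _ => ?_
    change 0 < ite ((show Bool from e n) = true) _ _
    split_ifs
    · positivity
    · linarith
  · refine lt_of_eq_of_lt (sum_indicator_bernoulli _ t) (one_div_card_lt_pow.trans_eq ?_)
    simp [SCM.noiseJoint, biasedModel]
  · intro e he
    obtain ⟨e', h1, h2, h3⟩ := hpos e he
    exact ⟨e', fun v => h1 v v.2, h2, h3⟩
  · exact fun e h1 h2 h3 v => hdet e (fun v hv => h1 ⟨v, hv⟩) (fun v hv => h2 ⟨v, hv⟩) h3 v v.2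
  · exact hz.imp (fun h e he v => h e he v v.2) fun h => ⟨fun v => h.1 v v.2, h.2⟩
  · exact fun e w h1 h2 h3 => hdo e w (fun v hv => h1 ⟨v, hv⟩) h2 fun v hv => h3 ⟨v, hv⟩

end MGraph

/-! ### Two counterexamples with binary variables. -/

namespace MGraph

open CausalGraph Relation

variable {Vo Vm U : Type*} {G : MGraph Vo Vm U}

/-- If all variables are binary then every node is. -/
def domEquivBool : ∀ n : MNode Vo Vm U, n.Dom (fun _ => Bool) (fun _ => Bool) ≃ Bool
  | .obs _ => Equiv.refl Bool
  | .lat _ => Equiv.refl Bool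
  | .miss _ => Equiv.refl Bool
  | .sel => Equiv.refl Bool

theorem not_isIndicator_of_edge {p n : MNode Vo Vm U} (h : G.edge p n) (hn : ¬ n.IsIndicator) :
    ¬ p.IsIndicator := fun hp => hn (G.indicator_edge p n hp h)

variable [Fintype Vo] [Fintype Vm] [Fintype U] [DecidableEq Vo] [DecidableEq Vm] [DecidableEq U]

/-- How a model with binary variables refutes the adjustment formula. -/
theorem not_isMSAdjustmentSet_of_bool
    (F : ∀ n, ({p // G.edge p n} → Bool) → Bool → Bool)
    {X Y Z : Finset (Vo ⊕ Vm)} (s : (MNode Vo Vm U → Bool) → MNode Vo Vm U → Bool)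
    (hs : ∀ e n, s e n = F n (fun p => s e p.1) (e n))
    (x y z : Vo ⊕ Vm → Bool) (t : MNode Vo Vm U)
    (C : Set (MNode Vo Vm U → Bool))
    (hCW : ∀ w, w ∈ C ↔ ∀ c ∈ indicators U (missingPart X Y Z), w c = true)
    (hC : ∃ e, s e ∈ C)
    (hpos : ∀ e, s e ∈ C → ∃ e', (∀ v ∈ X, s e' (.obs v) = x v) ∧ s e' ∈ C ∧
        ∀ v ∈ Z, s e' (.obs v) = s e (.obs v))
    (hdet : ∀ e, (∀ v ∈ X, s e (.obs v) = x v) → (∀ v ∈ Z, s e (.obs v) = z v) →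
      s e ∈ C → ∀ v ∈ Y, s e (.obs v) = y v)
    (hz : (∀ e, s e ∈ C → ∀ v ∈ Z, s e (.obs v) = z v) ∨
      (∀ v ∈ Z, s (fun _ => false) (.obs v) = z v) ∧ s (fun _ => false) ∈ C)
    (hdo : ∀ (e : MNode Vo Vm U → Bool) (w : MNode Vo Vm U → Bool), (∀ v ∈ X, w (.obs v) = x v) →
      (∀ n ∉ nodes U X, w n = F n (fun p => w p.1) (e n)) →
      (∀ v ∈ Y, w (.obs v) = y v) → e t = true) :
    ¬ G.IsMSAdjustmentSet X Y Z := by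
  have key : ∀ w : ConstWorld Vo Vm U Bool, (fun n => domEquivBool n (w n)) ∈ C ↔
      (∀ m ∈ missingPart X Y Z, w (.miss m) = true) ∧ w .sel = true := by
    intro w
    rw [hCW]
    constructor
    · exact fun h => ⟨fun m hm => h (.miss m) (.inl ⟨m, hm, rfl⟩), h .sel (.inr rfl)⟩
    · rintro ⟨h1, h2⟩ _ (⟨m, hm, rfl⟩ | rfl)
      · exact h1 m hm
      · exact h2
  have hsolC : ∀ e, (fun n => domEquivBool n ((domEquivBool n).symm (s e n))) = s e := fun e =>
    funext fun n => Equiv.apply_symm_apply _ _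
  refine not_isMSAdjustmentSet_of_func Bool
    (fun n pa e => (domEquivBool n).symm (F n (fun p => domEquivBool p.1 (pa p)) e))
    (fun e n => (domEquivBool n).symm (s e n)) ?_ x y z t
    {w | (fun n => domEquivBool n (w n)) ∈ C} key ?_ ?_ ?_ ?_ ?_
  · intro e n
    simp only [Equiv.apply_symm_apply]
    rw [hs]
  · simp only [Set.mem_ofPred_eq, hsolC]
    exact hC
  · simp only [Set.mem_ofPred_eq, hsolC]
    exact hpos
  · simp only [Set.mem_ofPred_eq, hsolC]
    exact hdet
  · simp only [Set.mem_ofPred_eq, hsolC]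
    exact hz
  · intro e w h1 h2 h3
    refine hdo e (fun n => domEquivBool n (w n)) h1 (fun n hn => ?_) h3
    have := congrArg (domEquivBool n) (h2 n hn)
    rwa [Equiv.apply_symm_apply] at this

/-- Each node is the conjunction of its parents, and at `t` also of a rare coin, so it is `true`
unless it descends from `t` and the coin fails. A complete case forces the coin, hence makes every
node `true`; under the intervention `y` still needs the rare coin. -/
theorem IsMSAdjustmentSet.not_anc {X Y Z : Finset (Vo ⊕ Vm)} (h : G.IsMSAdjustmentSet X Y Z)
    {t : MNode Vo Vm U} (ht : t ∈ freeAncestors G.edge (nodes U X) (nodes U Y))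
    {c : MNode Vo Vm U} (hc : c ∈ indicators U (missingPart X Y Z)) : ¬ Desc G.edge t c := by
  classical
  intro htc
  obtain ⟨htX, y, hy, hty⟩ := ht
  have hC : ∀ e : MNode Vo Vm U → Bool,
      (∀ c ∈ indicators U (missingPart X Y Z),
        decide (Desc G.edge t c → e t = true) = true) → e t = true := by
    intro e he
    exact of_decide_eq_true (he c hc) htc
  refine not_isMSAdjustmentSet_of_bool
    (fun n pa e => decide ((n = t → e = true) ∧ ∀ p, pa p = true))
    (fun e n => decide (Desc G.edge t n → e t = true)) ?_ (fun _ => true) (fun _ => true)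
    (fun _ => true) t {w | ∀ c ∈ indicators U (missingPart X Y Z), w c = true} (fun _ => Iff.rfl)
    ⟨fun _ => true, by simp⟩ ?_ ?_ ?_ ?_ h
  · intro e n
    simp only [decide_eq_true_eq, decide_eq_decide]
    constructor
    · intro h1
      refine ⟨fun hn => ?_, fun p hp => h1 (hp.tail p.2)⟩
      subst hn
      exact h1 .refl
    · rintro ⟨h1, h2⟩ htn
      rcases ReflTransGen.cases_tail htn with rfl | ⟨p, hp, hpn⟩
      · exact h1 rfl
      · exact h2 ⟨p, hpn⟩ hp
  · exact fun e he => ⟨e, fun v _ => by simp [hC e he], he, fun _ _ => rfl⟩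
  · exact fun e _ _ he v _ => by simp [hC e he]
  · exact .inl fun e he v _ => by simp [hC e he]
  · intro e w _ hw hwY
    obtain ⟨v, hv, rfl⟩ := hy
    have key : ∀ n, Desc (deleteIn G.edge (nodes U X)) t n → w n = true → e t = true := by
      intro n hn
      induction hn with
      | refl =>
        intro hwt
        rw [hw _ htX, decide_eq_true_eq] at hwt
        exact hwt.1 rfl
      | @tail b c _ hbc ih =>
        intro hwc
        rw [hw _ hbc.2, decide_eq_true_eq] at hwc
        exact ih (hwc.2 ⟨b, hbc.1⟩)
    exact key _ hty (hwY v hv)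

/-- `x` is a coin, `m` reports whether its own coin agrees with `x`, and the `X`-free descendants of
`m` pass the report on; indicators are `true` and all else is `false`. Rare coins usually agree, so
`z` and `y` usually report agreement, and `z` reveals `y`. Under `x = true`, agreement needs the
rare coin of `m`. -/
theorem IsMSAdjustmentSet.not_desc {X Y Z : Finset (Vo ⊕ Vm)} (h : G.IsMSAdjustmentSet X Y Z)
    (hXY : Disjoint X Y) (hXZ : Disjoint X Z) {x m : MNode Vo Vm U} (hx : x ∈ nodes U X)
    (hxm : G.edge x m) (hm : m ∈ freeAncestors G.edge (nodes U X) (nodes U Y))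
    {z : MNode Vo Vm U} (hz : z ∈ nodes U Z) :
    ¬ Desc (deleteIn G.edge (nodes U X)) m z := by
  classical
  intro hmz
  obtain ⟨hmX, y, hy, hmy⟩ := hm
  set D : MNode Vo Vm U → Prop := Desc (deleteIn G.edge (nodes U X)) m
  have hDX : ∀ n, D n → n ∉ nodes U X := fun n hn => notMem_of_desc_deleteIn hmX hn
  have hDm : ∀ p, D p → ¬ G.edge p m := fun p hp hpm =>
    G.acyclic p ((TransGen.single hpm).trans_left hp.of_deleteIn)
  have hxm' : x ≠ m := fun e => hmX (e ▸ hx)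
  have hobs : ∀ {A : Finset (Vo ⊕ Vm)} {v}, v ∈ A → (MNode.obs v : MNode Vo Vm U) ∈ nodes U A :=
    fun hv => ⟨_, hv, rfl⟩
  have hsub : ∀ v, ¬ (MNode.obs v : MNode Vo Vm U).IsIndicator := fun v => id
  have hne : ∀ {A : Finset (Vo ⊕ Vm)}, Disjoint X A → ∀ v ∈ A, MNode.obs v ≠ x := fun hA v hv e =>
    Set.disjoint_left.1 (SCM.disjoint_nodes hA) hx (e ▸ hobs hv)
  have hind : ∀ c ∈ indicators (Vo := Vo) U (missingPart X Y Z), c.IsIndicator := by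
    rintro _ (⟨m, -, rfl⟩ | rfl) <;> exact trivial
  refine not_isMSAdjustmentSet_of_bool
    (fun n pa e => decide (n.IsIndicator ∨ (n = x ∧ e = true) ∨
      (n = m ∧ ∀ p, p.1 = x → pa p = e) ∨ (D n ∧ ∃ p, D p.1 ∧ pa p = true)))
    (fun e n => decide (n.IsIndicator ∨ (n = x ∧ e x = true) ∨ (D n ∧ e x = e m))) ?_
    (fun v => decide (.obs v = x)) (fun v => decide (D (.obs v))) (fun v => decide (D (.obs v)))
    m {w | ∀ c ∈ indicators U (missingPart X Y Z), w c = true} (fun _ => Iff.rfl)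
    ⟨fun _ => true, fun c hc => decide_eq_true (.inl (hind c hc))⟩
    ?_ ?_ ?_ ?_ h
  · intro e n
    rw [decide_eq_decide]
    by_cases hn : n.IsIndicator
    · simp [hn]
    simp only [hn, false_or]
    have hpi : ∀ p : {p // G.edge p n}, ¬ p.1.IsIndicator := fun p =>
      not_isIndicator_of_edge p.2 hn
    by_cases hnx : n = x
    · subst hnx
      have : ¬ D n := fun h => hDX n h hx
      simp [this, hxm']
    by_cases hnm : n = m
    · subst hnm
      have hDn : D n := ReflTransGen.refl
      have h1 : ¬ ∃ p : {p // G.edge p n}, D p.1 ∧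
          decide (p.1.IsIndicator ∨ (p.1 = x ∧ e x = true) ∨ (D p.1 ∧ e x = e n)) = true :=
        fun ⟨p, hp, _⟩ => hDm p hp p.2
      simp only [hnx, false_and, false_or, hDn, true_and, h1, or_false]
      constructor
      · rintro he ⟨p, hp⟩ rfl
        have hpD : ¬ D p := fun h => hDX p h hx
        have hpI := hpi ⟨p, hp⟩
        simp only at hpI
        simp only [hpI, hpD, false_or, false_and, or_false, true_and, ← he]
        cases e p <;> rfl
      · intro he
        have hpD : ¬ D x := fun h => hDX x h hx
        have hpI := hpi ⟨x, hxm⟩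
        have := he ⟨x, hxm⟩ rfl
        simp only at hpI
        simp only [hpI, hpD, false_or, false_and, or_false, true_and] at this
        rw [← this]
        cases e x <;> rfl
    · simp only [hnx, hnm, false_and, false_or]
      refine and_congr_right fun hDn => ?_
      obtain ⟨p, hp, hpn⟩ := (ReflTransGen.cases_tail hDn).resolve_left hnm
      constructor
      · exact fun he => ⟨⟨p, hpn.1⟩, hp, decide_eq_true (.inr (.inr ⟨hp, he⟩))⟩
      · rintro ⟨q, hq, hqt⟩
        rcases of_decide_eq_true hqt with h | ⟨h, -⟩ | ⟨-, h⟩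
        · exact (hpi q h).elim
        · exact (hDX q hq (h ▸ hx)).elim
        · exact h
  · intro e _
    -- The coin of `x` becomes `true`, and that of `m` is set so that the two agree exactly if they
    -- did before. This is all that `Z` sees.
    refine ⟨fun n => if n = x then true else decide (e x = e m), ?_,
      fun c hc => decide_eq_true (.inl (hind c hc)), ?_⟩
    · intro v hv
      have : ¬ D (.obs v) := fun h => hDX _ h (hobs hv)
      simp [hsub, this]
    · intro v hv
      have := hne hXZ v hv
      simp only [hsub, this, hxm'.symm, if_true, if_false, false_or, false_and, decide_eq_decide]
      simp
  · intro e hX hZ _ v hv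
    have hne' := hne hXY v hv
    have hex : e x = e m := by
      obtain ⟨v', hv', rfl⟩ := hz
      have h1 := hZ v' hv'
      rw [decide_eq_true (p := D (.obs v')) hmz, decide_eq_true_eq] at h1
      rcases h1 with h1 | ⟨h1, -⟩ | ⟨-, h1⟩
      · exact (hsub v' h1).elim
      · exact (hne hXZ v' hv' h1).elim
      · exact h1
    simp [hsub, hne', hex]
  · refine .inr ⟨fun v hv => ?_, fun c hc => decide_eq_true (.inl (hind c hc))⟩
    simp [hsub, hne hXZ v hv]
  · intro e w hwX hw hwY
    have hwx : w x = true := by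
      obtain ⟨v, hv, rfl⟩ := hx
      rw [hwX v hv]
      simp
    have key : ∀ n, ¬ n.IsIndicator → D n → w n = true → e m = true := by
      intro n
      induction n using G.wellFounded_edge.induction with
      | _ n ih =>
        intro hnI hDn hwn
        rw [hw n (hDX n hDn), decide_eq_true_eq] at hwn
        rcases hwn with h | ⟨h, -⟩ | ⟨h, h'⟩ | ⟨-, p, hp, hwp⟩
        · exact (hnI h).elim
        · exact (hDX n hDn (h ▸ hx)).elim
        · subst h
          exact (h' ⟨x, hxm⟩ rfl).symm.trans hwx
        · exact ih p p.2 (not_isIndicator_of_edge p.2 hnI) hp hwp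
    obtain ⟨v, hv, rfl⟩ := hy
    refine key (.obs v) (hsub v) hmy ?_
    rw [hwY v hv]
    exact decide_eq_true hmy

end MGraph

/-! ### Shortest chains of sources. -/

namespace CausalGraph

open Relation

variable {N : Type*} {E : N → N → Prop} {X Y Q : Set N}

theorem exists_seq_of_reflTransGen {R : N → N → Prop} {a b : N} (h : ReflTransGen R a b) :
    ∃ (r : ℕ) (f : ℕ → N), f 0 = a ∧ f r = b ∧ ∀ i < r, R (f i) (f (i + 1)) := by
  induction h with
  | refl => exact ⟨0, fun _ => a, rfl, rfl, by simp⟩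
  | @tail b c _ hbc ih =>
    obtain ⟨r, f, h0, hr, hf⟩ := ih
    refine ⟨r + 1, fun i => if i ≤ r then f i else c, by simpa using h0, by simp, fun i hi => ?_⟩
    rcases (Nat.lt_succ_iff.1 hi).lt_or_eq with hi | rfl
    · simpa [hi.le, Nat.succ_le_of_lt hi] using hf i hi
    · simpa [hr] using hbc

/-- A shortest chain of coupled sources. -/
theorem Linked.exists_shortest (h : Linked E X Y Q) : ∃ (r : ℕ) (f : ℕ → N),
    IsStart E X Y Q (f 0) ∧ IsEnd E X Y Q (f r) ∧
    (∀ i < r, ∃ q ∈ Q, Flow E X Y Q (f i) q ∧ Flow E X Y Q (f (i + 1)) q) ∧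
    (∀ i ≤ r, ∀ x ∈ X, Flow E X Y Q (f i) x → i = 0) ∧
    (∀ i j, i + 2 ≤ j → j ≤ r → ∀ q ∈ Q, Flow E X Y Q (f i) q → ¬ Flow E X Y Q (f j) q) := by
  classical
  have hex : ∃ (r : ℕ) (f : ℕ → N), IsStart E X Y Q (f 0) ∧ IsEnd E X Y Q (f r) ∧
      ∀ i < r, Coupled E X Y Q (f i) (f (i + 1)) := by
    obtain ⟨s, t, hs, ht, hst⟩ := h
    obtain ⟨r, f, rfl, rfl, hf⟩ := exists_seq_of_reflTransGen hst
    exact ⟨r, f, hs, ht, hf⟩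
  obtain ⟨f, h0, hr, hf⟩ := Nat.find_spec hex
  have hmin := fun m (hm : m < Nat.find hex) => Nat.find_min hex hm
  generalize Nat.find hex = r at *
  have hQ : ∀ i ≤ r, f i ∉ Q := by
    intro i hi
    cases i with
    | zero => exact h0.1
    | succ i => exact (hf i hi).1
  refine ⟨r, f, h0, hr, fun i hi => (hf i hi).2, fun i hi x hx hix => ?_,
    fun i j hij hj q hq hi hjq => ?_⟩
  -- A later source that reaches `X` could itself start the chain.
  · by_contra hi0
    refine hmin (r - i) (by omega) ⟨fun k => f (k + i), ?_, ?_, fun k hk => ?_⟩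
    · simpa using ⟨hQ i hi, x, hx, hix⟩
    · simpa [Nat.sub_add_cancel hi] using hr
    · have := hf (k + i) (by omega)
      rwa [show k + i + 1 = k + 1 + i by omega] at this
  -- Sources `i` and `j` that meet in `Q` are coupled directly, which drops the `j - i - 1` sources
  -- between them.
  · refine hmin (r - (j - i - 1)) (by omega)
      ⟨fun k => if k ≤ i then f k else f (k + (j - i - 1)), by simpa using h0, ?_, fun k hk => ?_⟩
    · have h1 : ¬ r - (j - i - 1) ≤ i := by omega
      have h2 : r - (j - i - 1) + (j - i - 1) = r := by omega
      simpa only [h1, if_false, h2] using hr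
    · rcases lt_trichotomy k i with hki | rfl | hki
      · simpa only [hki.le, Nat.succ_le_of_lt hki, if_true] using hf k (by omega)
      · have h1 : k + 1 + (j - k - 1) = j := by omega
        simp only [le_refl, if_true, Nat.not_succ_le_self, if_false, h1]
        exact ⟨hQ j hj, q, hq, hi, hjq⟩
      · have h1 : ¬ k ≤ i := by omega
        have h2 : ¬ k + 1 ≤ i := by omega
        have h3 : k + 1 + (j - i - 1) = k + (j - i - 1) + 1 := by omega
        simpa only [h1, h2, if_false, h3] using hf (k + (j - i - 1)) (by omega)

end CausalGraph

/-! ### The model on a chain of sources. -/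

namespace MGraph

open CausalGraph Relation

variable {Vo Vm U : Type*} (G : MGraph Vo Vm U)

theorem isIndicator_of_desc {G : MGraph Vo Vm U} {n d : MNode Vo Vm U} (h : Desc G.edge n d)
    (hn : n.IsIndicator) : d.IsIndicator := by
  induction h with
  | refl => exact hn
  | tail _ hbc ih => exact G.indicator_edge _ _ ih hbc

/-- The data of a chain of `r + 1` sources. -/
structure SourceChain (X Y Z : Set (MNode Vo Vm U)) (C : Set (MNode Vo Vm U)) (r : ℕ) where
  src : Fin (r + 1) → MNode Vo Vm U
  flow : Fin (r + 1) → MNode Vo Vm U → Prop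
  flow_eq : flow = fun i n => Flow G.edge X Y (Z ∪ C) (src i) n
  flow_X : ∃ x ∈ X, flow 0 x
  eq_zero : ∀ i, ∀ x ∈ X, flow i x → i = 0
  coupled : ∀ i : Fin r, ∃ q ∈ Z ∪ C, flow i.castSucc q ∧ flow i.succ q
  -- With at most two sources at a node of `C`, a single bit records exactly how they compare.
  two : ∀ q ∈ C, ∀ i j k, flow i q → flow j q → flow k q → i ≠ j → k = i ∨ k = j
  last_notMem : src (Fin.last r) ∉ X
  flow_Y : ∃ y ∈ Y, flow (Fin.last r) y

namespace SourceChain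

variable {G} {X Y Z C : Set (MNode Vo Vm U)} {r : ℕ} (S : SourceChain G X Y Z C r)

/-- The edge `p → n` transmits the value of source `i`. -/
def Transmits (i : Fin (r + 1)) (p n : MNode Vo Vm U) : Prop :=
  FlowStep G.edge X Y (Z ∪ C) (S.src i) p n

/-- An indicator outside `C` that receives the value of source `i` only. -/
def Single (n : MNode Vo Vm U) (i : Fin (r + 1)) : Prop :=
  n ∉ C ∧ S.flow i n ∧ ∀ j, S.flow j n → j = i

open Classical in
/-- The value of an indicator: it copies a single source, or it checks that the sources agree. -/
def indicatorValue (s : Fin (r + 1) → Bool) (n : MNode Vo Vm U) : Prop :=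
  n ∈ ancestors G.edge C → if ∃ i, S.Single n i then ∀ i, S.Single n i → s i = true
    else ∀ i j, S.flow i n → S.flow j n → s i = s j

open Classical in
/-- The value of a variable: it copies its sources, or, in `Z`, compares them. -/
noncomputable def variableValue (s : Fin (r + 1) → Bool) (n : MNode Vo Vm U)
    (i j : Fin (r + 1)) : Bool :=
  if n ∈ Z then decide (S.flow i n ∧ S.flow j n ∧ s i ≠ s j) else decide (S.flow i n ∧ s i = true)

open Classical in
/-- The values of all nodes as a function of the values of the sources. -/
noncomputable def value (s : Fin (r + 1) → Bool) :
    ConstWorld Vo Vm U (Fin (r + 1) → Fin (r + 1) → Bool)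
  | .obs v => S.variableValue s (.obs v)
  | .lat u => S.variableValue s (.lat u)
  | .miss m => decide (S.indicatorValue s (.miss m))
  | .sel => decide (S.indicatorValue s .sel)

/-- The value of a variable. -/
def read {V : Type} [Inhabited V] :
    ∀ n : MNode Vo Vm U, n.Dom (fun _ => V) (fun _ => V) → V
  | .obs _ => fun d => d
  | .lat _ => fun d => d
  | .miss _ => fun _ => default
  | .sel => fun _ => default

/-- A variable receives the value `1` of source `i`. -/
def Receives (n : MNode Vo Vm U)
    (pa : ∀ p : {p // G.edge p n}, p.1.Dom (fun _ => Fin (r + 1) → Fin (r + 1) → Bool)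
      (fun _ => Fin (r + 1) → Fin (r + 1) → Bool)) (e : Bool) (i : Fin (r + 1)) : Prop :=
  (n = S.src i ∧ e = true) ∨ ∃ p, S.Transmits i p.1 n ∧ read p.1 (pa p) i i = true

open Classical in
/-- The structural function of a variable. -/
noncomputable def variableFunc (n : MNode Vo Vm U)
    (pa : ∀ p : {p // G.edge p n}, p.1.Dom (fun _ => Fin (r + 1) → Fin (r + 1) → Bool)
      (fun _ => Fin (r + 1) → Fin (r + 1) → Bool)) (e : Bool) (i j : Fin (r + 1)) : Bool :=
  if n ∈ Z then decide (S.flow i n ∧ S.flow j n ∧ ¬ (S.Receives n pa e i ↔ S.Receives n pa e j))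
  else decide (S.Receives n pa e i)

open Classical in
/-- The structural function of an indicator. -/
noncomputable def indicatorFunc (n : MNode Vo Vm U)
    (pa : ∀ p : {p // G.edge p n}, p.1.Dom (fun _ => Fin (r + 1) → Fin (r + 1) → Bool)
      (fun _ => Fin (r + 1) → Fin (r + 1) → Bool)) (e : Bool) : Bool :=
  decide (∃ s, (∀ p, pa p = S.value s p.1) ∧ (∀ i, n = S.src i → s i = e) ∧ S.indicatorValue s n)

/-- The structural functions of the model. -/
noncomputable def func : ∀ n : MNode Vo Vm U,
    (∀ p : {p // G.edge p n}, p.1.Dom (fun _ => Fin (r + 1) → Fin (r + 1) → Bool)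
      (fun _ => Fin (r + 1) → Fin (r + 1) → Bool)) → Bool →
    n.Dom (fun _ => Fin (r + 1) → Fin (r + 1) → Bool) (fun _ => Fin (r + 1) → Fin (r + 1) → Bool)
  | .obs v => S.variableFunc (.obs v)
  | .lat u => S.variableFunc (.lat u)
  | .miss m => S.indicatorFunc (.miss m)
  | .sel => S.indicatorFunc .sel

theorem read_value {n : MNode Vo Vm U} (hn : ¬ n.IsIndicator) (s : Fin (r + 1) → Bool) :
    read n (S.value s n) = S.variableValue s n := by
  cases n with
  | obs v => rfl
  | lat u => rfl
  | miss m => exact (hn trivial).elim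
  | sel => exact (hn trivial).elim

theorem flow_iff {i : Fin (r + 1)} {n : MNode Vo Vm U} :
    S.flow i n ↔ n = S.src i ∨ ∃ p, S.flow i p ∧ S.Transmits i p n := by
  rw [S.flow_eq]
  exact ReflTransGen.cases_tail_iff _ _ _

theorem flow_of_transmits {i : Fin (r + 1)} {p n : MNode Vo Vm U} (hp : S.flow i p)
    (h : S.Transmits i p n) : S.flow i n := S.flow_iff.2 (.inr ⟨p, hp, h⟩)

/-- A transmitting parent lies outside `Z`, so it holds the bit of source `i` itself and not a
comparison. -/
theorem receives_value_iff {n : MNode Vo Vm U} (hn : ¬ n.IsIndicator)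
    (e : MNode Vo Vm U → Bool) (i : Fin (r + 1)) :
    S.Receives n (fun p => S.value (fun i => e (S.src i)) p.1) (e n) i ↔
      S.flow i n ∧ e (S.src i) = true := by
  have hpar : ∀ p : {p // G.edge p n}, S.Transmits i p.1 n →
      (read p.1 (S.value (fun i => e (S.src i)) p.1) i i = true ↔
        S.flow i p.1 ∧ e (S.src i) = true) := by
    intro p hp
    have hpZ : p.1 ∉ Z := fun h => hp.2.1 (.inl h)
    rw [S.read_value (not_isIndicator_of_edge p.2 hn), variableValue, if_neg hpZ]
    classical exact decide_eq_true_iff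
  rw [S.flow_iff]
  constructor
  · rintro (⟨rfl, he⟩ | ⟨p, hp, hr⟩)
    · exact ⟨.inl rfl, he⟩
    · have := (hpar p hp).1 hr
      exact ⟨.inr ⟨p, this.1, hp⟩, this.2⟩
  · rintro ⟨rfl | ⟨p, hp, hpn⟩, he⟩
    · exact .inl ⟨rfl, he⟩
    · exact .inr ⟨⟨p, hpn.1.1⟩, hpn, (hpar ⟨p, hpn.1.1⟩ hpn).2 ⟨hp, he⟩⟩

theorem variableValue_eq {n : MNode Vo Vm U} (hn : ¬ n.IsIndicator)
    (e : MNode Vo Vm U → Bool) :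
    S.variableValue (fun i => e (S.src i)) n =
      S.variableFunc n (fun p => S.value (fun i => e (S.src i)) p.1) (e n) := by
  funext i j
  unfold variableValue variableFunc
  split_ifs with hZ
  · rw [decide_eq_decide]
    refine and_congr_right fun hi => and_congr_right fun hj => ?_
    rw [S.receives_value_iff hn, S.receives_value_iff hn, ne_eq, Bool.eq_iff_iff]
    simp only [hi, hj, true_and]
  · rw [decide_eq_decide, S.receives_value_iff hn]

theorem value_of_isIndicator {n : MNode Vo Vm U} (hn : n.IsIndicator) {s s' : Fin (r + 1) → Bool}
    (h : S.value s n = S.value s' n) : S.indicatorValue s n ↔ S.indicatorValue s' n := by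
  cases n with
  | obs v => exact hn.elim
  | lat u => exact hn.elim
  | miss m => exact decide_eq_decide.1 h
  | sel => exact decide_eq_decide.1 h

/-- No indicator reaches `X` or `Z`, so one that is an ancestor of `C` passes all its sources on to
a single node of `C`, where `two` applies. -/
theorem eq_or_eq_of_flow (hX : ∀ n ∈ X, ¬ n.IsIndicator) (hZ : ∀ n ∈ Z, ¬ n.IsIndicator)
    {n : MNode Vo Vm U} (hn : n.IsIndicator) (hnC : n ∈ ancestors G.edge C) {i j k : Fin (r + 1)}
    (hi : S.flow i n) (hj : S.flow j n) (hk : S.flow k n) (hij : i ≠ j) : k = i ∨ k = j := by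
  obtain ⟨d, hd, hnd⟩ := hnC
  have hnX : n ∉ X := fun h => hX n h hn
  obtain ⟨q, hq, hnq⟩ := flow_of_desc (Y := Y) (Q := Z ∪ C) hnX (.inr hd) hnd
  have hqi := isIndicator_of_desc hnq.desc hn
  have hqC : q ∈ C := by
    rcases hq with (hq | hq) | hq
    · exact (hZ q hq hqi).elim
    · exact hq
    · exact (hX q hq hqi).elim
  have key : ∀ l, S.flow l n → S.flow l q := by
    intro l hl
    rw [S.flow_eq] at hl ⊢
    exact hl.trans hnX hnq
  exact S.two q hqC i j k (key i hi) (key j hj) (key k hk) hij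

/-- The values of the parents of an indicator determine the values of its sources up to
comparison. -/
theorem eq_or_exists_of_flow (hX : ∀ n ∈ X, ¬ n.IsIndicator) (hZ : ∀ n ∈ Z, ¬ n.IsIndicator)
    {n : MNode Vo Vm U} (hnC : n ∈ ancestors G.edge C)
    {s s' : Fin (r + 1) → Bool} (hpa : ∀ p, G.edge p n → S.value s p = S.value s' p)
    {i : Fin (r + 1)} (hsrc : n = S.src i → s i = s' i) (hi : S.flow i n) :
    s i = s' i ∨ ∃ j, j ≠ i ∧ S.flow j n ∧ (s i = s j ↔ s' i = s' j) := by
  rcases S.flow_iff.1 hi with rfl | ⟨p, hip, hpn⟩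
  · exact .inl (hsrc rfl)
  have hpar := hpa p hpn.1.1
  by_cases hp : p.IsIndicator
  · have hpC : p ∈ ancestors G.edge C := by
      obtain ⟨d, hd, hnd⟩ := hnC
      exact ⟨d, hd, hnd.head hpn.1.1⟩
    have hpC' : p ∉ C := fun h => hpn.2.1 (.inr h)
    have hval := S.value_of_isIndicator hp hpar
    unfold indicatorValue at hval
    -- An indicator parent with one source shows its bit. With two it shows only whether they agree,
    -- but then both flow on to `n`.
    by_cases hs : ∃ k, S.Single p k
    · obtain ⟨k, hk⟩ := hs
      obtain rfl := hk.2.2 i hip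
      have h1 : ∀ t : Fin (r + 1) → Bool, (∀ j, S.Single p j → t j = true) ↔ t i = true :=
        fun t => ⟨fun h => h i hk, fun h j hj => hj.2.2 i hip ▸ h⟩
      simp only [hpC, true_imp_iff, if_pos (⟨i, hk⟩ : ∃ k, S.Single p k), h1] at hval
      exact .inl (Bool.eq_iff_iff.2 hval)
    · obtain ⟨j, hj, hji⟩ : ∃ j, S.flow j p ∧ j ≠ i := by
        by_contra! h
        exact hs ⟨i, hpC', hip, h⟩
      have h1 : ∀ t : Fin (r + 1) → Bool,
          (∀ k l, S.flow k p → S.flow l p → t k = t l) ↔ t i = t j := by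
        refine fun t => ⟨fun h => h i j hip hj, fun h k l hk hl => ?_⟩
        rcases S.eq_or_eq_of_flow hX hZ hp hpC hip hj hk hji.symm with rfl | rfl <;>
        rcases S.eq_or_eq_of_flow hX hZ hp hpC hip hj hl hji.symm with rfl | rfl <;>
        simp [h]
      simp only [hpC, true_imp_iff, if_neg hs, h1] at hval
      exact .inr ⟨j, hji, S.flow_of_transmits hj
        ⟨hpn.1, hpn.2.1, .inl fun h => hX p h hp⟩, hval⟩
  · have hpZ : p ∉ Z := fun h => hpn.2.1 (.inl h)
    have := congrArg (fun d => read (V := Fin (r + 1) → Fin (r + 1) → Bool) p d i i) hpar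
    simp only [S.read_value hp, variableValue, if_neg hpZ, decide_eq_decide, hip, true_and] at this
    exact .inl (Bool.eq_iff_iff.2 this)

/-- A sole source must have arrived as a plain bit. If two arrive, their agreement can be recovered
from two bits or from one comparison. -/
theorem indicatorValue_of_eq (hX : ∀ n ∈ X, ¬ n.IsIndicator) (hZ : ∀ n ∈ Z, ¬ n.IsIndicator)
    {n : MNode Vo Vm U} (hn : n.IsIndicator)
    {s s' : Fin (r + 1) → Bool} (hpa : ∀ p, G.edge p n → S.value s p = S.value s' p)
    (hsrc : ∀ i, n = S.src i → s i = s' i) (h : S.indicatorValue s n) :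
    S.indicatorValue s' n := by
  intro hnC
  have h := h hnC
  have key := fun i => S.eq_or_exists_of_flow hX hZ hnC hpa (hsrc i)
  split_ifs at h ⊢ with hs
  · intro i hi
    rcases key i hi.2.1 with he | ⟨j, hj, hjn, -⟩
    · exact he ▸ h i hi
    · exact (hj (hi.2.2 j hjn)).elim
  · intro i j hi hj
    have hij := h i j hi hj
    rcases key i hi with he | ⟨k, hk, hkn, he⟩
    · rcases key j hj with he' | ⟨k, hk, hkn, he'⟩
      · rw [← he, ← he', hij]
      · rcases S.eq_or_eq_of_flow hX hZ hn hnC hj hkn hi hk.symm with rfl | rfl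
        · rfl
        · exact (he'.1 hij.symm).symm
    · rcases S.eq_or_eq_of_flow hX hZ hn hnC hi hkn hj hk.symm with rfl | rfl
      · rfl
      · exact he.1 hij

/-- `indicatorFunc` guesses source values that explain the parents and the noise. By
`indicatorValue_of_eq` all guesses give the same answer, so the true values may be used. -/
theorem indicatorValue_eq (hX : ∀ n ∈ X, ¬ n.IsIndicator) (hZ : ∀ n ∈ Z, ¬ n.IsIndicator)
    {n : MNode Vo Vm U} (hn : n.IsIndicator) (e : MNode Vo Vm U → Bool) :
    open Classical in decide (S.indicatorValue (fun i => e (S.src i)) n) =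
      S.indicatorFunc n (fun p => S.value (fun i => e (S.src i)) p.1) (e n) := by
  classical
  unfold indicatorFunc
  rw [decide_eq_decide]
  constructor
  · intro h
    exact ⟨_, fun _ => rfl, fun i hi => by rw [hi], h⟩
  · rintro ⟨s, hs, hsrc, h⟩
    exact S.indicatorValue_of_eq hX hZ hn (fun p hp => (hs ⟨p, hp⟩).symm)
      (fun i hi => (hsrc i hi).trans (by rw [hi])) h

theorem value_eq (hX : ∀ n ∈ X, ¬ n.IsIndicator) (hZ : ∀ n ∈ Z, ¬ n.IsIndicator)
    (e : MNode Vo Vm U → Bool) (n : MNode Vo Vm U) :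
    S.value (fun i => e (S.src i)) n =
      S.func n (fun p => S.value (fun i => e (S.src i)) p.1) (e n) := by
  cases n with
  | obs v => exact S.variableValue_eq id e
  | lat u => exact S.variableValue_eq id e
  | miss m => exact S.indicatorValue_eq hX hZ (n := .miss m) trivial e
  | sel => exact S.indicatorValue_eq hX hZ (n := .sel) trivial e

theorem indicatorValue_of_mem {n : MNode Vo Vm U} (hn : n ∈ C) (s : Fin (r + 1) → Bool) :
    S.indicatorValue s n ↔ ∀ i j, S.flow i n → S.flow j n → s i = s j := by
  unfold indicatorValue
  rw [if_neg (by rintro ⟨i, hi⟩; exact hi.1 hn)]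
  exact ⟨fun h => h (subset_ancestors _ hn), fun h _ => h⟩

end SourceChain

end MGraph

/-! ### The chain model refutes the formula. -/

namespace MGraph

open CausalGraph Relation

namespace SourceChain

variable {Vo Vm U : Type*} {G : MGraph Vo Vm U}

section

variable {X Y Z C : Set (MNode Vo Vm U)} {r : ℕ} (S : SourceChain G X Y Z C r)

/-- By `eq_zero`, source 0 is the only one that reaches `X`. -/
theorem variableValue_of_mem {n : MNode Vo Vm U} (hn : n ∈ X) (hZ : n ∉ Z)
    {s : Fin (r + 1) → Bool} (hs : s 0 = true) :
    S.variableValue s n = S.variableValue (fun _ => true) n := by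
  funext i j
  simp only [variableValue, if_neg hZ, decide_eq_decide]
  refine and_congr_right fun hi => ?_
  obtain rfl := S.eq_zero i n hn hi
  simp [hs]

theorem variableValue_not {n : MNode Vo Vm U} (hn : n ∈ Z) (s : Fin (r + 1) → Bool) :
    S.variableValue (fun i => !s i) n = S.variableValue s n := by
  funext i j
  simp [variableValue, hn]

/-- `X` reveals source 0, and each coupling hands the value on: a node of `Z` shows no disagreement,
a node of `C` certifies agreement. -/
theorem eq_true_of_value {s : Fin (r + 1) → Bool} (hXZ : Disjoint X Z)
    (hX : ∀ n ∈ X, S.variableValue s n = S.variableValue (fun _ => true) n)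
    (hZ : ∀ n ∈ Z, S.variableValue s n = S.variableValue (fun _ => false) n)
    (hC : ∀ n ∈ C, S.indicatorValue s n) (i : Fin (r + 1)) : s i = true := by
  induction i using Fin.induction with
  | zero =>
    obtain ⟨x, hx, h0⟩ := S.flow_X
    have := congrFun (congrFun (hX x hx) 0) 0
    simpa [variableValue, Set.disjoint_left.1 hXZ hx, h0] using this
  | succ i ih =>
    obtain ⟨q, hq | hq, h1, h2⟩ := S.coupled i
    · have := congrFun (congrFun (hZ q hq) i.castSucc) i.succ
      simpa [variableValue, hq, h1, h2, ih] using this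
    · exact ((S.indicatorValue_of_mem hq s).1 (hC q hq) _ _ h1 h2).symm.trans ih

theorem not_isIndicator_of_mem_nodes {A : Finset (Vo ⊕ Vm)} {n : MNode Vo Vm U}
    (hn : n ∈ nodes U A) : ¬ n.IsIndicator := by
  obtain ⟨v, -, rfl⟩ := hn
  exact id

theorem read_func {n : MNode Vo Vm U} (hn : ¬ n.IsIndicator)
    (pa : ∀ p : {p // G.edge p n}, p.1.Dom (fun _ => Fin (r + 1) → Fin (r + 1) → Bool)
      (fun _ => Fin (r + 1) → Fin (r + 1) → Bool)) (e : Bool) :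
    read n (S.func n pa e) = S.variableFunc n pa e := by
  cases n with
  | obs v => rfl
  | lat u => rfl
  | miss m => exact (hn trivial).elim
  | sel => exact (hn trivial).elim

/-- The flow of the last source never leaves a node of `X`, so the intervention neither blocks nor
imitates it: a received bit stems from the noise of that source. -/
theorem eq_true_of_read [Fintype Vo] [Fintype Vm] [Fintype U] (e : MNode Vo Vm U → Bool)
    (w : ConstWorld Vo Vm U (Fin (r + 1) → Fin (r + 1) → Bool))
    (hw : ∀ n ∉ X, w n = S.func n (fun p => w p.1) (e n)) {n : MNode Vo Vm U}
    (hn : ¬ n.IsIndicator) (hX : n ∉ X) (hZ : n ∉ Z)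
    (h : read n (w n) (Fin.last r) (Fin.last r) = true) : e (S.src (Fin.last r)) = true := by
  classical
  induction n using G.wellFounded_edge.induction with
  | _ n ih =>
    rw [hw n hX, S.read_func hn, variableFunc, if_neg hZ, decide_eq_true_eq] at h
    rcases h with ⟨rfl, h⟩ | ⟨p, hp, hr⟩
    · exact h
    · exact ih p.1 p.2 (not_isIndicator_of_edge p.2 hn)
        (hp.2.2.elim id fun h => h ▸ S.last_notMem) (fun h => hp.2.1 (.inl h)) hr

end

variable [Fintype Vo] [Fintype Vm] [Fintype U] [DecidableEq Vo] [DecidableEq Vm] [DecidableEq U]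

theorem not_isMSAdjustmentSet {X Y Z : Finset (Vo ⊕ Vm)} {r : ℕ} (hXY : Disjoint X Y)
    (hXZ : Disjoint X Z) (hYZ : Disjoint Y Z)
    (S : SourceChain G (nodes U X) (nodes U Y) (nodes U Z) (indicators U (missingPart X Y Z)) r) :
    ¬ G.IsMSAdjustmentSet X Y Z := by
  classical
  have hI : ∀ {A : Finset (Vo ⊕ Vm)}, ∀ n ∈ nodes U A, ¬ n.IsIndicator :=
    fun n hn => not_isIndicator_of_mem_nodes hn
  have hC : ∀ s, (S.value s ∈ {w : ConstWorld Vo Vm U (Fin (r + 1) → Fin (r + 1) → Bool) |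
      (∀ m ∈ missingPart X Y Z, w (.miss m) = true) ∧ w .sel = true}) ↔
      ∀ c ∈ indicators U (missingPart X Y Z), S.indicatorValue s c := by
    intro s
    constructor
    · rintro ⟨h1, h2⟩ _ (⟨m, hm, rfl⟩ | rfl)
      · exact of_decide_eq_true (h1 m hm)
      · exact of_decide_eq_true h2
    · exact fun h => ⟨fun m hm => decide_eq_true (h _ (.inl ⟨m, hm, rfl⟩)),
        decide_eq_true (h _ (.inr rfl))⟩
  have hC0 : ∀ b : Bool, ∀ c ∈ indicators U (missingPart X Y Z),
      S.indicatorValue (fun _ => b) c := fun b c hc =>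
    (S.indicatorValue_of_mem hc _).2 fun _ _ _ _ => rfl
  have hXZ' : Disjoint (nodes U X) (nodes U Z) := SCM.disjoint_nodes hXZ
  have hobs : ∀ {A : Finset (Vo ⊕ Vm)} {v}, v ∈ A → (MNode.obs v : MNode Vo Vm U) ∈ nodes U A :=
    fun hv => ⟨_, hv, rfl⟩
  refine not_isMSAdjustmentSet_of_func (Fin (r + 1) → Fin (r + 1) → Bool) S.func
    (fun e => S.value fun i => e (S.src i)) (S.value_eq hI hI)
    -- `x` and `y` are taken with all sources `true`, `z` with all `false`. As `Z` sees only
    -- comparisons, `z` fits both cases, and the likely all-`false` noise produces it.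
    (fun v => S.variableValue (fun _ => true) (.obs v))
    (fun v => S.variableValue (fun _ => true) (.obs v))
    (fun v => S.variableValue (fun _ => false) (.obs v)) (S.src (Fin.last r))
    {w | (∀ m ∈ missingPart X Y Z, w (.miss m) = true) ∧ w .sel = true} (fun _ => Iff.rfl)
    ⟨fun _ => false, (hC _).2 (hC0 false)⟩ ?_ ?_
    (.inr ⟨fun _ _ => rfl, (hC _).2 (hC0 false)⟩) ?_
  · intro e he
    cases h0 : e (S.src 0) with
    | true =>
      exact ⟨e, fun v hv => S.variableValue_of_mem (hobs hv)
        (Set.disjoint_left.1 hXZ' (hobs hv)) h0, he, fun _ _ => rfl⟩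
    | false =>
      -- Flipping every noise makes source 0 `true` and changes neither the comparisons in `Z` nor
      -- the agreements in `C`.
      refine ⟨fun n => !e n, fun v hv => S.variableValue_of_mem (hobs hv)
        (Set.disjoint_left.1 hXZ' (hobs hv)) (by simp [h0]), (hC _).2 fun c hc => ?_,
        fun v hv => S.variableValue_not (hobs hv) fun i => e (S.src i)⟩
      exact (S.indicatorValue_of_mem hc _).2 fun i j hi hj => congrArg not
        ((S.indicatorValue_of_mem hc _).1 ((hC _).1 he c hc) i j hi hj)
  · intro e hX hZ he v hv
    have := S.eq_true_of_value hXZ' (s := fun i => e (S.src i))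
      (by rintro _ ⟨v, hv, rfl⟩; exact hX v hv) (by rintro _ ⟨v, hv, rfl⟩; exact hZ v hv)
      ((hC _).1 he)
    exact congrArg (fun s => S.variableValue s (.obs v)) (funext this)
  · intro e w _ hw hY
    obtain ⟨y, hy, hyl⟩ := S.flow_Y
    have hyZ := Set.disjoint_left.1 (SCM.disjoint_nodes (U := U) hYZ) hy
    have hyX := Set.disjoint_right.1 (SCM.disjoint_nodes (U := U) hXY) hy
    refine S.eq_true_of_read e w hw (hI y hy) hyX hyZ ?_
    obtain ⟨v, hv, rfl⟩ := hy
    have := congrFun (congrFun (hY v hv) (Fin.last r)) (Fin.last r)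
    refine this.trans ?_
    simp [variableValue, hyZ, hyl]

end SourceChain

variable {Vo Vm U : Type*} {G : MGraph Vo Vm U}
variable [Fintype Vo] [Fintype Vm] [Fintype U] [DecidableEq Vo] [DecidableEq Vm] [DecidableEq U]

theorem IsMSAdjustmentSet.not_linked {X Y Z : Finset (Vo ⊕ Vm)} (h : G.IsMSAdjustmentSet X Y Z)
    (hXY : Disjoint X Y) (hXZ : Disjoint X Z) (hYZ : Disjoint Y Z) :
    ¬ Linked G.edge (nodes U X) (nodes U Y)
      (nodes U Z ∪ indicators U (missingPart X Y Z)) := by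
  intro hL
  obtain ⟨r, f, h0, hr, hf, hX, htwo⟩ := hL.exists_shortest
  let S : SourceChain G (nodes U X) (nodes U Y) (nodes U Z)
      (indicators U (missingPart X Y Z)) r :=
    { src := fun i => f i
      flow := fun i n => Flow G.edge (nodes U X) (nodes U Y)
        (nodes U Z ∪ indicators U (missingPart X Y Z)) (f i) n
      flow_eq := rfl
      flow_X := h0.2
      eq_zero := fun i x hx hi => Fin.ext (hX i i.is_le x hx hi)
      coupled := fun i => hf i i.2
      two := by
        intro q hq i j k hi hj hk hij
        have key : ∀ a b : Fin (r + 1), ∀ ha : Flow G.edge (nodes U X) (nodes U Y)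
            (nodes U Z ∪ indicators U (missingPart X Y Z)) (f a) q,
            ∀ hb : Flow G.edge (nodes U X) (nodes U Y)
            (nodes U Z ∪ indicators U (missingPart X Y Z)) (f b) q, (b : ℕ) < a + 2 := by
          intro a b ha hb
          by_contra! hab
          exact htwo a b hab b.is_le q (.inr hq) ha hb
        have h1 := key i j hi hj
        have h2 := key j i hj hi
        have h3 := key i k hi hk
        have h4 := key k i hk hi
        have h5 := key j k hj hk
        have h6 := key k j hk hj
        have h7 : (i : ℕ) ≠ j := fun h => hij (Fin.ext h)
        -- Indices that pairwise differ by at most one take at most two values.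
        have h8 : (k : ℕ) = i ∨ (k : ℕ) = j := by omega
        exact h8.imp Fin.ext Fin.ext
      last_notMem := hr.2.1
      flow_Y := hr.2.2 }
  exact S.not_isMSAdjustmentSet hXY hXZ hYZ h

theorem sourceCriterion_of_isMSAdjustmentSet {X Y Z : Finset (Vo ⊕ Vm)} (hXY : Disjoint X Y)
    (hXZ : Disjoint X Z) (hYZ : Disjoint Y Z) (h : G.IsMSAdjustmentSet X Y Z) :
    SourceCriterion G.edge (nodes U X) (nodes U Y) (nodes U Z)
      (indicators U (missingPart X Y Z)) where
  not_desc _ hx _ hxm hm _ hz := h.not_desc hXY hXZ hx hxm hm hz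
  not_anc _ ht _ hc := h.not_anc ht hc
  not_linked := h.not_linked hXY hXZ hYZ

end MGraph

theorem theorem6 {Vo Vm U : Type*} [Fintype Vo] [Fintype Vm] [Fintype U]
    [DecidableEq Vo] [DecidableEq Vm] [DecidableEq U]
    (G : MGraph Vo Vm U) (X Y Z : Finset (Vo ⊕ Vm))
    (hXY : Disjoint X Y) (hXZ : Disjoint X Z) (hYZ : Disjoint Y Z) :
    G.IsMSAdjustmentSet X Y Z ↔ G.MSAdjustmentCriterion X Y Z := by
  have dXY := MGraph.SCM.disjoint_nodes (U := U) hXY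
  have dZX := MGraph.SCM.disjoint_nodes (U := U) hXZ.symm
  have dZY := MGraph.SCM.disjoint_nodes (U := U) hYZ.symm
  have dC := fun A : Finset (Vo ⊕ Vm) =>
    MGraph.SCM.disjoint_indicators (U := U) A (MGraph.missingPart X Y Z)
  constructor
  · intro h
    have hS := MGraph.sourceCriterion_of_isMSAdjustmentSet hXY hXZ hYZ h
    exact
      { no_forbidden := fun x hx y hy p hp hc hpX w hw hwX z hz =>
          hS.no_forbidden hx hy hp hc hpX hw hwX hz
        blocks := fun x hx y hy p hp hc hpX =>
          hS.blocked G.acyclic dXY (Set.disjoint_union_left.2 ⟨dZX, dC X⟩)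
            (Set.disjoint_union_left.2 ⟨dZY, dC Y⟩) hx hy hp hc hpX
        indicators_sep := hS.dSep_deleteIn dXY (dC X)
        ancestors_sep := fun x hx hxC => hS.dSep_deleteOut dXY hx hxC }
  · intro h M x y hdef
    exact MGraph.SCM.probDo_eq_of_sourceCriterion hXY hXZ hYZ
      (CausalGraph.sourceCriterion_of_paths G.acyclic dXY dZX (dC X) h.no_forbidden h.blocks h.indicators_sep
        h.ancestors_sep) x y hdef
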